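/- Theorem (Set Cover). An instance of Set Cover consists of a family $\mathcal F=\{S_1,\dots,S_m\}$ of $m$ distinct subsets of a ground set $U$ with $|U|=n$ and an integer $k\ge 0$; the task is to find a subfamily $\mathcal C\subseteq\mathcal F$ with $|\mathcal C|=k$ and $\bigcup_{S\in\mathcal C}S=U$, or to report that there is none. There are a deterministic algorithm for Set Cover and a constant $c$ such that the following holds. The algorithm halts with a correct answer on every instance, and whenever $\alpha$ is the largest real number with $0<\alpha\le 1/2$ and $$\Bigl|\Bigl\{\,\bigcup_{S\in\mathcal C}S \;:\; \mathcal C\subseteq\mathcal F,\ |\mathcal C|=k\Bigr\}\Bigr|\;\le\;2^{(1-\alpha)n}$$ (such an $\alpha$ exists unless $n\ge1$ and every subset of $U$ is such a union), its running time on the instance is at most $$c\,(N+1)^c\cdot 2^{(1-\alpha/2)n},$$ and it uses at most $c\,(N+1)^c\cdot 2^{n}$ bits of space (exponential space). Here $N=n+m+mn+\ell(k)$ is the input size, where $\ell(k)$ is the length of the binary representation of $k$ ($\ell(0)=0$). The number $\alpha$ is not part of the input. The computation model is the random access machine with integer registers, indirectly addressed memory, and the operations $+,-,\times$ and integer division,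 under the logarithmic cost criterion: each instruction and each test costs the total bit length of the addresses and integers involved. -/

import Mathlib

/-! ### Random access machine with logarithmic cost -/

namespace RAM

/-- Number of bits used to write an integer (absolute value and sign). -/
def bits (z : ℤ) : ℕ := Nat.size z.natAbs + 1

/-- A machine state: registers, which instructions address directly, and a memory, which is
addressed indirectly through registers. All but finitely many cells are zero. -/
structure State where
  reg : ℕ →₀ ℤ
  mem : ℕ →₀ ℤ

/-- Bits needed to store the nonzero cells, each together with its address. -/
noncomputable def cellBits (f : ℕ →₀ ℤ) : ℕ := f.sum fun a z => bits a + bits z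

/-- Space occupied by a state, in bits. -/
noncomputable def State.space (s : State) : ℕ := cellBits s.reg + cellBits s.mem

/-- The arithmetic operations (integer division, with value `0` for the divisor `0`). -/
inductive Arith
  | add | sub | mul | div

def Arith.eval : Arith → ℤ → ℤ → ℤ
  | .add, x, y => x + y
  | .sub, x, y => x - y
  | .mul, x, y => x * y
  | .div, x, y => x / y

/-- Instructions; `R` stands for the registers and `M` for the memory. -/
inductive Instr
  /-- `R[i] := c` -/
  | const (i : ℕ) (c : ℤ)
  /-- `R[i] := R[j] o R[k]` -/
  | arith (o : Arith) (i j k : ℕ)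
  /-- `R[i] := M[R[j]]` -/
  | load (i j : ℕ)
  /-- `M[R[i]] := R[j]` -/
  | store (i j : ℕ)

/-- Effect of an instruction. A negative address is read as `0`. -/
noncomputable def Instr.effect : Instr → State → State
  | .const i c, s => { s with reg := s.reg.update i c }
  | .arith o i j k, s => { s with reg := s.reg.update i (o.eval (s.reg j) (s.reg k)) }
  | .load i j, s => { s with reg := s.reg.update i (s.mem (s.reg j).toNat) }
  | .store i j, s => { s with mem := s.mem.update (s.reg i).toNat (s.reg j) }

/-- Cost of reading register `i`: the lengths of its index and of its content. -/
def State.readCost (s : State) (i : ℕ) : ℕ := bits i + bits (s.reg i)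

/-- Logarithmic cost: the total length of all addresses and all integers that are involved. -/
def Instr.cost : Instr → State → ℕ
  | .const i c, _ => bits i + bits c
  | .arith o i j k, s =>
      bits i + s.readCost j + s.readCost k + bits (o.eval (s.reg j) (s.reg k))
  | .load i j, s => bits i + s.readCost j + bits (s.mem (s.reg j).toNat)
  | .store i j, s => s.readCost i + s.readCost j

/-- Structured programs: instructions, sequencing, the conditional `if R[i] > 0 then P else Q`
and the loop `while R[i] > 0 do P`. -/
inductive Prog
  | skip
  | instr (a : Instr)
  | seq (P Q : Prog)
  | ite (i : ℕ) (P Q : Prog)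
  | loop (i : ℕ) (P : Prog)

/-- `Exec P s t p s'`: started in state `s`, the program `P` halts in state `s'`, its running time
is `t` (the total cost of the executed instructions and tests), and `p` is the largest space
occupied by a state of the run. -/
inductive Exec : Prog → State → ℕ → ℕ → State → Prop
  | skip (s : State) : Exec .skip s 1 s.space s
  | instr (a : Instr) (s : State) :
      Exec (.instr a) s (a.cost s) (max s.space (a.effect s).space) (a.effect s)
  | seq {P Q : Prog} {s s₁ s₂ : State} {t₁ t₂ p₁ p₂ : ℕ} :
      Exec P s t₁ p₁ s₁ → Exec Q s₁ t₂ p₂ s₂ →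
      Exec (.seq P Q) s (t₁ + t₂) (max p₁ p₂) s₂
  | itePos {i : ℕ} {P Q : Prog} {s s₁ : State} {t p : ℕ} :
      0 < s.reg i → Exec P s t p s₁ → Exec (.ite i P Q) s (s.readCost i + t) p s₁
  | iteNonpos {i : ℕ} {P Q : Prog} {s s₁ : State} {t p : ℕ} :
      s.reg i ≤ 0 → Exec Q s t p s₁ → Exec (.ite i P Q) s (s.readCost i + t) p s₁
  | loopDone {i : ℕ} {P : Prog} {s : State} :
      s.reg i ≤ 0 → Exec (.loop i P) s (s.readCost i) s.space s
  | loopStep {i : ℕ} {P : Prog} {s s₁ s₂ : State} {t₁ t₂ p₁ p₂ : ℕ} :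
      0 < s.reg i → Exec P s t₁ p₁ s₁ → Exec (.loop i P) s₁ t₂ p₂ s₂ →
      Exec (.loop i P) s (s.readCost i + t₁ + t₂) (max p₁ p₂) s₂

/-- Initial state: the input word stands in the memory from address `0` on, all else is zero. -/
noncomputable def State.init (w : List ℤ) : State where
  reg := 0
  mem := w.toFinsupp

end RAM

/-! ### Set Cover -/

/-- An instance of Set Cover: a ground set with `n` elements, a family of `m` distinct subsets in
the order in which it is presented, and the number `k` of sets to choose. -/
structure SetCover where
  n : ℕ
  m : ℕ
  k : ℕ
  sets : Fin m → Finset (Fin n)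
  sets_injective : Function.Injective sets

namespace SetCover

variable (I : SetCover)

/-- The set family. -/
def family : Finset (Finset (Fin I.n)) := Finset.univ.image I.sets

/-- `C` is a subfamily of exactly `k` sets that covers the ground set. -/
def IsSolution (C : Finset (Finset (Fin I.n))) : Prop :=
  C ⊆ I.family ∧ C.card = I.k ∧ C.biUnion id = Finset.univ

/-- The distinct unions of subfamilies of exactly `k` sets. -/
def unions : Finset (Finset (Fin I.n)) :=
  (I.family.powersetCard I.k).image fun C => C.biUnion id

/-- The input word: `n`, `m`, `k`, followed by the rows of the `m × n` incidence matrix. -/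
def input : List ℤ :=
  (I.n : ℤ) :: (I.m : ℤ) :: (I.k : ℤ) ::
    List.ofFn fun p : Fin (I.m * I.n) => if p.modNat ∈ I.sets p.divNat then 1 else 0

/-- The input size: ground set, family and incidence matrix are written out, `k` is in binary. -/
def size : ℕ := I.n + I.m + I.m * I.n + Nat.size I.k

/-- The final state `s` presents a correct answer: either register `0` holds `1` and memory
cells `0, …, m - 1` hold the indicator vector of a solution, or register `0` holds `0` and there
is no solution. -/
def Answers (s : RAM.State) : Prop :=
  (s.reg 0 = 1 ∧ ∃ C, I.IsSolution C ∧
    ∀ i : Fin I.m, s.mem i = if I.sets i ∈ C then 1 else 0) ∨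
  (s.reg 0 = 0 ∧ ¬ ∃ C, I.IsSolution C)

end SetCover

/-! For `X ⊆ U` let `T(X)` be the number of injective `k`-tuples of sets of the family that avoid
`X`. It is a falling factorial of the number of sets that avoid `X`, hence computable in polynomial
time, and it equals `k!` times the number of `k`-subfamilies whose union avoids `X` (`tuples_eq`).
Inclusion–exclusion, `∑ (-1)^|X| T(X)`, counts the solutions up to the factor `k!`, but it has `2^n`
terms.

To shorten the sum, split `U` into its first `a` elements and the remaining `n - a`. On the second
part plain inclusion–exclusion is kept. On the first part the sign of `X` is multiplied by a
coefficient `c(X)`. A subfamily whose union misses exactly the set `V` of the first part then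
contributes, up to sign, the Möbius transform of `c` at `V`, and this only has to be `[V = ∅]` for
those `V` that really occur. Which `V` occur is found by a Möbius transform of `T` on the first part
(`pattern_eq`, `pattern_pos_iff`). The transform is unitriangular for inclusion, so the system
restricted to the occurring `V` has a solution `c` that vanishes elsewhere, and `a + 1` rounds of
residual correction find it (`mob_corr`). The resulting identity is `sum_corr_eq`.

If `q` sets `V` occur, the sum has `q * 2^(n-a)` nonzero terms, and the preparation takes `2^a`
steps up to polynomial factors. Distinct `V` come from distinct unions (`card_pattern_le`), so `q ≤
2^((1-α)n)`, and `a = ⌈(1 - α/2) n⌉` balances both costs. The program does not know `α`: it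
increases `a` until the measured `q` satisfies the balance condition (`runs_search`), which happens
at that `a` at the latest. A solution is obtained from the decision procedure by deleting sets that
are not needed (`runs_greedy`).

On the machine, all stored values stay below a bound `M` with polynomially many bits, so each
elementary step costs a polynomial. Space is at most the initial space plus the time, and the time
is always `2^n` up to a polynomial factor because `a ≤ n`. -/

namespace RAM

/-! ### Space is bounded by time -/

theorem cellBits_update_le (f : ℕ →₀ ℤ) (a : ℕ) (z : ℤ) :
    cellBits (f.update a z) ≤ cellBits f + (bits a + bits z) := by
  classical
  unfold cellBits Finsupp.sum
  have hsub : (f.update a z).support ⊆ insert a (f.support.erase a) := by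
    intro x hx
    rw [Finsupp.mem_support_iff, Finsupp.coe_update] at hx
    by_cases h : x = a
    · simp [h]
    · simp [h] at hx ⊢
      exact hx
  refine (Finset.sum_le_sum_of_subset hsub).trans ?_
  rw [Finset.sum_insert (by simp), add_comm]
  refine add_le_add ?_ (by simp)
  calc ∑ x ∈ f.support.erase a, (bits x + bits (f.update a z x))
      = ∑ x ∈ f.support.erase a, (bits x + bits (f x)) := by
        refine Finset.sum_congr rfl fun x hx => ?_
        rw [Finsupp.coe_update, Function.update_of_ne (Finset.ne_of_mem_erase hx)]
    _ ≤ _ := Finset.sum_le_sum_of_subset (Finset.erase_subset _ _)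

theorem bits_toNat_le (z : ℤ) : bits (z.toNat : ℤ) ≤ bits z := by
  unfold bits
  have : ((z.toNat : ℤ)).natAbs ≤ z.natAbs := by omega
  have := Nat.size_le_size this
  omega

/-- The logarithmic cost includes the address and the content of the cell that is written, and the
state grows by no more than that. -/
theorem Instr.space_effect_le (a : Instr) (s : State) :
    (a.effect s).space ≤ s.space + a.cost s := by
  cases a with
  | const i c =>
    have := cellBits_update_le s.reg i c
    simp only [State.space, Instr.effect, Instr.cost]; omega
  | arith o i j k =>
    have := cellBits_update_le s.reg i (o.eval (s.reg j) (s.reg k))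
    simp only [State.space, Instr.effect, Instr.cost]; omega
  | load i j =>
    have := cellBits_update_le s.reg i (s.mem (s.reg j).toNat)
    simp only [State.space, Instr.effect, Instr.cost]; omega
  | store i j =>
    have := cellBits_update_le s.mem (s.reg i).toNat (s.reg j)
    have := bits_toNat_le (s.reg i)
    simp only [State.space, Instr.effect, Instr.cost, State.readCost]; omega

theorem Exec.space_le {P : Prog} {s s' : State} {t p : ℕ} (h : Exec P s t p s') :
    p ≤ s.space + t ∧ s'.space ≤ s.space + t := by
  induction h with
  | skip s => omega
  | instr a s => have := a.space_effect_le s; omega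
  | seq _ _ ih₁ ih₂ => omega
  | itePos _ _ ih => omega
  | iteNonpos _ _ ih => omega
  | loopDone _ => omega
  | loopStep _ _ _ ih₁ ih₂ => omega

/-! ### Expressions, and their compilation to register code -/

theorem bits_mono {y z : ℤ} (h : |y| ≤ |z|) : bits y ≤ bits z := by
  unfold bits
  have := Nat.size_le_size (Int.natAbs_le_iff_sq_le.2 (sq_le_sq.2 h))
  omega

/-- Integer expressions over registers and memory. -/
inductive Ex
  | c (z : ℤ)
  | r (i : ℕ)
  | op (o : Arith) (e f : Ex)
  | ld (e : Ex)

namespace Ex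

instance : Add Ex := ⟨op .add⟩
instance : Sub Ex := ⟨op .sub⟩
instance : Mul Ex := ⟨op .mul⟩
instance : Div Ex := ⟨op .div⟩
instance (n : ℕ) : OfNat Ex n := ⟨c n⟩

end Ex

/-- Registers and memory as plain functions. -/
structure Store where
  reg : ℕ → ℤ
  mem : ℕ → ℤ

def Store.set (σ : Store) (i : ℕ) (z : ℤ) : Store := ⟨Function.update σ.reg i z, σ.mem⟩

def Store.put (σ : Store) (a : ℕ) (z : ℤ) : Store := ⟨σ.reg, Function.update σ.mem a z⟩

@[simp] theorem Store.set_reg (σ : Store) (i : ℕ) (z : ℤ) (j : ℕ) :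
    (σ.set i z).reg j = if j = i then z else σ.reg j := by
  simp [Store.set, Function.update_apply]

@[simp] theorem Store.set_mem (σ : Store) (i : ℕ) (z : ℤ) : (σ.set i z).mem = σ.mem := rfl

@[simp] theorem Store.put_reg (σ : Store) (a : ℕ) (z : ℤ) : (σ.put a z).reg = σ.reg := rfl

@[simp] theorem Store.put_mem (σ : Store) (a : ℕ) (z : ℤ) (b : ℕ) :
    (σ.put a z).mem b = if b = a then z else σ.mem b := by
  simp [Store.put, Function.update_apply]

namespace Ex

def eval (σ : Store) : Ex → ℤ
  | c z => z
  | r i => σ.reg i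
  | op o e f => o.eval (e.eval σ) (f.eval σ)
  | ld e => σ.mem (e.eval σ).toNat

@[simp] theorem eval_c (σ : Store) (z : ℤ) : (c z).eval σ = z := rfl
@[simp] theorem eval_zero (σ : Store) : eval σ 0 = 0 := rfl
@[simp] theorem eval_one (σ : Store) : eval σ 1 = 1 := rfl
@[simp] theorem eval_two (σ : Store) : eval σ 2 = 2 := rfl
@[simp] theorem eval_three (σ : Store) : eval σ 3 = 3 := rfl
@[simp] theorem eval_r (σ : Store) (i : ℕ) : (r i).eval σ = σ.reg i := rfl
@[simp] theorem eval_ld (σ : Store) (e : Ex) : (ld e).eval σ = σ.mem (e.eval σ).toNat := rfl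
@[simp] theorem eval_add (σ : Store) (e f : Ex) : (e + f).eval σ = e.eval σ + f.eval σ := rfl
@[simp] theorem eval_sub (σ : Store) (e f : Ex) : (e - f).eval σ = e.eval σ - f.eval σ := rfl
@[simp] theorem eval_mul (σ : Store) (e f : Ex) : (e * f).eval σ = e.eval σ * f.eval σ := rfl
@[simp] theorem eval_div (σ : Store) (e f : Ex) : (e / f).eval σ = e.eval σ / f.eval σ := rfl

def size : Ex → ℕ
  | c _ => 1
  | r _ => 1
  | op _ e f => e.size + f.size + 1
  | ld e => e.size + 1

/-- Only registers below `64` and constants up to `128` occur. -/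
def wf : Ex → Bool
  | c z => z.natAbs ≤ 128
  | r i => i < 64
  | op _ e f => e.wf && f.wf
  | ld e => e.wf

/-- The limit `24` is the exponent in `unit`; it also keeps the indices of the scratch registers
below `128`. -/
def good (e : Ex) : Bool := e.wf && decide (e.size ≤ 24)

theorem size_pos (e : Ex) : 0 < e.size := by cases e <;> simp [size]

/-- Code that computes the expression into register `d`, using the registers from `d` on. -/
def comp : Ex → ℕ → Prog
  | c z, d => .instr (.const d z)
  -- Registers are copied by adding zero, since there is no move instruction.
  | r i, d => .seq (.instr (.const d 0)) (.instr (.arith .add d i d))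
  | op o e f, d => .seq (e.comp d) (.seq (f.comp (d + 1)) (.instr (.arith o d d (d + 1))))
  | ld e, d => .seq (e.comp d) (.instr (.load d d))

end Ex

/-- All stored values are bounded by `M`. -/
def Store.Bdd (M : ℕ) (σ : Store) : Prop := (∀ i, |σ.reg i| ≤ M) ∧ ∀ a, |σ.mem a| ≤ M

/-- Since `M ≥ 2`, `M ^ u + M ^ v ≤ M ^ (u + v)`, so a sum grows no faster than a product and
exponents just add up along an expression. -/
theorem abs_arith_le {M : ℕ} (hM : 2 ≤ M) (o : Arith) {x y : ℤ} {u v : ℕ} (hu : 0 < u)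
    (hv : 0 < v) (hx : |x| ≤ (M : ℤ) ^ u) (hy : |y| ≤ (M : ℤ) ^ v) :
    |o.eval x y| ≤ (M : ℤ) ^ (u + v) := by
  have hM' : (2 : ℤ) ≤ M := by exact_mod_cast hM
  have h1 : (1 : ℤ) ≤ M := by omega
  have key : (M : ℤ) ^ u + (M : ℤ) ^ v ≤ (M : ℤ) ^ (u + v) := by
    have hu' : (2 : ℤ) ≤ (M : ℤ) ^ u := hM'.trans (le_self_pow₀ h1 hu.ne')
    have hv' : (2 : ℤ) ≤ (M : ℤ) ^ v := hM'.trans (le_self_pow₀ h1 hv.ne')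
    rw [pow_add]; nlinarith
  cases o with
  | add => exact (abs_add_le x y).trans (by change |x| + |y| ≤ _; linarith)
  | sub => exact (abs_sub x y).trans (by change |x| + |y| ≤ _; linarith)
  | mul =>
    change |x * y| ≤ _
    rw [abs_mul, pow_add]
    exact mul_le_mul hx hy (abs_nonneg _) (by positivity)
  | div =>
    change |x / y| ≤ _
    have : |x / y| ≤ |x| := by
      rw [Int.abs_eq_natAbs, Int.abs_eq_natAbs]
      exact_mod_cast Int.natAbs_ediv_le_natAbs x y
    exact this.trans (hx.trans (pow_le_pow_right₀ h1 (by omega)))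

theorem Ex.abs_eval_le {M : ℕ} (hM : 128 ≤ M) {σ : Store} (hσ : σ.Bdd M) :
    ∀ e : Ex, e.wf → |e.eval σ| ≤ (M : ℤ) ^ e.size
  | c z, h => by
    simp only [wf, decide_eq_true_eq] at h
    simp only [eval_c, size, pow_one, Int.abs_eq_natAbs]; omega
  | r i, h => by simpa [size] using hσ.1 i
  | op o e f, h => by
    simp only [wf, Bool.and_eq_true] at h
    have h1 : (1 : ℤ) ≤ M := by omega
    refine (abs_arith_le (by omega) o e.size_pos f.size_pos (abs_eval_le hM hσ e h.1)
      (abs_eval_le hM hσ f h.2)).trans (pow_le_pow_right₀ h1 (by simp [size]))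
  | ld e, h => by
    have h1 : (1 : ℤ) ≤ M := by omega
    exact (hσ.2 _).trans (le_self_pow₀ h1 (by simp [size]))

/-- The state agrees with the store, except for the scratch registers from `64` on. -/
def Agree (s : State) (σ : Store) : Prop :=
  (∀ i < 64, s.reg i = σ.reg i) ∧ ∀ a, s.mem a = σ.mem a

/-- A bound on the length of the integers handled while an expression is evaluated. -/
def unit (M : ℕ) : ℕ := bits ((M : ℤ) ^ 24)

theorem bits_le_unit {M : ℕ} {z : ℤ} (h : |z| ≤ (M : ℤ) ^ 24) : bits z ≤ unit M :=
  bits_mono (h.trans (le_abs_self _))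

theorem bits_index_le_unit {M : ℕ} (hM : 128 ≤ M) {i : ℕ} (h : i ≤ 128) :
    bits i ≤ unit M := by
  refine bits_le_unit ?_
  have h1 : (1 : ℤ) ≤ M := by omega
  have : (M : ℤ) ≤ (M : ℤ) ^ 24 := le_self_pow₀ h1 (by norm_num)
  rw [Nat.abs_cast]
  omega

/-- The registers from `d` on act as a stack: the second operand is computed into `d + 1` and leaves
the first one intact. The factor `8` comes from a register copy, with two lengths for the constant
and six for the addition. -/
theorem Ex.exec_comp {M : ℕ} (hM : 128 ≤ M) {σ : Store} (hσ : σ.Bdd M) :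
    ∀ (e : Ex) (d : ℕ) (s : State), e.wf → e.size ≤ 24 → 64 ≤ d → d + e.size ≤ 127 →
      Agree s σ → ∃ t p s', Exec (e.comp d) s t p s' ∧ t ≤ 8 * e.size * unit M ∧
        (∀ i < d, s'.reg i = s.reg i) ∧ s'.mem = s.mem ∧ s'.reg d = e.eval σ
  | c z, d, s, hw, hs, hd, hd', hA => by
    refine ⟨_, _, _, .instr _ _, ?_, ?_, rfl, ?_⟩
    · have := bits_index_le_unit hM (show d ≤ 128 by omega)
      have : bits z ≤ unit M := by
        refine bits_le_unit ?_
        have := (c z).abs_eval_le hM hσ hw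
        exact this.trans (pow_le_pow_right₀ (by omega) hs)
      simp only [Instr.cost, size]; omega
    · intro i hi
      simp [Instr.effect, Function.update_of_ne hi.ne]
    · simp [Instr.effect]
  | r i, d, s, hw, hs, hd, hd', hA => by
    simp only [wf, decide_eq_true_eq] at hw
    have hi : s.reg i = σ.reg i := hA.1 i hw
    have hid : i ≠ d := by omega
    refine ⟨_, _, _, .seq (.instr _ _) (.instr _ _), ?_, ?_, rfl, ?_⟩
    · have h1 := bits_index_le_unit hM (show d ≤ 128 by omega)
      have h2 := bits_index_le_unit hM (show i ≤ 128 by omega)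
      have h3 : bits (σ.reg i) ≤ unit M := by
        refine bits_le_unit ((hσ.1 i).trans (le_self_pow₀ (by omega) (by norm_num)))
      have h4 : bits (0 : ℤ) ≤ unit M := bits_mono (by simp)
      simp only [Instr.cost, size, Instr.effect, State.readCost, Finsupp.coe_update,
        Function.update_of_ne hid, Function.update_self, Arith.eval, hi, add_zero]
      omega
    · intro j hj
      simp [Instr.effect, Function.update_of_ne hj.ne]
    · simp [Instr.effect, Function.update_of_ne hid, hi, Arith.eval]
  | op o e f, d, s, hw, hs, hd, hd', hA => by
    have hw' := hw
    simp only [wf, Bool.and_eq_true] at hw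
    have hsz : (op o e f).size = e.size + f.size + 1 := rfl
    rw [hsz] at hs hd'
    obtain ⟨t₁, p₁, s₁, x₁, ht₁, hr₁, hm₁, hv₁⟩ :=
      exec_comp hM hσ e d s hw.1 (by omega) hd (by omega) hA
    have hA₁ : Agree s₁ σ := ⟨fun i hi => (hr₁ i (by omega)).trans (hA.1 i hi), fun a => by
      rw [hm₁]; exact hA.2 a⟩
    obtain ⟨t₂, p₂, s₂, x₂, ht₂, hr₂, hm₂, hv₂⟩ :=
      exec_comp hM hσ f (d + 1) s₁ hw.2 (by omega) (by omega) (by omega) hA₁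
    refine ⟨_, _, _, .seq x₁ (.seq x₂ (.instr _ _)), ?_, ?_, ?_, ?_⟩
    · have h1 := bits_index_le_unit hM (show d ≤ 128 by omega)
      have h2 := bits_index_le_unit hM (show d + 1 ≤ 128 by omega)
      have hb : ∀ g : Ex, g.wf → g.size ≤ 24 → bits (g.eval σ) ≤ unit M := fun g hg hg' =>
        bits_le_unit ((g.abs_eval_le hM hσ hg).trans (pow_le_pow_right₀ (by omega) hg'))
      have h3 := hb e hw.1 (by omega)
      have h4 := hb f hw.2 (by omega)
      have h5 := hb (op o e f) hw' (by omega)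
      simp only [eval] at h5
      simp only [Instr.cost, State.readCost, hr₂ d (by omega), hv₁, hv₂, hsz]
      have : 8 * (e.size + f.size + 1) * unit M =
        8 * e.size * unit M + 8 * f.size * unit M + 8 * unit M := by ring
      omega
    · intro i hi
      simp only [Instr.effect, Finsupp.coe_update, Function.update_of_ne hi.ne]
      rw [hr₂ i (by omega), hr₁ i hi]
    · simp [Instr.effect, hm₂, hm₁]
    · simp [Instr.effect, hr₂ d (by omega), hv₁, hv₂, eval]
  | ld e, d, s, hw, hs, hd, hd', hA => by
    have hw' : e.wf := hw
    have hsz : (ld e).size = e.size + 1 := rfl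
    rw [hsz] at hs hd'
    obtain ⟨t₁, p₁, s₁, x₁, ht₁, hr₁, hm₁, hv₁⟩ :=
      exec_comp hM hσ e d s hw' (by omega) hd (by omega) hA
    refine ⟨_, _, _, .seq x₁ (.instr _ _), ?_, ?_, ?_, ?_⟩
    · have h1 := bits_index_le_unit hM (show d ≤ 128 by omega)
      have hb : ∀ g : Ex, g.wf → g.size ≤ 24 → bits (g.eval σ) ≤ unit M := fun g hg hg' =>
        bits_le_unit ((g.abs_eval_le hM hσ hg).trans (pow_le_pow_right₀ (by omega) hg'))
      have h3 := hb e hw' (by omega)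
      have h5 := hb (ld e) hw (by omega)
      simp only [eval] at h5
      simp only [Instr.cost, State.readCost, hv₁, hsz, hm₁, hA.2]
      have : 8 * (e.size + 1) * unit M = 8 * e.size * unit M + 8 * unit M := by ring
      omega
    · intro i hi
      simp only [Instr.effect, Finsupp.coe_update, Function.update_of_ne hi.ne]
      rw [hr₁ i hi]
    · simp [Instr.effect, hm₁]
    · simp [Instr.effect, hm₁, hv₁, hA.2]

/-! ### Program constructs -/

namespace Prog

/-- `R[i] := e` -/
def asg (i : ℕ) (e : Ex) : Prog :=
  .seq (e.comp 64) (.seq (.instr (.const 65 0)) (.instr (.arith .add i 64 65)))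

/-- `M[e] := f` -/
def put (e f : Ex) : Prog := .seq (e.comp 64) (.seq (f.comp 65) (.instr (.store 64 65)))

/-- `if e > 0 then P else Q` -/
def cond (e : Ex) (P Q : Prog) : Prog := .seq (e.comp 64) (.ite 64 P Q)

/-- `while e > 0 do P` -/
def whileDo (e : Ex) (P : Prog) : Prog := .seq (e.comp 64) (.loop 64 (.seq P (e.comp 64)))

/-- `for R[i] = 0, 1, …` while `R[i] < e` `do P` -/
def forDo (i : ℕ) (e : Ex) (P : Prog) : Prog :=
  .seq (asg i 0) (whileDo (e - .r i) (.seq P (asg i (.r i + 1))))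

end Prog

/-- Cost of one step of the derived constructs. -/
def W (M : ℕ) : ℕ := 1000 * unit M

/-- Started in a state that agrees with the store `σ`, the program halts within `K` steps of the
derived constructs in a state that satisfies `Q`, provided that stored values are bounded. -/
def Runs (M : ℕ) (P : Prog) (σ : Store) (K : ℕ) (Q : Store → Prop) : Prop :=
  σ.Bdd M → ∀ s, Agree s σ → ∃ t p s' σ', Exec P s t p s' ∧ t ≤ K * W M ∧ Agree s' σ' ∧
    σ'.Bdd M ∧ Q σ'

section Rules

variable {M : ℕ} {σ : Store} {P P' : Prog} {K K' : ℕ} {Q Q' : Store → Prop} {e f : Ex}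

theorem Runs.mono (h : Runs M P σ K Q') (hK : K ≤ K') (hQ : ∀ σ', Q' σ' → Q σ') :
    Runs M P σ K' Q := by
  intro hσ s hs
  obtain ⟨t, p, s', σ', hx, ht, hA, hB, hq⟩ := h hσ s hs
  exact ⟨t, p, s', σ', hx, ht.trans (Nat.mul_le_mul_right _ hK), hA, hB, hQ _ hq⟩

theorem Runs.seq (h : Runs M P σ K Q') (h' : ∀ σ', Q' σ' → Runs M P' σ' K' Q) :
    Runs M (.seq P P') σ (K + K') Q := by
  intro hσ s hs
  obtain ⟨t, p, s₁, σ₁, hx, ht, hA, hB, hq⟩ := h hσ s hs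
  obtain ⟨t', p', s₂, σ₂, hx', ht', hA', hB', hq'⟩ := h' _ hq hB s₁ hA
  exact ⟨_, _, s₂, σ₂, .seq hx hx', by rw [add_mul]; omega, hA', hB', hq'⟩

theorem one_le_unit (M : ℕ) : 1 ≤ unit M := by simp [unit, bits]

theorem Runs.skip (h : Q σ) : Runs M .skip σ 1 Q := by
  intro hσ s hs
  refine ⟨_, _, s, σ, .skip s, ?_, hs, hσ, h⟩
  have := one_le_unit M
  simp only [W]; omega

theorem Ex.exec_comp_agree (hM : 128 ≤ M) (hσ : σ.Bdd M) (he : e.good)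
    (s : State) (hs : Agree s σ) :
    ∃ t p s', Exec (e.comp 64) s t p s' ∧ t ≤ 192 * unit M ∧ Agree s' σ ∧
      s'.reg 64 = e.eval σ ∧ bits (e.eval σ) ≤ unit M := by
  simp only [Ex.good, Bool.and_eq_true, decide_eq_true_eq] at he
  obtain ⟨t, p, s', hx, ht, hr, hm, hv⟩ :=
    e.exec_comp hM hσ 64 s he.1 he.2 le_rfl (by omega) hs
  refine ⟨t, p, s', hx, ht.trans (Nat.mul_le_mul_right _ (by omega)),
    ⟨fun i hi => (hr i hi).trans (hs.1 i hi), fun a => by rw [hm]; exact hs.2 a⟩, hv,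
    bits_le_unit ((e.abs_eval_le hM hσ he.1).trans (pow_le_pow_right₀ (by omega) he.2))⟩

theorem Store.Bdd.set (hσ : σ.Bdd M) {i : ℕ} {z : ℤ} (hz : |z| ≤ M) : (σ.set i z).Bdd M := by
  refine ⟨fun j => ?_, hσ.2⟩
  rw [Store.set_reg]; split_ifs
  exacts [hz, hσ.1 j]

theorem Store.Bdd.put (hσ : σ.Bdd M) {i : ℕ} {z : ℤ} (hz : |z| ≤ M) : (σ.put i z).Bdd M := by
  refine ⟨hσ.1, fun j => ?_⟩
  rw [Store.put_mem]; split_ifs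
  exacts [hz, hσ.2 j]

theorem Runs.asg (hM : 128 ≤ M) {i : ℕ} (hz : |e.eval σ| ≤ M) (hQ : Q (σ.set i (e.eval σ)))
    (he : e.good := by decide +kernel) (hi : i < 64 := by decide) : Runs M (.asg i e) σ 1 Q := by
  intro hσ s hs
  obtain ⟨t, p, s', hx, ht, hA, hv, hb⟩ := Ex.exec_comp_agree hM hσ he s hs
  refine ⟨_, _, _, σ.set i (e.eval σ), .seq hx (.seq (.instr _ _) (.instr _ _)), ?_, ?_,
    hσ.set hz, hQ⟩
  · have h1 := bits_index_le_unit hM (show 64 ≤ 128 by omega)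
    have h2 := bits_index_le_unit hM (show 65 ≤ 128 by omega)
    have h3 := bits_index_le_unit hM (show i ≤ 128 by omega)
    have h4 : bits (0 : ℤ) ≤ unit M := bits_mono (by simp)
    simp only [Instr.cost, State.readCost, Instr.effect, Finsupp.coe_update, W,
      Function.update_self, Function.update_of_ne (show (64 : ℕ) ≠ 65 by decide), hv, Arith.eval,
      add_zero]
    push_cast at *
    omega
  · refine ⟨fun j hj => ?_, fun a => by simpa [Instr.effect] using hA.2 a⟩
    rw [Store.set_reg]
    simp only [Instr.effect, Finsupp.coe_update, Function.update_self, Arith.eval, add_zero,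
      Function.update_of_ne (show (64 : ℕ) ≠ 65 by decide), hv]
    by_cases h : j = i
    · simp [h]
    · rw [Function.update_of_ne h, Function.update_of_ne (by omega), if_neg h, hA.1 j hj]

theorem Runs.put (hM : 128 ≤ M) (hz : |f.eval σ| ≤ M)
    (hQ : Q (σ.put (e.eval σ).toNat (f.eval σ)))
    (he : e.good := by decide +kernel) (hf : f.good := by decide) : Runs M (.put e f) σ 1 Q := by
  intro hσ s hs
  obtain ⟨t, p, s', hx, ht, hA, hv, hb⟩ := Ex.exec_comp_agree hM hσ he s hs
  simp only [Ex.good, Bool.and_eq_true, decide_eq_true_eq] at hf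
  obtain ⟨t₂, p₂, s₂, hx₂, ht₂, hr₂, hm₂, hv₂⟩ :=
    f.exec_comp hM hσ 65 s' hf.1 hf.2 (by omega) (by omega) hA
  refine ⟨_, _, _, _, .seq hx (.seq hx₂ (.instr _ _)), ?_, ?_, hσ.put hz, hQ⟩
  · have h1 := bits_index_le_unit hM (show 64 ≤ 128 by omega)
    have h2 := bits_index_le_unit hM (show 65 ≤ 128 by omega)
    have h3 : bits (f.eval σ) ≤ unit M :=
      bits_le_unit ((f.abs_eval_le hM hσ hf.1).trans (pow_le_pow_right₀ (by omega) hf.2))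
    have h4 : 8 * f.size * unit M ≤ 192 * unit M := Nat.mul_le_mul_right _ (by omega)
    simp only [Instr.cost, State.readCost, hr₂ 64 (by omega), hv, hv₂, W]
    push_cast at *
    omega
  · refine ⟨fun j hj => ?_, fun a => ?_⟩
    · simp only [Instr.effect, Store.put_reg]
      rw [hr₂ j (by omega), hA.1 j hj]
    · rw [Store.put_mem]
      simp only [Instr.effect, Finsupp.coe_update, hr₂ 64 (by omega), hv, hv₂, hm₂,
        Function.update_apply, hA.2]

theorem Runs.cond (hM : 128 ≤ M) (hP : 0 < e.eval σ → Runs M P σ K Q)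
    (hP' : e.eval σ ≤ 0 → Runs M P' σ K Q) (he : e.good := by decide +kernel) :
    Runs M (.cond e P P') σ (1 + K) Q := by
  intro hσ s hs
  obtain ⟨t, p, s', hx, ht, hA, hv, hb⟩ := Ex.exec_comp_agree hM hσ he s hs
  have h1 := bits_index_le_unit hM (show 64 ≤ 128 by omega)
  rcases lt_or_ge 0 (e.eval σ) with h | h
  · obtain ⟨t₂, p₂, s₂, σ₂, hx₂, ht₂, hA₂, hB₂, hq⟩ := hP h hσ s' hA
    refine ⟨_, _, s₂, σ₂, .seq hx (.itePos (by rwa [hv]) hx₂), ?_, hA₂, hB₂, hq⟩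
    rw [add_mul, State.readCost, hv]
    simp only [W] at *; push_cast at *; omega
  · obtain ⟨t₂, p₂, s₂, σ₂, hx₂, ht₂, hA₂, hB₂, hq⟩ := hP' h hσ s' hA
    refine ⟨_, _, s₂, σ₂, .seq hx (.iteNonpos (by rwa [hv]) hx₂), ?_, hA₂, hB₂, hq⟩
    rw [add_mul, State.readCost, hv]
    simp only [W] at *; push_cast at *; omega

/-- The invariant is indexed by the number of finished iterations, and exactly `L` are made. Costs
are summed iteration by iteration, because round `x` of the search costs about `2 ^ x`. -/
theorem Runs.whileDo (hM : 128 ≤ M) (I : ℕ → Store → Prop) (L : ℕ) (k : ℕ → ℕ)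
    (h0 : I 0 σ)
    (hstep : ∀ x < L, ∀ σ', I x σ' → 0 < e.eval σ' ∧ Runs M P σ' (k x) (I (x + 1)))
    (hend : ∀ σ', I L σ' → e.eval σ' ≤ 0 ∧ Q σ') (he : e.good := by decide +kernel) :
    Runs M (.whileDo e P) σ (1 + ∑ x ∈ Finset.range L, (k x + 1)) Q := by
  have h1 := bits_index_le_unit hM (show 64 ≤ 128 by omega)
  -- Induction on the number `d` of remaining iterations, with the value of the test already in
  -- register `64`.
  have key : ∀ d x : ℕ, x + d = L → ∀ σ', I x σ' → σ'.Bdd M → ∀ s, Agree s σ' →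
      s.reg 64 = e.eval σ' → bits (e.eval σ') ≤ unit M → ∃ t p s' σ₂,
      Exec (.loop 64 (.seq P (e.comp 64))) s t p s' ∧
      t ≤ 2 * unit M + (∑ y ∈ Finset.Ico x L, (k y + 1)) * W M ∧ Agree s' σ₂ ∧ σ₂.Bdd M ∧ Q σ₂ := by
    intro d
    induction d with
    | zero =>
      intro x hx σ' hI hB s hs hv hb
      obtain rfl : x = L := by omega
      refine ⟨_, _, s, σ', .loopDone (by rw [hv]; exact (hend _ hI).1), ?_, hs, hB, (hend _ hI).2⟩
      rw [State.readCost, hv]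
      simp only [Finset.Ico_self, Finset.sum_empty]; push_cast at *; omega
    | succ d ih =>
      intro x hx σ' hI hB s hs hv hb
      obtain ⟨hg, hr⟩ := hstep x (by omega) σ' hI
      obtain ⟨t, p, s₁, σ₁, hx₁, ht₁, hA₁, hB₁, hI₁⟩ := hr hB s hs
      obtain ⟨t₂, p₂, s₂, hx₂, ht₂, hA₂, hv₂, hb₂⟩ := Ex.exec_comp_agree hM hB₁ he s₁ hA₁
      obtain ⟨t₃, p₃, s₃, σ₃, hx₃, ht₃, hA₃, hB₃, hq⟩ :=
        ih (x + 1) (by omega) σ₁ hI₁ hB₁ s₂ hA₂ hv₂ hb₂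
      refine ⟨_, _, s₃, σ₃, .loopStep (by rwa [hv]) (.seq hx₁ hx₂) hx₃, ?_, hA₃, hB₃, hq⟩
      rw [State.readCost, hv, Finset.sum_eq_sum_Ico_succ_bot (show x < L by omega)]
      simp only [add_mul, one_mul] at *
      have : W M = 1000 * unit M := rfl
      push_cast at *; omega
  intro hσ s hs
  obtain ⟨t, p, s', hx, ht, hA, hv, hb⟩ := Ex.exec_comp_agree hM hσ he s hs
  obtain ⟨t₃, p₃, s₃, σ₃, hx₃, ht₃, hA₃, hB₃, hq⟩ := key L 0 (by omega) σ h0 hσ s' hA hv hb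
  refine ⟨_, _, s₃, σ₃, .seq hx hx₃, ?_, hA₃, hB₃, hq⟩
  rw [Finset.range_eq_Ico, add_mul]
  have : W M = 1000 * unit M := rfl
  omega

theorem Runs.forDo_sum (hM : 128 ≤ M) {i : ℕ} (I : ℕ → Store → Prop) (L : ℕ) (k : ℕ → ℕ)
    (hL : L ≤ M) (h0 : I 0 (σ.set i 0))
    (hlim : ∀ x ≤ L, ∀ σ', I x σ' → σ'.reg i = x ∧ e.eval σ' = L)
    (hstep : ∀ x < L, ∀ σ', I x σ' → Runs M P σ' (k x)
      fun σ₁ => σ₁.reg i = x ∧ I (x + 1) (σ₁.set i (x + 1 : ℕ)))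
    (hend : ∀ σ', I L σ' → Q σ')
    (he : (e - .r i).good := by decide +kernel) (hi : i < 64 := by decide)
    (he' : (Ex.r i + 1).good := by decide +kernel) :
    Runs M (.forDo i e P) σ (2 + ∑ x ∈ Finset.range L, (k x + 2)) Q := by
  refine Runs.mono (Runs.seq (K := 1) (Q' := fun σ' => I 0 σ') (Runs.asg hM ?_ ?_ rfl hi)
    fun σ' h => Runs.whileDo (Q := Q) hM I L (fun x => k x + 1) h ?_ ?_ he) ?_ fun σ' h => h
  · simp
  · simpa using h0
  · intro x hx σ' hI
    obtain ⟨h1, h2⟩ := hlim x hx.le σ' hI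
    refine ⟨by rw [Ex.eval_sub, Ex.eval_r, h1, h2]; omega, ?_⟩
    refine Runs.seq (hstep x hx σ' hI) fun σ₁ h => Runs.asg hM ?_ ?_ he' hi
    · simp only [Ex.eval_add, Ex.eval_r, Ex.eval_one, h.1]
      rw [abs_of_nonneg (by positivity)]; omega
    · simpa [h.1] using h.2
  · intro σ' hI
    obtain ⟨h1, h2⟩ := hlim L le_rfl σ' hI
    exact ⟨by rw [Ex.eval_sub, Ex.eval_r, h1, h2]; omega, hend σ' hI⟩
  · rw [← add_assoc]

theorem Runs.forDo (hM : 128 ≤ M) {i : ℕ} (I : ℕ → Store → Prop) (L k : ℕ)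
    (hL : L ≤ M) (h0 : I 0 (σ.set i 0))
    (hlim : ∀ x ≤ L, ∀ σ', I x σ' → σ'.reg i = x ∧ e.eval σ' = L)
    (hstep : ∀ x < L, ∀ σ', I x σ' → Runs M P σ' k
      fun σ₁ => σ₁.reg i = x ∧ I (x + 1) (σ₁.set i (x + 1 : ℕ)))
    (hend : ∀ σ', I L σ' → Q σ')
    (he : (e - .r i).good := by decide +kernel) (hi : i < 64 := by decide)
    (he' : (Ex.r i + 1).good := by decide +kernel) :
    Runs M (.forDo i e P) σ (2 + L * (k + 2)) Q := by
  have := Runs.forDo_sum (Q := Q) hM I L (fun _ => k) hL h0 hlim hstep hend he hi he'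
  simpa using this

end Rules

end RAM

/-! ### Binary digits and the Möbius transform on arrays -/

namespace SubsetTransform

open Finset

/-- The binary digit of `x` with weight `2 ^ j`. -/
def bit (x j : ℕ) : ℤ := ((x / 2 ^ j % 2 : ℕ) : ℤ)

theorem bit_eq_zero_or_one (x j : ℕ) : bit x j = 0 ∨ bit x j = 1 := by
  unfold bit; have := Nat.mod_two_eq_zero_or_one (x / 2 ^ j); omega

theorem bit_add_mul_of_lt {a j : ℕ} (hj : j < a) (x t : ℕ) : bit (x + 2 ^ a * t) j = bit x j := by
  unfold bit
  obtain ⟨d, rfl⟩ : ∃ d, a = j + (d + 1) := ⟨a - j - 1, by omega⟩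
  rw [show x + 2 ^ (j + (d + 1)) * t = x + 2 ^ j * (2 * (2 ^ d * t)) by ring,
    Nat.add_mul_div_left _ _ (by positivity), Nat.add_mul_mod_self_left]

theorem bit_add_mul_add {a x : ℕ} (hx : x < 2 ^ a) (t j : ℕ) :
    bit (x + 2 ^ a * t) (a + j) = bit t j := by
  unfold bit
  rw [pow_add, ← Nat.div_div_eq_div_mul, Nat.add_mul_div_left _ _ (by positivity),
    Nat.div_eq_of_lt hx, zero_add]

theorem bit_eq_zero_of_lt {a x : ℕ} (hx : x < 2 ^ a) : bit x a = 0 := by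
  simp [bit, Nat.div_eq_of_lt hx]

theorem bit_two_pow_add_self {a x : ℕ} (hx : x < 2 ^ a) : bit (2 ^ a + x) a = 1 := by
  simp [bit, Nat.add_div_left, Nat.div_eq_of_lt hx]

theorem bit_two_pow_add_of_lt {a j : ℕ} (hj : j < a) (x : ℕ) : bit (2 ^ a + x) j = bit x j := by
  simpa [add_comm] using bit_add_mul_of_lt hj x 1

theorem eq_of_bit_eq {a : ℕ} : ∀ {x y : ℕ}, x < 2 ^ a → y < 2 ^ a →
    (∀ j < a, bit x j = bit y j) → x = y := by
  induction a with
  | zero => intro x y hx hy _; simp at hx hy; omega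
  | succ a ih =>
    intro x y hx hy h
    have h0 := h 0 (by omega)
    rw [pow_succ] at hx hy
    have h1 : x / 2 = y / 2 := ih (by omega) (by omega) fun j hj => by
      have := h (j + 1) (by omega)
      unfold bit at this ⊢
      rwa [pow_succ', ← Nat.div_div_eq_div_mul, ← Nat.div_div_eq_div_mul] at this
    simp [bit] at h0
    omega

theorem bit_compl {a x j : ℕ} (hj : j < a) (hx : x < 2 ^ a) :
    bit (2 ^ a - 1 - x) j = 1 - bit x j := by
  have h1 := Nat.testBit_two_pow_sub_succ hx j
  rw [Nat.sub_sub, add_comm 1 x]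
  simp only [Nat.testBit_eq_decide_div_mod_eq, hj, decide_true, Bool.true_and] at h1
  unfold bit
  have := Nat.mod_two_eq_zero_or_one (x / 2 ^ j)
  have := Nat.mod_two_eq_zero_or_one ((2 ^ a - (x + 1)) / 2 ^ j)
  by_cases h : x / 2 ^ j % 2 = 1 <;> simp [h] at h1 <;> omega

theorem exists_bit_eq (a : ℕ) (q : ℕ → Prop) [DecidablePred q] :
    ∃ v < 2 ^ a, ∀ j < a, bit v j = if q j then 1 else 0 := by
  induction a with
  | zero => exact ⟨0, by simp, by simp⟩
  | succ a ih =>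
    obtain ⟨v, hv, h⟩ := ih
    by_cases hq : q a
    · refine ⟨2 ^ a + v, by rw [pow_succ]; omega, fun j hj => ?_⟩
      rcases Nat.lt_succ_iff_lt_or_eq.1 hj with hj | rfl
      · rw [bit_two_pow_add_of_lt hj, h j hj]
      · rw [bit_two_pow_add_self hv, if_pos hq]
    · refine ⟨v, by rw [pow_succ]; omega, fun j hj => ?_⟩
      rcases Nat.lt_succ_iff_lt_or_eq.1 hj with hj | rfl
      · exact h j hj
      · rw [bit_eq_zero_of_lt hv, if_neg hq]

theorem sum_range_two_pow_succ (a : ℕ) (f : ℕ → ℤ) :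
    ∑ x ∈ range (2 ^ (a + 1)), f x =
      ∑ x ∈ range (2 ^ a), f x + ∑ x ∈ range (2 ^ a), f (2 ^ a + x) := by
  rw [pow_succ, mul_two, sum_range_add]

theorem prod_bit_of_lt {a x : ℕ} (hx : x < 2 ^ a) (ψ : ℕ → ℤ → ℤ) :
    ∏ j ∈ range (a + 1), ψ j (bit x j) = (∏ j ∈ range a, ψ j (bit x j)) * ψ a 0 := by
  rw [prod_range_succ, bit_eq_zero_of_lt hx]

theorem prod_bit_two_pow_add {a x : ℕ} (hx : x < 2 ^ a) (ψ : ℕ → ℤ → ℤ) :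
    ∏ j ∈ range (a + 1), ψ j (bit (2 ^ a + x) j) = (∏ j ∈ range a, ψ j (bit x j)) * ψ a 1 := by
  rw [prod_range_succ, bit_two_pow_add_self hx]
  congr 1
  exact prod_congr rfl fun j hj => by rw [bit_two_pow_add_of_lt (mem_range.1 hj)]

/-- Distributivity, with one digit chosen per position. The inclusion–exclusion sums below factor
over the elements in this way. -/
theorem sum_prod_bit (ψ : ℕ → ℤ → ℤ) (a : ℕ) :
    ∑ x ∈ range (2 ^ a), ∏ j ∈ range a, ψ j (bit x j) = ∏ j ∈ range a, (ψ j 0 + ψ j 1) := by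
  induction a with
  | zero => simp
  | succ a ih =>
    rw [sum_range_two_pow_succ, prod_range_succ, ← ih, mul_add, sum_mul, sum_mul]
    congr 1 <;> refine sum_congr rfl fun x hx => ?_
    · exact prod_bit_of_lt (mem_range.1 hx) ψ
    · exact prod_bit_two_pow_add (mem_range.1 hx) ψ

/-- One round of the transform. -/
def mobStep (j : ℕ) (f : ℕ → ℤ) (x : ℕ) : ℤ := if bit x j = 1 then f x - f (x - 2 ^ j) else f x

/-- The Möbius transform with respect to the `a` lowest binary digits. -/
def mob : ℕ → (ℕ → ℤ) → ℕ → ℤ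
  | 0, f => f
  | a + 1, f => mobStep a (mob a f)

/-- Each round reads only at `x` and at a smaller index, so an array that agrees with `f` up to `x`
serves as well. -/
theorem mob_congr {f f' : ℕ → ℤ} (a x : ℕ) (h : ∀ y ≤ x, f y = f' y) : mob a f x = mob a f' x := by
  induction a generalizing x with
  | zero => exact h x le_rfl
  | succ a ih =>
    simp only [mob, mobStep]
    rw [ih x h, ih (x - 2 ^ a) fun y hy => h y (hy.trans (Nat.sub_le _ _))]

theorem abs_mob_le {f : ℕ → ℤ} {B : ℕ} {F : ℤ} (hF : ∀ x < B, |f x| ≤ F) (a : ℕ) :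
    ∀ x < B, |mob a f x| ≤ 2 ^ a * F := by
  induction a with
  | zero => simpa [mob] using hF
  | succ a ih =>
    intro x hx
    have h1 := ih x hx
    have h2 := ih (x - 2 ^ a) ((Nat.sub_le _ _).trans_lt hx)
    have h3 := (abs_nonneg _).trans h1
    simp only [mob, mobStep, pow_succ]
    split_ifs
    · exact (abs_sub _ _).trans (by linarith)
    · linarith

/-- The factor that a digit `v` of the output and a digit `x` of the input contribute. -/
def kappa (v x : ℤ) : ℤ := if v = 1 then 2 * x - 1 else 1 - x

/-- The first `a` rounds act on each block of `2 ^ a` consecutive indices separately; `t` is the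
number of the block. The induction needs all `t`, because block `t` of the next level consists of
the blocks `2 * t` and `2 * t + 1`. The kernel is the Möbius function of the subset order, written
digit by digit. -/
theorem mob_eq_sum_aux (a : ℕ) (f : ℕ → ℤ) : ∀ (v t : ℕ), v < 2 ^ a →
    mob a f (v + 2 ^ a * t) =
      ∑ x ∈ range (2 ^ a), f (x + 2 ^ a * t) * ∏ j ∈ range a, kappa (bit v j) (bit x j) := by
  induction a with
  | zero => intro v t hv; simp at hv; simp [mob, hv]
  | succ a ih =>
    intro v t hv
    have hp : 2 ^ (a + 1) * t = 2 ^ a * (2 * t) := by ring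
    have e1 : ∑ x ∈ range (2 ^ a), f (x + 2 ^ (a + 1) * t) *
        ∏ j ∈ range (a + 1), kappa (bit v j) (bit x j) =
        (∑ x ∈ range (2 ^ a), f (x + 2 ^ a * (2 * t)) *
          ∏ j ∈ range a, kappa (bit v j) (bit x j)) * kappa (bit v a) 0 := by
      rw [sum_mul]
      refine sum_congr rfl fun x hx => ?_
      rw [prod_bit_of_lt (mem_range.1 hx) fun j => kappa (bit v j), hp, mul_assoc]
    have e2 : ∑ x ∈ range (2 ^ a), f (2 ^ a + x + 2 ^ (a + 1) * t) *
        ∏ j ∈ range (a + 1), kappa (bit v j) (bit (2 ^ a + x) j) =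
        (∑ x ∈ range (2 ^ a), f (x + 2 ^ a * (2 * t + 1)) *
          ∏ j ∈ range a, kappa (bit v j) (bit x j)) * kappa (bit v a) 1 := by
      rw [sum_mul]
      refine sum_congr rfl fun x hx => ?_
      rw [prod_bit_two_pow_add (mem_range.1 hx) fun j => kappa (bit v j), mul_assoc,
        show 2 ^ a + x + 2 ^ (a + 1) * t = x + 2 ^ a * (2 * t + 1) by ring]
    rw [sum_range_two_pow_succ, e1, e2]
    rcases lt_or_ge v (2 ^ a) with h | h
    · have hb : bit (v + 2 ^ a * (2 * t)) a = 0 := by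
        simpa [bit] using bit_add_mul_add h (2 * t) 0
      rw [hp, mob, mobStep, hb, if_neg (by norm_num), ih v (2 * t) h, bit_eq_zero_of_lt h]
      simp only [kappa, zero_ne_one, if_false, sub_zero, mul_one, sub_self, mul_zero, add_zero]
    · obtain ⟨w, rfl⟩ := Nat.exists_eq_add_of_le h
      have hw : w < 2 ^ a := by rw [pow_succ] at hv; omega
      have e : 2 ^ a + w + 2 ^ a * (2 * t) = w + 2 ^ a * (2 * t + 1) := by ring
      have hb : bit (w + 2 ^ a * (2 * t + 1)) a = 1 := by
        have := bit_add_mul_add hw (2 * t + 1) 0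
        rw [add_zero] at this
        rw [this]; simp [bit, Nat.add_mod]
      have hc : ∀ x, ∏ j ∈ range a, kappa (bit (2 ^ a + w) j) (bit x j) =
          ∏ j ∈ range a, kappa (bit w j) (bit x j) := fun x =>
        prod_congr rfl fun j hj => by rw [bit_two_pow_add_of_lt (mem_range.1 hj) w]
      simp only [hc]
      rw [hp, e, mob, mobStep, hb, if_pos rfl, ih w _ hw,
        show w + 2 ^ a * (2 * t + 1) - 2 ^ a = w + 2 ^ a * (2 * t) by
          rw [mul_add, mul_one]; omega, ih w _ hw, bit_two_pow_add_self hw]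
      simp only [kappa, if_true]
      ring

theorem mob_eq_sum {a v : ℕ} (f : ℕ → ℤ) (hv : v < 2 ^ a) :
    mob a f v = ∑ x ∈ range (2 ^ a), f x * ∏ j ∈ range a, kappa (bit v j) (bit x j) := by
  simpa using mob_eq_sum_aux a f v 0 hv

/-- The number of ones among the `a` lowest binary digits. -/
def ones (a x : ℕ) : ℤ := ∑ j ∈ range a, bit x j

theorem ones_le (a x : ℕ) : ones a x ≤ a := by
  have : ones a x ≤ ∑ j ∈ range a, (1 : ℤ) :=
    sum_le_sum fun j _ => by rcases bit_eq_zero_or_one x j with h | h <;> simp [h]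
  simpa using this

/-- The kernel is `1` on the diagonal and vanishes unless the digits of `z` lie below those of `x`.
Such a `z ≠ x` has fewer ones than `x`, hence fewer than `r`, and `f` is zero there. -/
theorem mob_eq_self {a x : ℕ} {r : ℤ} {f : ℕ → ℤ} (hf : ∀ z < 2 ^ a, ones a z < r → f z = 0)
    (hx : x < 2 ^ a) (hr : ones a x ≤ r) : mob a f x = f x := by
  rw [mob_eq_sum f hx, sum_eq_single x]
  · rw [prod_eq_one, mul_one]
    intro j _
    rcases bit_eq_zero_or_one x j with h | h <;> simp [h, kappa]
  · intro z hz hzx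
    rw [mem_range] at hz
    by_cases hK : ∏ j ∈ range a, kappa (bit x j) (bit z j) = 0
    · rw [hK, mul_zero]
    · rw [hf z hz, zero_mul]
      rw [← ne_eq, prod_ne_zero_iff] at hK
      refine lt_of_lt_of_le ?_ hr
      have hle : ∀ j ∈ range a, bit z j ≤ bit x j := by
        intro j hj
        have := hK j hj
        rcases bit_eq_zero_or_one x j with h | h <;> rcases bit_eq_zero_or_one z j with h' | h' <;>
          simp [h, h', kappa] at this ⊢
      refine sum_lt_sum hle ?_
      by_contra! hcon
      exact hzx (eq_of_bit_eq hz hx fun j hj =>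
        le_antisymm (hle j (mem_range.2 hj)) (hcon j (mem_range.2 hj)))
  · intro h; exact absurd (mem_range.2 hx) h

/-! ### Solving for an array that is transformed into a delta function on a given support -/

/-- The `r`-th iterate of the correction of an array on the support `p`. -/
def corr (a : ℕ) (p : ℕ → Prop) [DecidablePred p] : ℕ → ℕ → ℤ
  | 0, _ => 0
  | r + 1, x =>
    if p x then corr a p r x + (if x = 0 then 1 else 0) - mob a (corr a p r) x
    else corr a p r x

section Corr

variable {a : ℕ} (p : ℕ → Prop) [DecidablePred p]

theorem corr_eq_zero {x : ℕ} (hx : ¬ p x) (r : ℕ) : corr a p r x = 0 := by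
  induction r with
  | zero => rfl
  | succ r ih => rw [corr, if_neg hx, ih]

/-- A round multiplies the bound by at most `2 ^ a + 2`: `2 ^ a` for the transform, `1` for the old
value and `1` for the delta. -/
theorem abs_corr_le (r : ℕ) : ∀ x < 2 ^ a, |corr a p r x| ≤ (2 ^ a + 2) ^ r := by
  induction r with
  | zero => intro x _; simp [corr]
  | succ r ih =>
    intro x hx
    have h1 := ih x hx
    have h2 := abs_mob_le ih a x hx
    have h3 : (1 : ℤ) ≤ (2 ^ a + 2) ^ r := one_le_pow₀ (by have : (0 : ℤ) < 2 ^ a := by positivity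
                                                           omega)
    have h4 : (0 : ℤ) ≤ 2 ^ a * (2 ^ a + 2) ^ r := by positivity
    rw [corr, pow_succ]
    split_ifs with hp h0
    · calc _ ≤ |corr a p r x + 1| + |mob a (corr a p r) x| := abs_sub _ _
        _ ≤ |corr a p r x| + |1| + |mob a (corr a p r) x| := by gcongr; exact abs_add_le _ _
        _ ≤ _ := by rw [abs_one]; linarith
    · calc _ ≤ |corr a p r x + 0| + |mob a (corr a p r) x| := abs_sub _ _
        _ ≤ _ := by rw [add_zero]; linarith
    · linarith

theorem mob_add (a : ℕ) (f f' : ℕ → ℤ) (x : ℕ) :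
    mob a (fun y => f y + f' y) x = mob a f x + mob a f' x := by
  induction a generalizing x with
  | zero => rfl
  | succ a ih =>
    simp only [mob, mobStep, ih]
    split_ifs <;> ring

/-- Round `r + 1` adds to the iterate its residual `E` on the support. By induction `E` vanishes at
points with fewer than `r` ones, so the transform of `E` agrees with `E` at points with at most `r`
ones, and there the residual is cancelled. -/
theorem mob_corr_aux (r : ℕ) : ∀ x < 2 ^ a, p x → ones a x < r →
    mob a (corr a p r) x = if x = 0 then 1 else 0 := by
  induction r with
  | zero =>
    intro x _ _ h
    have : 0 ≤ ones a x := sum_nonneg fun j _ => by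
      rcases bit_eq_zero_or_one x j with h | h <;> simp [h]
    push_cast at h; omega
  | succ r ih =>
    intro x hx hp hr
    set E : ℕ → ℤ := fun y =>
      if p y then (if y = 0 then 1 else 0) - mob a (corr a p r) y else 0 with hE
    have hsplit : corr a p (r + 1) = fun y => corr a p r y + E y := by
      funext y
      simp only [corr, hE]
      split_ifs <;> ring
    have hEz : ∀ z < 2 ^ a, ones a z < r → E z = 0 := by
      intro z hz hzr
      simp only [hE]
      by_cases hpz : p z
      · rw [if_pos hpz, ih z hz hpz hzr, sub_self]
      · rw [if_neg hpz]
    rw [hsplit, mob_add, mob_eq_self hEz hx (by push_cast at hr; omega)]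
    simp only [hE, if_pos hp]
    ring

/-- With `a` digits there are at most `a` ones, so `a + 1` rounds reach every point of the support.
-/
theorem mob_corr {x : ℕ} (hx : x < 2 ^ a) (hp : p x) :
    mob a (corr a p (a + 1)) x = if x = 0 then 1 else 0 :=
  mob_corr_aux p (a + 1) x hx hp (by have := ones_le a x; push_cast; omega)

end Corr

end SubsetTransform

namespace SubsetTransform

open Finset

/-! ### Counting subfamilies that avoid or cover given elements -/

def ind (s : Finset ℕ) (j : ℕ) : ℤ := if j ∈ s then 1 else 0

theorem ind_eq_zero_or_one (s : Finset ℕ) (j : ℕ) : ind s j = 0 ∨ ind s j = 1 := by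
  unfold ind; split_ifs <;> simp

/-- Indicates whether `s` contains none of the elements that the digits of `x` encode. -/
def avoid (n : ℕ) (s : Finset ℕ) (x : ℕ) : ℤ := ∏ j ∈ range n, (1 - bit x j * ind s j)

/-- The sign given by the parity of the binary digits. -/
def sgn (n x : ℕ) : ℤ := ∏ j ∈ range n, (1 - 2 * bit x j)

/-- The number of members of `S` that avoid the elements encoded by `x`. -/
def cnt (n m : ℕ) (row : ℕ → Finset ℕ) (S : Finset ℕ) (x : ℕ) : ℤ :=
  ∑ i ∈ range m, ind S i * avoid n (row i) x

/-- The number of injective `k`-tuples of members of `S` that avoid the elements encoded by `x`. -/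
def tuples (n m k : ℕ) (row : ℕ → Finset ℕ) (S : Finset ℕ) (x : ℕ) : ℤ :=
  ∏ j ∈ range k, (cnt n m row S x - j)

theorem avoid_eq_ite (n : ℕ) (s : Finset ℕ) (x : ℕ) :
    avoid n s x = if ∀ j < n, bit x j = 1 → j ∉ s then 1 else 0 := by
  unfold avoid
  split_ifs with h
  · refine prod_eq_one fun j hj => ?_
    rcases bit_eq_zero_or_one x j with hb | hb
    · simp [hb]
    · simp [ind, h j (mem_range.1 hj) hb]
  · push Not at h
    obtain ⟨j, hj, hb, hs⟩ := h
    exact prod_eq_zero (mem_range.2 hj) (by simp [hb, ind, hs])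

theorem abs_sgn (n x : ℕ) : |sgn n x| = 1 := by
  unfold sgn
  rw [abs_prod]
  refine prod_eq_one fun j _ => ?_
  rcases bit_eq_zero_or_one x j with h | h <;> simp [h]

section

variable {n m k : ℕ} {row : ℕ → Finset ℕ} {S : Finset ℕ}

theorem cnt_eq_card (hS : S ⊆ range m) (x : ℕ) :
    cnt n m row S x = #(S.filter fun i => ∀ j < n, bit x j = 1 → j ∉ row i) := by
  unfold cnt ind
  simp only [avoid_eq_ite, ite_mul, one_mul, zero_mul]
  rw [← sum_filter, filter_mem_eq_inter, inter_eq_right.2 hS, card_filter]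
  push_cast; rfl

theorem prod_sub_eq_descFactorial (c k : ℕ) :
    ∏ j ∈ range k, ((c : ℤ) - j) = c.descFactorial k := by
  induction k with
  | zero => simp
  | succ k ih =>
    rw [prod_range_succ, ih, Nat.descFactorial_succ]
    rcases le_or_gt k c with h | h
    · push_cast [h]; ring
    · simp [Nat.descFactorial_of_lt h]

/-- A `k`-subfamily has a union avoiding `x` iff it is chosen among the members avoiding `x`. The
descending factorial counts these choices with the factor `k!`, which is harmless because only signs
are tested. -/
theorem tuples_eq (hS : S ⊆ range m) (x : ℕ) :
    tuples n m k row S x =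
      k.factorial * ∑ C ∈ S.powersetCard k, avoid n (C.biUnion row) x := by
  unfold tuples
  rw [cnt_eq_card hS, prod_sub_eq_descFactorial, Nat.descFactorial_eq_factorial_mul_choose,
    ← card_powersetCard]
  push_cast
  congr 1
  simp only [avoid_eq_ite]
  rw [← sum_filter, sum_const, nsmul_eq_mul, mul_one]
  norm_cast
  congr 1
  ext C
  simp only [mem_filter, mem_powersetCard, mem_biUnion, subset_iff]
  constructor
  · rintro ⟨h1, h2⟩
    refine ⟨⟨fun i hi => (h1 hi).1, h2⟩, fun j hj hb => ?_⟩
    rintro ⟨i, hi, hij⟩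
    exact (h1 hi).2 j hj hb hij
  · rintro ⟨⟨h1, h2⟩, h3⟩
    exact ⟨fun i hi => ⟨h1 hi, fun j hj hb hij => h3 j hj hb ⟨i, hi, hij⟩⟩, h2⟩

theorem cnt_nonneg_le (x : ℕ) : 0 ≤ cnt n m row S x ∧ cnt n m row S x ≤ m := by
  have h : ∀ i ∈ range m, 0 ≤ ind S i * avoid n (row i) x ∧ ind S i * avoid n (row i) x ≤ 1 := by
    intro i _
    rw [avoid_eq_ite, ind]
    split_ifs <;> simp
  exact ⟨sum_nonneg fun i hi => (h i hi).1,
    (sum_le_sum fun i hi => (h i hi).2).trans (by simp)⟩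

theorem abs_tuples_le {i : ℕ} (hi : i ≤ m) (x : ℕ) :
    |tuples n m i row S x| ≤ ((m : ℤ) + 1) ^ m := by
  unfold tuples
  rw [abs_prod]
  obtain ⟨h1, h2⟩ := cnt_nonneg_le (n := n) (m := m) (row := row) (S := S) x
  calc _ ≤ ∏ _j ∈ range i, ((m : ℤ) + 1) := by
        refine prod_le_prod (fun _ _ => abs_nonneg _) fun j hj => ?_
        rw [mem_range] at hj
        rw [abs_le]; omega
    _ = ((m : ℤ) + 1) ^ i := by simp
    _ ≤ _ := pow_le_pow_right₀ (by omega) hi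

theorem avoid_add {a b x : ℕ} (s : Finset ℕ) (hx : x < 2 ^ a) (w : ℕ) :
    avoid (a + b) s (x + 2 ^ a * w) =
      avoid a s x * ∏ j ∈ range b, (1 - bit w j * ind s (a + j)) := by
  unfold avoid
  rw [prod_range_add]
  congr 1
  · exact prod_congr rfl fun j hj => by rw [bit_add_mul_of_lt (mem_range.1 hj)]
  · exact prod_congr rfl fun j _ => by rw [bit_add_mul_add hx]

theorem sgn_add {a b x : ℕ} (hx : x < 2 ^ a) (w : ℕ) :
    sgn (a + b) (x + 2 ^ a * w) = sgn a x * sgn b w := by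
  unfold sgn
  rw [prod_range_add]
  congr 1
  · exact prod_congr rfl fun j hj => by rw [bit_add_mul_of_lt (mem_range.1 hj)]
  · exact prod_congr rfl fun j _ => by rw [bit_add_mul_add hx]

theorem avoid_of_lt {a x : ℕ} (s : Finset ℕ) (hx : x < 2 ^ a) (ha : a ≤ n) :
    avoid n s x = avoid a s x := by
  obtain ⟨b, rfl⟩ := Nat.exists_eq_add_of_le ha
  simpa [bit] using avoid_add (b := b) s hx 0

end

/-! ### Patterns on a prefix of the ground set and the shortened inclusion–exclusion -/

/-- Up to the factor `k !`, the number of `k`-subfamilies of `S` whose union meets the first `a`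
elements in the set encoded by `y`. -/
def pattern (n m k : ℕ) (row : ℕ → Finset ℕ) (S : Finset ℕ) (a : ℕ) : ℕ → ℤ :=
  mob a fun x => tuples n m k row S (2 ^ a - 1 - x)

/-- Some `k` members of `S` cover the first `n` elements. -/
def Feasible (n k : ℕ) (row : ℕ → Finset ℕ) (S : Finset ℕ) : Prop :=
  ∃ C ⊆ S, #C = k ∧ ∀ j < n, j ∈ C.biUnion row

section

variable {n m k a : ℕ} {row : ℕ → Finset ℕ} {S : Finset ℕ}

/-- Avoiding the complement of `x` means that the trace of the union lies inside `x`. Möbius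
inversion turns this containment into equality of the trace with `y`, separately for each `C`. -/
theorem pattern_eq (hS : S ⊆ range m) (ha : a ≤ n) {y : ℕ} (hy : y < 2 ^ a) :
    pattern n m k row S a y = k.factorial * ∑ C ∈ S.powersetCard k,
      if ∀ j < a, bit y j = ind (C.biUnion row) j then 1 else 0 := by
  unfold pattern
  rw [mob_eq_sum _ hy]
  simp only [tuples_eq hS, mul_assoc, sum_mul]
  rw [← mul_sum, sum_comm]
  congr 1
  refine sum_congr rfl fun C _ => ?_
  set u := C.biUnion row
  calc _ = ∑ x ∈ range (2 ^ a), ∏ j ∈ range a,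
        (1 - (1 - bit x j) * ind u j) * kappa (bit y j) (bit x j) := by
        refine sum_congr rfl fun x hx => ?_
        rw [mem_range] at hx
        rw [avoid_of_lt u (by omega) ha, avoid, ← prod_mul_distrib]
        exact prod_congr rfl fun j hj => by rw [bit_compl (mem_range.1 hj) hx]
    _ = _ := by
        rw [sum_prod_bit fun j b => (1 - (1 - b) * ind u j) * kappa (bit y j) b]
        split_ifs with h
        · refine prod_eq_one fun j hj => ?_
          rw [h j (mem_range.1 hj)]
          rcases ind_eq_zero_or_one u j with h | h <;> simp [h, kappa]
        · push Not at h
          obtain ⟨j, hj, h⟩ := h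
          refine prod_eq_zero (mem_range.2 hj) ?_
          rcases ind_eq_zero_or_one u j with h1 | h1 <;>
            rcases bit_eq_zero_or_one y j with h2 | h2 <;> simp [h1, h2, kappa] at h ⊢

theorem pattern_pos_iff (hS : S ⊆ range m) (ha : a ≤ n) {y : ℕ} (hy : y < 2 ^ a) :
    0 < pattern n m k row S a y ↔
      ∃ C ∈ S.powersetCard k, ∀ j < a, bit y j = ind (C.biUnion row) j := by
  rw [pattern_eq hS ha hy, mul_pos_iff_of_pos_left (by positivity)]
  constructor
  · intro h
    obtain ⟨C, hC, h⟩ := exists_ne_zero_of_sum_ne_zero h.ne'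
    exact ⟨C, hC, by by_contra hcon; exact h (if_neg hcon)⟩
  · rintro ⟨C, hC, h⟩
    refine sum_pos' (fun C _ => ?_) ⟨C, hC, ?_⟩
    · split_ifs <;> norm_num
    · rw [if_pos h]; exact one_pos

/-- A pattern is the trace of a union on the first `a` elements, so distinct patterns have distinct
unions as preimages. -/
theorem card_pattern_le (hS : S ⊆ range m) (ha : a ≤ n) :
    #((range (2 ^ a)).filter fun y => 0 < pattern n m k row S a y) ≤
      #((S.powersetCard k).image fun C => C.biUnion row) := by
  classical
  have h : ∀ y ∈ (range (2 ^ a)).filter fun y => 0 < pattern n m k row S a y,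
      ∃ u ∈ (S.powersetCard k).image (fun C => C.biUnion row), ∀ j < a, bit y j = ind u j := by
    intro y hy
    rw [mem_filter, mem_range] at hy
    obtain ⟨C, hC, h⟩ := (pattern_pos_iff hS ha hy.1).1 hy.2
    exact ⟨_, mem_image_of_mem _ hC, h⟩
  choose! f hf hb using h
  refine card_le_card_of_injOn f hf fun y hy z hz hyz => ?_
  have hy' := mem_range.1 (mem_filter.1 hy).1
  have hz' := mem_range.1 (mem_filter.1 hz).1
  exact eq_of_bit_eq hy' hz' fun j hj => by rw [hb y hy j hj, hb z hz j hj, hyz]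

/-- After expansion by `tuples_eq`, the sum for a fixed `C` is the product of a sum over the prefix
digits `x` and one over the remaining digits `w`. The claim is that this product is the indicator of
`C` being a cover. -/
theorem sum_corr_eq {b : ℕ} (hS : S ⊆ range m) (hn : n = a + b) :
    ∑ x ∈ range (2 ^ a), ∑ w ∈ range (2 ^ b),
      corr a (fun x => 0 < pattern n m k row S a (2 ^ a - 1 - x)) (a + 1) x *
        (tuples n m k row S (x + 2 ^ a * w) * sgn n (x + 2 ^ a * w)) =
      k.factorial * #((S.powersetCard k).filter fun C => ∀ j < n, j ∈ C.biUnion row) := by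
  subst hn
  set c := corr a (fun x => 0 < pattern (a + b) m k row S a (2 ^ a - 1 - x)) (a + 1) with hc
  have key : ∀ C ∈ S.powersetCard k,
      (∑ x ∈ range (2 ^ a), c x * (sgn a x * avoid a (C.biUnion row) x)) *
        (∑ w ∈ range (2 ^ b), sgn b w *
          ∏ j ∈ range b, (1 - bit w j * ind (C.biUnion row) (a + j))) =
      if ∀ j < a + b, j ∈ C.biUnion row then 1 else 0 := by
    intro C hC
    set u := C.biUnion row with hu
    -- Plain inclusion–exclusion on the last `b` elements: each factor is `1` if the element is
    -- covered and `0` otherwise.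
    have h2 : ∑ w ∈ range (2 ^ b), sgn b w * ∏ j ∈ range b, (1 - bit w j * ind u (a + j)) =
        ∏ j ∈ range b, ind u (a + j) := by
      simp only [sgn, ← prod_mul_distrib]
      rw [sum_prod_bit fun j y => (1 - 2 * y) * (1 - y * ind u (a + j))]
      exact prod_congr rfl fun j _ => by ring
    -- `v` encodes the prefix elements that the union misses; sign times avoidance is, up to `sgn a
    -- v`, row `v` of the Möbius kernel.
    obtain ⟨v, hv, hvb⟩ := exists_bit_eq a fun j => j ∉ u
    have hvb' : ∀ j < a, bit v j = 1 - ind u j := fun j hj => by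
      rw [hvb j hj, ind]; split_ifs <;> simp_all
    have h1 : ∑ x ∈ range (2 ^ a), c x * (sgn a x * avoid a u x) = sgn a v * mob a c v := by
      rw [mob_eq_sum c hv, mul_sum]
      refine sum_congr rfl fun x _ => ?_
      rw [mul_left_comm (sgn a v)]
      congr 1
      simp only [sgn, avoid, ← prod_mul_distrib]
      refine prod_congr rfl fun j hj => ?_
      rw [hvb' j (mem_range.1 hj)]
      rcases ind_eq_zero_or_one u j with h1 | h1 <;>
        rcases bit_eq_zero_or_one x j with h2 | h2 <;> simp [h1, h2, kappa]
    -- `C` itself shows that the complement of `v` occurs as a pattern, so `v` lies in the support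
    -- on which `corr` solves the system.
    have hpos : 0 < pattern (a + b) m k row S a (2 ^ a - 1 - v) := by
      rw [pattern_pos_iff hS (by omega) (by omega)]
      refine ⟨C, hC, fun j hj => ?_⟩
      rw [bit_compl hj hv, hvb' j hj]; ring
    rw [h1, h2, hc, mob_corr _ hv hpos]
    by_cases h : ∀ j < a + b, j ∈ u
    · rw [if_pos h]
      have hv0 : v = 0 := eq_of_bit_eq hv (by positivity) fun j hj => by
        rw [hvb' j hj, ind, if_pos (h j (by omega))]; simp [bit]
      rw [if_pos hv0, hv0, prod_eq_one fun j hj => by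
        rw [ind, if_pos (h _ (by have := mem_range.1 hj; omega))]]
      simp [sgn, bit]
    · rw [if_neg h]
      push Not at h
      obtain ⟨j, hj, hju⟩ := h
      -- An uncovered element of the prefix makes `v ≠ 0`, which kills the first factor; one beyond
      -- the prefix kills the second.
      rcases lt_or_ge j a with hja | hja
      · rw [if_neg, mul_zero, zero_mul]
        rintro rfl
        have := hvb' j hja
        simp [bit, ind, hju] at this
      · rw [prod_eq_zero (mem_range.2 (show j - a < b by omega)), mul_zero]
        rw [Nat.add_sub_cancel' hja, ind, if_neg hju]
  rw [card_filter]
  push_cast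
  rw [← sum_congr rfl key]
  calc _ = ∑ x ∈ range (2 ^ a), ∑ w ∈ range (2 ^ b), ∑ C ∈ S.powersetCard k,
        (k.factorial : ℤ) * ((c x * (sgn a x * avoid a (C.biUnion row) x)) *
          (sgn b w * ∏ j ∈ range b, (1 - bit w j * ind (C.biUnion row) (a + j)))) := by
        refine sum_congr rfl fun x hx => sum_congr rfl fun w _ => ?_
        rw [tuples_eq hS, mul_sum, sum_mul, mul_sum]
        refine sum_congr rfl fun C _ => ?_
        rw [avoid_add _ (mem_range.1 hx), sgn_add (mem_range.1 hx)]
        ring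
    _ = _ := by
        rw [sum_congr rfl fun x _ => sum_comm, sum_comm, mul_sum]
        refine sum_congr rfl fun C _ => ?_
        rw [sum_mul_sum, mul_sum]
        exact sum_congr rfl fun x _ => (mul_sum _ _ _).symm

theorem feasible_iff :
    Feasible n k row S ↔
      (0 : ℤ) < k.factorial *
        #((S.powersetCard k).filter fun C => ∀ j < n, j ∈ C.biUnion row) := by
  rw [mul_pos_iff_of_pos_left (by positivity), Nat.cast_pos, card_pos]
  constructor
  · rintro ⟨C, h1, h2, h3⟩
    exact ⟨C, mem_filter.2 ⟨mem_powersetCard.2 ⟨h1, h2⟩, h3⟩⟩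
  · rintro ⟨C, hC⟩
    rw [mem_filter, mem_powersetCard] at hC
    exact ⟨C, hC.1.1, hC.1.2, hC.2⟩

end

end SubsetTransform

/-! ### Program rules with the computed values named explicitly -/

namespace RAM

variable {M : ℕ} {σ : Store} {P : Prog} {K : ℕ} {Q : Store → Prop} {e f : Ex}

theorem Runs.asg_seq (hM : 128 ≤ M) {i : ℕ} (z : ℤ) (hv : e.eval σ = z) (hz : |z| ≤ M)
    (h : Runs M P (σ.set i z) K Q)
    (he : e.good := by decide +kernel) (hi : i < 64 := by decide) :
    Runs M (.seq (.asg i e) P) σ (1 + K) Q := by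
  subst hv
  exact Runs.seq (Q' := fun σ' => σ' = σ.set i (e.eval σ)) (Runs.asg hM hz rfl he hi)
    fun σ' h' => h' ▸ h

theorem Runs.put_seq (hM : 128 ≤ M) (a : ℕ) (z : ℤ) (ha : e.eval σ = a) (hv : f.eval σ = z)
    (hz : |z| ≤ M) (h : Runs M P (σ.put a z) K Q)
    (he : e.good := by decide +kernel) (hf : f.good := by decide +kernel) :
    Runs M (.seq (.put e f) P) σ (1 + K) Q := by
  subst hv
  have ha' : (e.eval σ).toNat = a := by omega
  subst ha'
  exact Runs.seq (Q' := fun σ' => σ' = σ.put _ (f.eval σ)) (Runs.put hM hz rfl he hf)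
    fun σ' h' => h' ▸ h

theorem Runs.asg' (hM : 128 ≤ M) {i : ℕ} (z : ℤ) (hv : e.eval σ = z) (hz : |z| ≤ M)
    (h : Q (σ.set i z))
    (he : e.good := by decide +kernel) (hi : i < 64 := by decide) :
    Runs M (.asg i e) σ 1 Q := by
  subst hv
  exact Runs.asg hM hz h he hi

theorem Runs.put' (hM : 128 ≤ M) (a : ℕ) (z : ℤ) (ha : e.eval σ = a) (hv : f.eval σ = z)
    (hz : |z| ≤ M) (h : Q (σ.put a z))
    (he : e.good := by decide +kernel) (hf : f.good := by decide +kernel) :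
    Runs M (.put e f) σ 1 Q := by
  subst hv
  have ha' : (e.eval σ).toNat = a := by omega
  subst ha'
  exact Runs.put hM hz h he hf

end RAM

/-! ### Evaluating tuple counts and signs on the machine -/

namespace SubsetTransform

open Finset RAM RAM.Prog

infixr:60 " ;; " => RAM.Prog.seq

/-- Bounds on the numbers that the program handles. -/
structure Fits (n m k M : ℕ) : Prop where
  small : 128 ≤ M
  card : k ≤ m
  -- Room for the input, the indicator vector and three arrays of `2 ^ n` cells.
  addr : 3 + m * n + m + 4 * 2 ^ n ≤ M
  -- Up to `2 ^ n` summands, each a coefficient bounded by `(2 ^ n + 2) ^ (n + 1)` times a tuple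
  -- count bounded by `(m + 1) ^ m`.
  val : 2 ^ n * ((2 ^ n + 2) ^ (n + 1) * (m + 1) ^ m) ≤ M

theorem Fits.pow_le {n m k M : ℕ} (h : Fits n m k M) : ((m : ℤ) + 1) ^ m ≤ M := by
  have h1 : 1 * (1 * (m + 1) ^ m) ≤ 2 ^ n * ((2 ^ n + 2) ^ (n + 1) * (m + 1) ^ m) := by
    gcongr
    · exact Nat.one_le_two_pow
    · exact Nat.one_le_pow _ _ (by positivity)
  have := h1.trans h.val
  rw [one_mul, one_mul] at this
  exact_mod_cast this

/-- The memory contains the incidence matrix `row` and the indicator vector of `S`. -/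
structure Env (n m k : ℕ) (row : ℕ → Finset ℕ) (S : Finset ℕ) (σ : Store) : Prop where
  reg1 : σ.reg 1 = n
  reg2 : σ.reg 2 = m
  reg3 : σ.reg 3 = k
  reg5 : σ.reg 5 = (3 + m * n : ℕ)
  reg6 : σ.reg 6 = (3 + m * n + m : ℕ)
  reg7 : σ.reg 7 = (2 ^ n : ℕ)
  mem_row : ∀ i < m, ∀ j < n, σ.mem (3 + i * n + j) = ind (row i) j
  mem_act : ∀ i < m, σ.mem (3 + m * n + i) = ind S i

theorem Env.congr {n m k : ℕ} {row : ℕ → Finset ℕ} {S : Finset ℕ} {σ σ' : Store}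
    (h : Env n m k row S σ) (hr : ∀ r < 10, σ'.reg r = σ.reg r)
    (hm : ∀ a < 3 + m * n + m, σ'.mem a = σ.mem a) : Env n m k row S σ' where
  reg1 := by rw [hr 1 (by decide), h.reg1]
  reg2 := by rw [hr 2 (by decide), h.reg2]
  reg3 := by rw [hr 3 (by decide), h.reg3]
  reg5 := by rw [hr 5 (by decide), h.reg5]
  reg6 := by rw [hr 6 (by decide), h.reg6]
  reg7 := by rw [hr 7 (by decide), h.reg7]
  mem_row i hi j hj := by
    rw [hm _ _, h.mem_row i hi j hj]
    have : (i + 1) * n ≤ m * n := Nat.mul_le_mul_right _ hi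
    rw [add_mul] at this; omega
  mem_act i hi := by rw [hm _ (by omega), h.mem_act i hi]

/-- Evaluation at the argument in register `40`: the number of tuples in register `41`, the sign in
register `42`. -/
def evalProg : Prog :=
  asg 42 1 ;; asg 45 (.r 40) ;;
  forDo 44 (.r 1) (asg 42 (.r 42 * (1 - 2 * (.r 45 - 2 * (.r 45 / 2)))) ;; asg 45 (.r 45 / 2)) ;;
  asg 47 0 ;;
  forDo 43 (.r 2) (
    asg 46 (.ld (.r 5 + .r 43)) ;; asg 45 (.r 40) ;;
    forDo 44 (.r 1) (
      asg 46 (.r 46 * (1 - (.r 45 - 2 * (.r 45 / 2)) * .ld (3 + .r 43 * .r 1 + .r 44))) ;;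
      asg 45 (.r 45 / 2)) ;;
    asg 47 (.r 47 + .r 46)) ;;
  asg 41 1 ;;
  forDo 43 (.r 3) (asg 41 (.r 41 * (.r 47 - .r 43)))

def evalSteps (n m k : ℕ) : ℕ := 12 + 4 * n + m * (7 + 4 * n) + 3 * k

theorem bit_eq_sub (x j : ℕ) :
    bit x j = ((x / 2 ^ j : ℕ) : ℤ) - 2 * (((x / 2 ^ j : ℕ) : ℤ) / 2) := by
  unfold bit; omega

theorem div_two_pow_succ (x j : ℕ) :
    ((x / 2 ^ j : ℕ) : ℤ) / 2 = ((x / 2 ^ (j + 1) : ℕ) : ℤ) := by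
  rw [pow_succ, ← Nat.div_div_eq_div_mul]; omega

theorem avoid_nonneg_le (n : ℕ) (s : Finset ℕ) (x : ℕ) : 0 ≤ avoid n s x ∧ avoid n s x ≤ 1 := by
  rw [avoid_eq_ite]; split_ifs <;> simp

theorem ind_nonneg_le (s : Finset ℕ) (j : ℕ) : 0 ≤ ind s j ∧ ind s j ≤ 1 := by
  unfold ind; split_ifs <;> simp

section

variable {n m k M : ℕ} {row : ℕ → Finset ℕ} {S : Finset ℕ} {σ : Store}

/-- Register `45` runs through `x / 2 ^ j`, whose parity is digit `j`. Registers `42`, `46`, `47`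
and `41` accumulate the sign, the avoidance indicator of one set, the count and the falling
factorial. -/
theorem runs_eval (hF : Fits n m k M) (hE : Env n m k row S σ) {x : ℕ}
    (hx : x < 2 ^ n) (h40 : σ.reg 40 = x) :
    Runs M evalProg σ (evalSteps n m k) fun σ' => σ'.mem = σ.mem ∧
      (∀ r < 41, σ'.reg r = σ.reg r) ∧ σ'.reg 41 = tuples n m k row S x ∧
      σ'.reg 42 = sgn n x := by
  have hM := hF.small
  have haddr := hF.addr
  have hn2 : n < 2 ^ n := Nat.lt_two_pow_self
  have hdiv : ∀ j, |((x / 2 ^ j : ℕ) : ℤ)| ≤ M := fun j => by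
    have := Nat.div_le_self x (2 ^ j)
    rw [Nat.abs_cast]; omega
  have hone : (1 : ℤ) ≤ M := by omega
  refine Runs.mono (Runs.asg_seq hM 1 rfl (by simpa using hone)
    (Runs.asg_seq hM x (by simp [h40]) (by simpa using hdiv 0) (Runs.seq
    (Q' := fun σ' => σ'.mem = σ.mem ∧ (∀ r < 41, σ'.reg r = σ.reg r) ∧ σ'.reg 42 = sgn n x)
    (Runs.forDo hM (fun j σ' => σ'.mem = σ.mem ∧ (∀ r < 41, σ'.reg r = σ.reg r) ∧
      σ'.reg 42 = sgn j x ∧ σ'.reg 45 = (x / 2 ^ j : ℕ) ∧ σ'.reg 44 = j)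
      n (1 + 1) (by omega) ?_ ?_ ?_ ?_)
    fun σ₁ h₁ => Runs.asg_seq hM 0 rfl (by simp) (Runs.seq
    (Q' := fun σ' => σ'.mem = σ.mem ∧ (∀ r < 41, σ'.reg r = σ.reg r) ∧ σ'.reg 42 = sgn n x ∧
      σ'.reg 47 = cnt n m row S x)
    (Runs.forDo hM (fun i σ' => σ'.mem = σ.mem ∧ (∀ r < 41, σ'.reg r = σ.reg r) ∧
      σ'.reg 42 = sgn n x ∧ σ'.reg 43 = i ∧ σ'.reg 47 = cnt n i row S x)
      m (5 + 4 * n) (by omega) ?_ ?_ ?_ ?_)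
    fun σ₂ h₂ => Runs.asg_seq hM 1 rfl (by simpa using hone)
    (Runs.forDo hM (fun j σ' => σ'.mem = σ.mem ∧ (∀ r < 41, σ'.reg r = σ.reg r) ∧
      σ'.reg 42 = sgn n x ∧ σ'.reg 43 = j ∧ σ'.reg 47 = cnt n m row S x ∧
      σ'.reg 41 = tuples n m j row S x)
      k 1 (by have := hF.card; omega) ?_ ?_ ?_ ?_)))))
    (by simp only [evalSteps]; ring_nf; omega) fun σ' h => h
  · refine ⟨rfl, fun r hr => ?_, ?_, ?_, ?_⟩
    · simp [show r ≠ 42 by omega, show r ≠ 44 by omega, show r ≠ 45 by omega]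
    · simp [sgn]
    · simp
    · simp
  · rintro j hj σ' ⟨h1, h2, h3, h4, h5⟩
    exact ⟨h5, by simp [h2, hE.reg1]⟩
  · rintro j hj σ' ⟨h1, h2, h3, h4, h5⟩
    refine Runs.asg_seq hM (sgn (j + 1) x) ?_ (by rw [abs_sgn]; exact hone)
      (Runs.asg' hM ((x / 2 ^ (j + 1) : ℕ) : ℤ) ?_ (hdiv _) ?_)
    · rw [sgn, prod_range_succ, bit_eq_sub]
      simp [h3, h4, sgn]
    · rw [← div_two_pow_succ]; simp [h4]
    · refine ⟨by simp [h5], by simpa using h1, fun r hr => ?_, by simp, by simp, by simp⟩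
      simp [show r ≠ 42 by omega, show r ≠ 44 by omega, show r ≠ 45 by omega, h2 r hr]
  · rintro σ' ⟨h1, h2, h3, h4, h5⟩
    exact ⟨h1, h2, h3⟩
  · obtain ⟨h1, h2, h3⟩ := h₁
    refine ⟨by simpa using h1, fun r hr => ?_, by simpa using h3, by simp, by simp [cnt]⟩
    simp [show r ≠ 43 by omega, show r ≠ 47 by omega, h2 r hr]
  · rintro i hi σ' ⟨h1, h2, h3, h4, h5⟩
    exact ⟨h4, by simp [h2, hE.reg2]⟩
  · rintro i hi σ' ⟨h1, h2, h3, h4, h5⟩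
    have hact : σ.mem (3 + m * n + i) = ind S i := hE.mem_act i hi
    have hb : ∀ j, |ind S i * avoid j (row i) x| ≤ M := fun j => by
      obtain ⟨b1, b2⟩ := ind_nonneg_le S i
      obtain ⟨b3, b4⟩ := avoid_nonneg_le j (row i) x
      rw [abs_of_nonneg (by positivity)]
      exact (mul_le_one₀ b2 b3 b4).trans hone
    refine Runs.mono (Runs.asg_seq hM (ind S i) ?_ ?_
      (Runs.asg_seq hM x (by simp [h2, h40]) (by simpa using hdiv 0)
      (Runs.seq (Q' := fun σ' => σ'.mem = σ.mem ∧ (∀ r < 41, σ'.reg r = σ.reg r) ∧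
        σ'.reg 42 = sgn n x ∧ σ'.reg 43 = i ∧ σ'.reg 47 = cnt n i row S x ∧
        σ'.reg 46 = ind S i * avoid n (row i) x)
      (Runs.forDo hM (fun j σ' => σ'.mem = σ.mem ∧ (∀ r < 41, σ'.reg r = σ.reg r) ∧
        σ'.reg 42 = sgn n x ∧ σ'.reg 43 = i ∧ σ'.reg 47 = cnt n i row S x ∧
        σ'.reg 46 = ind S i * avoid j (row i) x ∧ σ'.reg 45 = (x / 2 ^ j : ℕ) ∧ σ'.reg 44 = j)
        n (1 + 1) (by omega) ?_ ?_ ?_ ?_)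
      fun σ₃ h₃ => Runs.asg' hM (cnt n (i + 1) row S x) ?_ ?_ ?_))) (by omega) fun σ' h => h
    · simp only [Ex.eval_ld, Ex.eval_add, Ex.eval_r, h2 5 (by decide), hE.reg5, h4, h1]
      rw [← hact]; congr 1
    · simpa [avoid] using hb 0
    · refine ⟨by simpa using h1, fun r hr => ?_, by simp [h3], by simp [h4], by simp [h5],
        by simp [avoid], by simp, by simp⟩
      simp [show r ≠ 44 by omega, show r ≠ 45 by omega, show r ≠ 46 by omega, h2 r hr]
    · rintro j hj σ₄ ⟨g1, g2, g3, g4, g5, g6, g7, g8⟩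
      exact ⟨g8, by simp [g2, hE.reg1]⟩
    · rintro j hj σ₄ ⟨g1, g2, g3, g4, g5, g6, g7, g8⟩
      have hrow : σ.mem (3 + i * n + j) = ind (row i) j := hE.mem_row i hi j hj
      refine Runs.asg_seq hM (ind S i * avoid (j + 1) (row i) x) ?_ (hb _)
        (Runs.asg' hM ((x / 2 ^ (j + 1) : ℕ) : ℤ) ?_ (hdiv _) ?_)
      · rw [avoid, prod_range_succ, bit_eq_sub, ← hrow]
        simp only [Ex.eval_ld, Ex.eval_add, Ex.eval_mul, Ex.eval_sub, Ex.eval_div, Ex.eval_r,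
          Ex.eval_one, Ex.eval_two, Ex.eval_three, g4, g6, g7, g8, g2 1 (by decide), hE.reg1, g1,
          avoid]
        rw [show ((3 : ℤ) + i * n + j).toNat = 3 + i * n + j by norm_cast]
        ring
      · rw [← div_two_pow_succ]; simp [g7]
      · refine ⟨by simp [g8], by simpa using g1, fun r hr => ?_, by simp [g3], by simp [g4],
          by simp [g5], by simp, by simp, by simp⟩
        simp [show r ≠ 44 by omega, show r ≠ 45 by omega, show r ≠ 46 by omega, g2 r hr]
    · rintro σ₄ ⟨g1, g2, g3, g4, g5, g6, g7, g8⟩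
      exact ⟨g1, g2, g3, g4, g5, g6⟩
    · obtain ⟨g1, g2, g3, g4, g5, g6⟩ := h₃
      simp [g5, g6, cnt, sum_range_succ]
    · obtain ⟨h1, h2⟩ := cnt_nonneg_le (n := n) (m := i + 1) (row := row) (S := S) x
      rw [abs_of_nonneg h1]
      push_cast at h2; omega
    · obtain ⟨g1, g2, g3, g4, g5, g6⟩ := h₃
      refine ⟨by simp [g4], by simpa using g1, fun r hr => ?_, by simp [g3], by simp,
        by simp⟩
      simp [show r ≠ 43 by omega, show r ≠ 47 by omega, g2 r hr]
  · rintro σ' ⟨h1, h2, h3, h4, h5⟩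
    exact ⟨h1, h2, h3, h5⟩
  · obtain ⟨h1, h2, h3, h4⟩ := h₂
    refine ⟨by simpa using h1, fun r hr => ?_, by simpa using h3, by simp, by simpa using h4,
      by simp [tuples]⟩
    simp [show r ≠ 43 by omega, show r ≠ 41 by omega, h2 r hr]
  · rintro i hi σ' ⟨h1, h2, h3, h4, h5, h6⟩
    exact ⟨h4, by simp [h2, hE.reg3]⟩
  · rintro i hi σ' ⟨h1, h2, h3, h4, h5, h6⟩
    refine Runs.asg' hM (tuples n m (i + 1) row S x) ?_ ?_ ?_
    · simp [h4, h5, h6, tuples, prod_range_succ]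
    · exact (abs_tuples_le (by have := hF.card; omega) x).trans hF.pow_le
    · refine ⟨by simp [h4], by simpa using h1, fun r hr => ?_, by simp [h3], by simp,
        by simp [h5], by simp⟩
      simp [show r ≠ 43 by omega, show r ≠ 41 by omega, h2 r hr]
  · rintro σ' ⟨h1, h2, h3, h4, h5, h6⟩
    exact ⟨h1, h2, h6, h3⟩

end

end SubsetTransform

/-! ### The Möbius transform in place -/

namespace SubsetTransform

open Finset RAM RAM.Prog

/-- The transform of the array that starts at the address in register `20`; the dimension and the
length are in the registers `11` and `12`. -/
def transProg : Prog :=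
  asg 31 1 ;;
  forDo 30 (.r 11) (
    forDo 32 (.r 12) (
      Prog.cond (.r 32 / .r 31 - 2 * (.r 32 / .r 31 / 2))
        (put (.r 20 + .r 32) (.ld (.r 20 + .r 32) - .ld (.r 20 + .r 32 - .r 31))) .skip) ;;
    asg 31 (2 * .r 31))

def transSteps (a : ℕ) : ℕ := 3 + a * (5 + 4 * 2 ^ a)

theorem two_pow_le_of_bit {x j : ℕ} (h : bit x j = 1) : 2 ^ j ≤ x := by
  by_contra! hlt
  simp [bit, Nat.div_eq_of_lt hlt] at h

theorem bit_sub_two_pow {x j : ℕ} (h : bit x j = 1) : bit (x - 2 ^ j) j = 0 := by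
  have := Nat.sub_mul_div x (2 ^ j) 1
  rw [mul_one] at this
  unfold bit at h ⊢
  omega

/-- Within round `j` the array is scanned upwards and overwritten. This is safe: the entry at `x - 2
^ j`, although already passed, has digit `j` equal to zero and was left unchanged by the round. -/
theorem runs_trans {M : ℕ} {σ : Store} (hM : 128 ≤ M) {a B : ℕ} {F : ℤ}
    (h20 : σ.reg 20 = B) (h11 : σ.reg 11 = a) (h12 : σ.reg 12 = (2 ^ a : ℕ)) (ha : 2 ^ a ≤ M)
    (hf : ∀ x < 2 ^ a, |σ.mem (B + x)| ≤ F) (hF : 2 ^ a * F ≤ M) :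
    Runs M transProg σ (transSteps a) fun σ' => (∀ r < 30, σ'.reg r = σ.reg r) ∧
      (∀ c, c < B ∨ B + 2 ^ a ≤ c → σ'.mem c = σ.mem c) ∧
      ∀ x < 2 ^ a, σ'.mem (B + x) = mob a (fun y => σ.mem (B + y)) x := by
  set f : ℕ → ℤ := fun y => σ.mem (B + y) with hfdef
  have hF0 : 0 ≤ F := (abs_nonneg _).trans (hf 0 (by positivity))
  have hmob : ∀ j ≤ a, ∀ x < 2 ^ a, |mob j f x| ≤ M := fun j hj x hx =>
    (abs_mob_le hf j x hx).trans ((mul_le_mul_of_nonneg_right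
      (pow_le_pow_right₀ (by norm_num) hj) hF0).trans hF)
  have ha2 : a < 2 ^ a := Nat.lt_two_pow_self
  have hpow : ∀ j ≤ a, |((2 ^ j : ℕ) : ℤ)| ≤ M := fun j hj => by
    have := Nat.pow_le_pow_right (show 0 < 2 by norm_num) hj
    rw [Nat.abs_cast]; omega
  refine Runs.mono (Runs.asg_seq hM 1 rfl (by simpa using hpow 0 (by omega))
    (Runs.forDo hM (fun j σ' => (∀ r < 30, σ'.reg r = σ.reg r) ∧
      (∀ c, c < B ∨ B + 2 ^ a ≤ c → σ'.mem c = σ.mem c) ∧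
      (∀ x < 2 ^ a, σ'.mem (B + x) = mob j f x) ∧ σ'.reg 30 = j ∧ σ'.reg 31 = (2 ^ j : ℕ))
      a (3 + 4 * 2 ^ a) (by omega) ?_ ?_ ?_ ?_))
      (by simp only [transSteps]; ring_nf; omega) fun σ' h => h
  · refine ⟨fun r hr => ?_, by simp, by simp [mob, hfdef], by simp, by simp⟩
    simp [show r ≠ 30 by omega, show r ≠ 31 by omega]
  · rintro j hj σ' ⟨h1, h2, h3, h4, h5⟩
    exact ⟨h4, by simp [h1, h11]⟩
  · rintro j hj σ' ⟨h1, h2, h3, h4, h5⟩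
    refine Runs.mono (Runs.seq (Q' := fun σ' => (∀ r < 30, σ'.reg r = σ.reg r) ∧
      (∀ c, c < B ∨ B + 2 ^ a ≤ c → σ'.mem c = σ.mem c) ∧
      (∀ x < 2 ^ a, σ'.mem (B + x) = mob (j + 1) f x) ∧ σ'.reg 30 = j ∧ σ'.reg 31 = (2 ^ j : ℕ))
      (Runs.forDo hM (fun x σ' => (∀ r < 30, σ'.reg r = σ.reg r) ∧
        (∀ c, c < B ∨ B + 2 ^ a ≤ c → σ'.mem c = σ.mem c) ∧
        (∀ y < 2 ^ a, σ'.mem (B + y) = if y < x then mob (j + 1) f y else mob j f y) ∧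
        σ'.reg 30 = j ∧ σ'.reg 31 = (2 ^ j : ℕ) ∧ σ'.reg 32 = x)
        (2 ^ a) (1 + 1) ha ?_ ?_ ?_ ?_)
      fun σ₁ h₁ => Runs.asg' hM ((2 ^ (j + 1) : ℕ) : ℤ) ?_ (hpow _ hj) ?_) (by omega)
      fun σ' h => h
    · refine ⟨fun r hr => ?_, by simpa using h2, by simpa using h3, by simp [h4], by simp [h5],
        by simp⟩
      simp [show r ≠ 32 by omega, h1 r hr]
    · rintro x hx σ' ⟨g1, g2, g3, g4, g5, g6⟩
      exact ⟨g6, by simp [g1, h12]⟩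
    · rintro x hx σ' ⟨g1, g2, g3, g4, g5, g6⟩
      have hguard : Ex.eval σ' (.r 32 / .r 31 - 2 * (.r 32 / .r 31 / 2)) = bit x j := by
        rw [bit_eq_sub]; simp [g5, g6]
      refine Runs.cond hM (fun h => ?_) (fun h => Runs.skip ?_)
      · rw [hguard] at h
        have hb : bit x j = 1 := by have := bit_eq_zero_or_one x j; omega
        have hle := two_pow_le_of_bit hb
        have hz := bit_sub_two_pow hb
        have hpos : 0 < 2 ^ j := by positivity
        have hv : mob (j + 1) f x = mob j f x - mob j f (x - 2 ^ j) := by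
          simp [mob, mobStep, hb]
        refine Runs.put' hM (B + x) (mob (j + 1) f x) ?_ ?_ (hmob _ hj _ hx) ?_
        · simp [g1, h20, g6]
        · have e1 := g3 x hx
          have e2 := g3 (x - 2 ^ j) (by omega)
          rw [if_neg (lt_irrefl _)] at e1
          rw [if_pos (by omega), mob, mobStep, hz, if_neg (by norm_num)] at e2
          simp only [Ex.eval_ld, Ex.eval_add, Ex.eval_sub, Ex.eval_r, g1 20 (by decide), h20, g5,
            g6]
          rw [hv, ← e1, ← e2]
          congr 2
          omega
        · refine ⟨by simp [g6], fun r hr => by simp [show r ≠ 32 by omega, g1 r hr], fun c hc => ?_, fun y hy => ?_, by simp [g4],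
            by simp [g5], by simp⟩
          · simp only [Store.set_mem, Store.put_mem]
            rw [if_neg (by omega), g2 c hc]
          · simp only [Store.set_mem, Store.put_mem, g3 y hy]
            rcases lt_trichotomy y x with h' | h' | h'
            · rw [if_neg (by omega), if_pos h', if_pos (by omega)]
            · rw [if_pos (by omega), if_pos (by omega), h']
            · rw [if_neg (by omega), if_neg (by omega), if_neg (by omega)]
      · rw [hguard] at h
        have hb : bit x j = 0 := by have := bit_eq_zero_or_one x j; omega
        have hv : mob (j + 1) f x = mob j f x := by simp [mob, mobStep, hb]
        refine ⟨g6, fun r hr => by simp [show r ≠ 32 by omega, g1 r hr], by simpa using g2, fun y hy => ?_, by simp [g4],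
          by simp [g5], by simp⟩
        simp only [Store.set_mem, g3 y hy]
        rcases lt_trichotomy y x with h' | h' | h'
        · rw [if_pos h', if_pos (by omega)]
        · rw [if_neg (by omega), if_pos (by omega), h', hv]
        · rw [if_neg (by omega), if_neg (by omega)]
    · rintro σ' ⟨g1, g2, g3, g4, g5, g6⟩
      exact ⟨g1, g2, fun x hx => by rw [g3 x hx, if_pos hx], g4, g5⟩
    · obtain ⟨g1, g2, g3, g4, g5⟩ := h₁
      simp [g5, pow_succ, mul_comm]
    · obtain ⟨g1, g2, g3, g4, g5⟩ := h₁
      refine ⟨by simp [g4], fun r hr => ?_, by simpa using g2, by simpa using g3, by simp,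
        by simp⟩
      simp [show r ≠ 30 by omega, show r ≠ 31 by omega, g1 r hr]
  · rintro σ' ⟨h1, h2, h3, h4, h5⟩
    exact ⟨h1, h2, h3⟩

end SubsetTransform

/-! ### Searching for the length of the prefix -/

namespace SubsetTransform

open Finset RAM RAM.Prog

/-- Writes the numbers of tuples for all subsets of the first `a` elements. -/
def fillProg : Prog :=
  forDo 16 (.r 12) (asg 40 (.r 12 - 1 - .r 16) ;; evalProg ;; put (.r 6 + .r 16) (.r 41))

/-- Counts the positive entries of the first array in register `15`. -/
def countProg : Prog :=
  asg 15 0 ;; forDo 16 (.r 12) (Prog.cond (.ld (.r 6 + .r 16)) (asg 15 (.r 15 + 1)) .skip)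

/-- Increases `a` until there are few patterns on the first `a` elements. -/
def searchProg : Prog :=
  asg 11 0 ;; asg 12 1 ;; asg 13 (.r 7) ;; asg 14 1 ;;
  whileDo (.r 14) (
    fillProg ;; asg 20 (.r 6) ;; transProg ;; countProg ;;
    Prog.cond ((.r 15 + 1) * .r 13 - 2 * .r 12)
      (asg 11 (.r 11 + 1) ;; asg 12 (2 * .r 12) ;; asg 13 (.r 13 / 2))
      (asg 14 0))

section

variable {n m k M a : ℕ} {row : ℕ → Finset ℕ} {S : Finset ℕ} {σ : Store}

theorem Fits.two_pow_le (hF : Fits n m k M) (ha : a ≤ n) :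
    2 ^ a ≤ 2 ^ n ∧ 3 + m * n + m + 4 * 2 ^ n ≤ M :=
  ⟨Nat.pow_le_pow_right (by norm_num) ha, hF.addr⟩

theorem Fits.total_le (hF : Fits n m k M) :
    (2 : ℤ) ^ n * ((2 ^ n + 2) ^ (n + 1) * ((m : ℤ) + 1) ^ m) ≤ M := by exact_mod_cast hF.val

theorem Fits.mul_pow_le (hF : Fits n m k M) (ha : a ≤ n) :
    (2 : ℤ) ^ a * ((m : ℤ) + 1) ^ m ≤ M := by
  refine le_trans ?_ hF.total_le
  have h1 : (1 : ℤ) ≤ (2 ^ n + 2) ^ (n + 1) := one_le_pow₀ (by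
    have : (0 : ℤ) < 2 ^ n := by positivity
    omega)
  have h2 : (2 : ℤ) ^ a ≤ 2 ^ n := pow_le_pow_right₀ (by norm_num) ha
  exact mul_le_mul h2 (le_mul_of_one_le_left (by positivity) h1) (by positivity) (by positivity)

theorem runs_fill (hF : Fits n m k M) (hE : Env n m k row S σ) (ha : a ≤ n)
    (h12 : σ.reg 12 = (2 ^ a : ℕ)) :
    Runs M fillProg σ (2 + 2 ^ a * (evalSteps n m k + 4)) fun σ' =>
      (∀ r < 15, σ'.reg r = σ.reg r) ∧
      (∀ c, c < 3 + m * n + m ∨ 3 + m * n + m + 2 ^ a ≤ c → σ'.mem c = σ.mem c) ∧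
      ∀ x < 2 ^ a, σ'.mem (3 + m * n + m + x) = tuples n m k row S (2 ^ a - 1 - x) := by
  obtain ⟨ha2, haddr⟩ := hF.two_pow_le ha
  have hM := hF.small
  set wb := 3 + m * n + m with hwb
  refine Runs.mono (Runs.forDo hM (fun x σ' => (∀ r < 15, σ'.reg r = σ.reg r) ∧
      (∀ c, c < wb ∨ wb + 2 ^ a ≤ c → σ'.mem c = σ.mem c) ∧
      (∀ y < x, σ'.mem (wb + y) = tuples n m k row S (2 ^ a - 1 - y)) ∧ σ'.reg 16 = x)
      (2 ^ a) (1 + (evalSteps n m k + 1)) (by omega) ?_ ?_ ?_ ?_) (by ring_nf; omega)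
      fun σ' h => h
  · refine ⟨fun r hr => ?_, by simp, by simp, by simp⟩
    simp [show r ≠ 16 by omega]
  · rintro x hx σ' ⟨h1, h2, h3, h4⟩
    exact ⟨h4, by simp [h1, h12]⟩
  · rintro x hx σ' ⟨h1, h2, h3, h4⟩
    have hE' : Env n m k row S (σ'.set 40 ((2 ^ a - 1 - x : ℕ) : ℤ)) :=
      hE.congr (fun r hr => by simp [show r ≠ 40 by omega, h1 r (by omega)])
        fun c hc => by simp [h2 c (by omega)]
    refine Runs.asg_seq hM ((2 ^ a - 1 - x : ℕ) : ℤ) ?_ (by rw [Nat.abs_cast]; omega)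
      (Runs.seq (runs_eval hF hE' (x := 2 ^ a - 1 - x) (by omega) (by simp)) fun σ₁ h₁ => ?_)
    · simp only [Ex.eval_sub, Ex.eval_r, Ex.eval_one, h1 12 (by decide), h12, h4]; omega
    · obtain ⟨g1, g2, g3, g4⟩ := h₁
      have g2' : ∀ r < 40, σ₁.reg r = σ'.reg r := fun r hr => by
        rw [g2 r (by omega)]; simp [show r ≠ 40 by omega]
      refine Runs.put' hM (wb + x) (tuples n m k row S (2 ^ a - 1 - x)) ?_ (by simp [g3])
        ((abs_tuples_le hF.card _).trans hF.pow_le) ?_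
      · simp only [Ex.eval_add, Ex.eval_r, g2' 6 (by decide), h1 6 (by decide), hE.reg6,
          g2' 16 (by decide), h4]
        push_cast [hwb]; ring
      · refine ⟨by simp [g2', h4], fun r hr => ?_, fun c hc => ?_, fun y hy => ?_, by simp⟩
        · simp [show r ≠ 16 by omega, g2' r (by omega), h1 r hr]
        · simp only [Store.set_mem, Store.put_mem, g1]
          rw [if_neg (by omega), h2 c hc]
        · simp only [Store.set_mem, Store.put_mem, g1]
          by_cases h : y = x
          · simp [h]
          · rw [if_neg (by omega), h3 y (by omega)]
  · rintro σ' ⟨h1, h2, h3, h4⟩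
    exact ⟨h1, h2, h3⟩

/-- The number of patterns on the first `a` elements. -/
def patterns (n m k : ℕ) (row : ℕ → Finset ℕ) (S : Finset ℕ) (a : ℕ) : ℕ :=
  #((range (2 ^ a)).filter fun y => 0 < pattern n m k row S a y)

theorem patterns_le : patterns n m k row S a ≤ 2 ^ a :=
  (card_filter_le _ _).trans (by simp)

theorem runs_count (hF : Fits n m k M) (hE : Env n m k row S σ) (ha : a ≤ n)
    (h12 : σ.reg 12 = (2 ^ a : ℕ))
    (hmem : ∀ x < 2 ^ a, σ.mem (3 + m * n + m + x) = pattern n m k row S a x) :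
    Runs M countProg σ (3 + 2 ^ a * 4) fun σ' =>
      (∀ r < 15, σ'.reg r = σ.reg r) ∧ σ'.mem = σ.mem ∧
      σ'.reg 15 = patterns n m k row S a := by
  obtain ⟨ha2, haddr⟩ := hF.two_pow_le ha
  have hM := hF.small
  set wb := 3 + m * n + m with hwb
  refine Runs.mono (Runs.asg_seq hM 0 rfl (by simp)
    (Runs.forDo hM (fun x σ' => (∀ r < 15, σ'.reg r = σ.reg r) ∧ σ'.mem = σ.mem ∧
      σ'.reg 15 = #((range x).filter fun y => 0 < pattern n m k row S a y) ∧ σ'.reg 16 = x)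
      (2 ^ a) (1 + 1) (by omega) ?_ ?_ ?_ ?_)) (by ring_nf; omega)
      fun σ' h => h
  · refine ⟨fun r hr => ?_, by simp, by simp, by simp⟩
    simp [show r ≠ 16 by omega, show r ≠ 15 by omega]
  · rintro x hx σ' ⟨h1, h2, h3, h4⟩
    exact ⟨h4, by simp [h1, h12]⟩
  · rintro x hx σ' ⟨h1, h2, h3, h4⟩
    have hguard : Ex.eval σ' (.ld (.r 6 + .r 16)) = pattern n m k row S a x := by
      simp only [Ex.eval_ld, Ex.eval_add, Ex.eval_r, h1 6 (by decide), hE.reg6, h4, h2]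
      rw [← hmem x hx]; congr 1
    have hcard := (card_filter_le (range (x + 1)) fun y => 0 < pattern n m k row S a y)
    rw [card_range] at hcard
    refine Runs.cond hM (fun h => ?_) (fun h => Runs.skip ?_)
    · rw [hguard] at h
      rw [range_add_one, filter_insert, if_pos h, card_insert_of_notMem (by simp)] at hcard
      refine Runs.asg' hM ((#((range (x + 1)).filter fun y => 0 < pattern n m k row S a y) : ℕ) : ℤ)
        ?_ ?_ ?_
      · rw [range_add_one, filter_insert, if_pos h, card_insert_of_notMem (by simp)]
        simp [h3]
      · rw [range_add_one, filter_insert, if_pos h, card_insert_of_notMem (by simp), Nat.abs_cast]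
        omega
      · refine ⟨by simp [h4], fun r hr => ?_, by simpa using h2, by simp, by simp⟩
        simp [show r ≠ 16 by omega, show r ≠ 15 by omega, h1 r hr]
    · rw [hguard] at h
      refine ⟨h4, fun r hr => ?_, by simpa using h2, ?_, by simp⟩
      · simp [show r ≠ 16 by omega, h1 r hr]
      · rw [range_add_one, filter_insert, if_neg (by omega)]
        simp [h3]
  · rintro σ' ⟨h1, h2, h3, h4⟩
    exact ⟨h1, h2, h3⟩

/-- There are few patterns on the first `a` elements, compared with the number of subsets of the
first `a` elements and of the remaining ones. -/
def Few (n m k : ℕ) (row : ℕ → Finset ℕ) (S : Finset ℕ) (a : ℕ) : Prop :=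
  (patterns n m k row S a + 1) * 2 ^ (n - a) ≤ 2 * 2 ^ a

def searchSteps (n m k a : ℕ) : ℕ := 2 ^ a * (evalSteps n m k + 8) + transSteps a + 20

/-- As `a` is the first length with `Few`, there are exactly `a + 1` iterations, the last of which
only lowers the flag in register `14` after its test. The second alternative of the loop invariant
describes the state after that iteration. -/
theorem runs_search (hF : Fits n m k M) (hE : Env n m k row S σ) (ha : a ≤ n)
    (hfew : Few n m k row S a) (hmin : ∀ x < a, ¬ Few n m k row S x) :
    Runs M searchProg σ (5 + ∑ x ∈ range (a + 1), searchSteps n m k x) fun σ' =>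
      (∀ r < 10, σ'.reg r = σ.reg r) ∧ (∀ c < 3 + m * n + m, σ'.mem c = σ.mem c) ∧
      σ'.reg 11 = a ∧ σ'.reg 12 = (2 ^ a : ℕ) ∧ σ'.reg 13 = (2 ^ (n - a) : ℕ) ∧
      ∀ x < 2 ^ a, σ'.mem (3 + m * n + m + x) = pattern n m k row S a x := by
  have hM := hF.small
  have haddr := hF.addr
  have hn2 : n < 2 ^ n := Nat.lt_two_pow_self
  have hsmall : ∀ z : ℕ, z ≤ 2 * 2 ^ n → |(z : ℤ)| ≤ M := fun z hz => by
    rw [Nat.abs_cast]; omega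
  set wb := 3 + m * n + m with hwb
  set Goal : Store → Prop := fun σ' =>
      (∀ r < 10, σ'.reg r = σ.reg r) ∧ (∀ c < wb, σ'.mem c = σ.mem c) ∧
      σ'.reg 11 = a ∧ σ'.reg 12 = (2 ^ a : ℕ) ∧ σ'.reg 13 = (2 ^ (n - a) : ℕ) ∧
      ∀ x < 2 ^ a, σ'.mem (wb + x) = pattern n m k row S a x with hGoal
  refine Runs.mono (Runs.asg_seq hM 0 rfl (by simp) (Runs.asg_seq hM 1 rfl
    (hsmall 1 (by omega)) (Runs.asg_seq hM ((2 ^ n : ℕ) : ℤ) (by simp [hE.reg7])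
    (hsmall _ (by omega)) (Runs.asg_seq hM 1 rfl (hsmall 1 (by omega))
    (Runs.whileDo hM (fun x σ' => (x ≤ a ∧ (∀ r < 10, σ'.reg r = σ.reg r) ∧
      (∀ c < wb, σ'.mem c = σ.mem c) ∧ σ'.reg 11 = x ∧ σ'.reg 12 = (2 ^ x : ℕ) ∧
      σ'.reg 13 = (2 ^ (n - x) : ℕ) ∧ σ'.reg 14 = 1) ∨ (x = a + 1 ∧ σ'.reg 14 = 0 ∧ Goal σ'))
      (a + 1) (fun x => (2 + 2 ^ x * (evalSteps n m k + 4)) + (1 + (transSteps x +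
        ((3 + 2 ^ x * 4) + (1 + (1 + (1 + 1))))))) ?_ ?_ ?_))))) ?_ fun σ' h => h
  · refine Or.inl ⟨by omega, fun r hr => ?_, by simp, by simp, by simp, by simp, by simp⟩
    simp [show r ≠ 11 by omega, show r ≠ 12 by omega, show r ≠ 13 by omega,
      show r ≠ 14 by omega]
  · rintro x hx σ' (⟨hxa, h1, h2, h3, h4, h5, h6⟩ | ⟨h, -⟩)
    swap
    · omega
    refine ⟨by simp [h6], ?_⟩
    have hE' : Env n m k row S σ' := hE.congr h1 h2
    have hxn : x ≤ n := by omega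
    obtain ⟨hx2, -⟩ := hF.two_pow_le hxn
    refine Runs.seq (runs_fill hF hE' hxn h4) fun σ₁ ⟨f1, f2, f3⟩ => ?_
    have hE₁ : Env n m k row S σ₁ :=
      hE'.congr (fun r hr => f1 r (by omega)) fun c hc => f2 c (Or.inl hc)
    refine Runs.asg_seq hM (wb : ℤ) (by simp [hE₁.reg6, hwb]) (by rw [Nat.abs_cast]; omega)
      (Runs.seq (runs_trans hM (a := x) (B := wb) (F := ((m : ℤ) + 1) ^ m) (by simp)
      (by simp [f1, h3]) (by simp [f1, h4]) (by omega) (fun y hy => ?_) (hF.mul_pow_le hxn))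
      fun σ₂ ⟨g1, g2, g3⟩ => ?_)
    · simp only [Store.set_mem, hwb, f3 y hy]
      exact abs_tuples_le hF.card _
    have g1' : ∀ r < 15, σ₂.reg r = σ'.reg r := fun r hr => by
      rw [g1 r (by omega)]; simp [show r ≠ 20 by omega, f1 r hr]
    have g2' : ∀ c < wb, σ₂.mem c = σ.mem c := fun c hc => by
      rw [g2 c (Or.inl hc), Store.set_mem, f2 c (Or.inl hc), h2 c hc]
    have hE₂ : Env n m k row S σ₂ :=
      hE.congr (fun r hr => by rw [g1' r (by omega), h1 r hr]) g2'
    have hpat : ∀ y < 2 ^ x, σ₂.mem (wb + y) = pattern n m k row S x y := fun y hy => by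
      rw [g3 y hy, pattern]
      exact mob_congr _ _ fun z hz => f3 z (by omega)
    refine Runs.seq (runs_count hF hE₂ hxn (by rw [g1' 12 (by decide), h4]) hpat)
      fun σ₃ ⟨c1, c2, c3⟩ => ?_
    have c1' : ∀ r < 15, σ₃.reg r = σ'.reg r := fun r hr => by rw [c1 r hr, g1' r hr]
    have hguard : Ex.eval σ₃ ((.r 15 + 1) * .r 13 - 2 * .r 12) =
        (((patterns n m k row S x + 1) * 2 ^ (n - x) : ℕ) : ℤ) - ((2 * 2 ^ x : ℕ) : ℤ) := by
      simp [c3, c1', h4, h5]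
    refine Runs.cond hM (fun hg => ?_) fun hg => Runs.mono (Runs.asg' hM 0 rfl (by simp) ?_)
      (show 1 ≤ 1 + (1 + 1) by norm_num) fun σ' h => h
    · rw [hguard] at hg
      have hnf : ¬ Few n m k row S x := by unfold Few; omega
      have hxa' : x < a := lt_of_le_of_ne hxa (by rintro rfl; exact hnf hfew)
      have hx3 : 2 ^ (x + 1) ≤ 2 ^ n := (hF.two_pow_le (by omega)).1
      have hx4 : 2 ^ (n - (x + 1)) ≤ 2 ^ n := (hF.two_pow_le (by omega)).1
      refine Runs.asg_seq hM ((x + 1 : ℕ) : ℤ) (by simp [c1', h3]) (hsmall _ (by omega))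
        (Runs.asg_seq hM ((2 ^ (x + 1) : ℕ) : ℤ) ?_ (hsmall _ (by omega))
        (Runs.asg' hM ((2 ^ (n - (x + 1)) : ℕ) : ℤ) ?_ (hsmall _ (by omega)) ?_))
      · simp [c1', h4, pow_succ, mul_comm]
      · rw [show (2 ^ (n - (x + 1)) : ℕ) = 2 ^ (n - x) / 2 by
          rw [show n - x = (n - (x + 1)) + 1 by omega, pow_succ]; omega]
        simp [c1', h5]
      · refine Or.inl ⟨by omega, fun r hr => ?_, fun c hc => ?_, by simp, by simp, by simp,
          by simp [c1', h6]⟩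
        · simp [show r ≠ 11 by omega, show r ≠ 12 by omega, show r ≠ 13 by omega,
            c1' r (by omega), h1 r hr]
        · simp only [Store.set_mem, c2, g2' c hc]
    · rw [hguard] at hg
      have hf : Few n m k row S x := by unfold Few; omega
      obtain rfl : x = a := by
        by_contra hne
        exact hmin x (by omega) hf
      refine Or.inr ⟨rfl, by simp, fun r hr => ?_, fun c hc => ?_, by simp [c1', h3],
        by simp [c1', h4], by simp [c1', h5], fun y hy => ?_⟩
      · simp [show r ≠ 14 by omega, c1' r (by omega), h1 r hr]
      · simp only [Store.set_mem, c2, g2' c hc]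
      · simp only [Store.set_mem, c2, hpat y hy]
  · rintro σ' (⟨h, -⟩ | ⟨-, h1, h2⟩)
    · omega
    · exact ⟨by simp [h1], h2⟩
  · have : ∑ x ∈ range (a + 1), ((2 + 2 ^ x * (evalSteps n m k + 4)) + (1 + (transSteps x +
        ((3 + 2 ^ x * 4) + (1 + (1 + (1 + 1)))))) + 1) ≤ ∑ x ∈ range (a + 1), searchSteps n m k x := by
      refine sum_le_sum fun x _ => ?_
      simp only [searchSteps]
      ring_nf; omega
    omega

end

end SubsetTransform

/-! ### Computing the coefficients and evaluating the shortened sum -/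

namespace SubsetTransform

open Finset RAM RAM.Prog

def zeroProg : Prog := forDo 16 (.r 12) (put (.r 6 + .r 7 + .r 16) 0)

def copyProg : Prog :=
  forDo 16 (.r 12) (put (.r 6 + 2 * .r 7 + .r 16) (.ld (.r 6 + .r 7 + .r 16)))

/-- `1 / (x + 1)` is the delta function at `0`. Membership of `x` in the support is read from the
pattern array at the complement of `x`. -/
def updateProg : Prog :=
  forDo 16 (.r 12) (Prog.cond (.ld (.r 6 + (.r 12 - 1 - .r 16)))
    (put (.r 6 + .r 7 + .r 16)
      (.ld (.r 6 + .r 7 + .r 16) + 1 / (.r 16 + 1) - .ld (.r 6 + 2 * .r 7 + .r 16))) .skip)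

/-- Computes the coefficients of the functional that extracts the covering subfamilies. -/
def corrProg : Prog :=
  zeroProg ;;
  forDo 17 (.r 11 + 1) (copyProg ;; asg 20 (.r 6 + 2 * .r 7) ;; transProg ;; updateProg)

/-- Applies the functional. -/
def sumProg : Prog :=
  asg 10 0 ;;
  forDo 16 (.r 12) (
    asg 19 (.ld (.r 6 + .r 7 + .r 16)) ;;
    Prog.cond (.r 19 * .r 19)
      (forDo 18 (.r 13) (
        asg 40 (.r 16 + .r 12 * .r 18) ;; evalProg ;;
        asg 10 (.r 10 + .r 19 * (.r 41 * .r 42))))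
      .skip)

/-- Register `10` becomes positive if and only if there is a solution. -/
def decideProg : Prog := searchProg ;; corrProg ;; sumProg

section

variable {n m k M a : ℕ} {row : ℕ → Finset ℕ} {S : Finset ℕ} {σ : Store}

theorem abs_corr_le_pow (p : ℕ → Prop) [DecidablePred p] (ha : a ≤ n) {r x : ℕ} (hr : r ≤ a + 1)
    (hx : x < 2 ^ a) : |corr a p r x| ≤ (2 ^ n + 2) ^ (n + 1) := by
  refine (abs_corr_le p r x hx).trans ?_
  have h0 : (0 : ℤ) < 2 ^ n := by positivity
  have h : (2 : ℤ) ^ a ≤ 2 ^ n := pow_le_pow_right₀ (by norm_num) ha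
  calc ((2 : ℤ) ^ a + 2) ^ r ≤ (2 ^ n + 2) ^ r := by gcongr
    _ ≤ _ := pow_le_pow_right₀ (by omega) (by omega)

theorem Fits.corr_le (hF : Fits n m k M) : (2 : ℤ) ^ n * (2 ^ n + 2) ^ (n + 1) ≤ M := by
  refine le_trans ?_ hF.total_le
  have h1 : (1 : ℤ) ≤ ((m : ℤ) + 1) ^ m := one_le_pow₀ (by omega)
  exact mul_le_mul_of_nonneg_left (le_mul_of_one_le_right (by positivity) h1) (by positivity)

def corrSteps (a : ℕ) : ℕ := 4 + 2 ^ a * 3 + (a + 1) * (10 + 2 ^ a * 8 + transSteps a)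

/-- The transform destroys its argument, so every round transforms a copy of the iterate in the
third array; the first array keeps the patterns and the second the iterate. -/
theorem runs_corr (hF : Fits n m k M) (hE : Env n m k row S σ) (ha : a ≤ n)
    (h11 : σ.reg 11 = a) (h12 : σ.reg 12 = (2 ^ a : ℕ))
    (hmem : ∀ x < 2 ^ a, σ.mem (3 + m * n + m + x) = pattern n m k row S a x) :
    Runs M corrProg σ (corrSteps a) fun σ' =>
      (∀ r < 15, σ'.reg r = σ.reg r) ∧ (∀ c < 3 + m * n + m, σ'.mem c = σ.mem c) ∧
      ∀ x < 2 ^ a, σ'.mem (3 + m * n + m + 2 ^ n + x) =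
        corr a (fun x => 0 < pattern n m k row S a (2 ^ a - 1 - x)) (a + 1) x := by
  obtain ⟨ha2, haddr⟩ := hF.two_pow_le ha
  have hM := hF.small
  have hn2 : n < 2 ^ n := Nat.lt_two_pow_self
  set wb := 3 + m * n + m with hwb
  set N := 2 ^ n with hN
  set c := corr a (fun x => 0 < pattern n m k row S a (2 ^ a - 1 - x)) with hc
  have hcle : ∀ r ≤ a + 1, ∀ x < 2 ^ a, |c r x| ≤ (2 ^ n + 2) ^ (n + 1) := fun r hr x hx =>
    abs_corr_le_pow _ ha hr hx
  have hcM : ∀ r ≤ a + 1, ∀ x < 2 ^ a, |c r x| ≤ M := fun r hr x hx =>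
    (hcle r hr x hx).trans (le_trans (le_mul_of_one_le_left (by positivity)
      (one_le_pow₀ (by norm_num))) hF.corr_le)
  have hr6 : σ.reg 6 = (wb : ℤ) := hE.reg6
  have hr7 : σ.reg 7 = (N : ℤ) := hE.reg7
  refine Runs.mono (Runs.seq (Q' := fun σ' => (∀ r < 15, σ'.reg r = σ.reg r) ∧
      (∀ d, d < wb + N → σ'.mem d = σ.mem d) ∧ ∀ x < 2 ^ a, σ'.mem (wb + N + x) = c 0 x)
    (Runs.forDo hM (fun x σ' => (∀ r < 15, σ'.reg r = σ.reg r) ∧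
      (∀ d, d < wb + N → σ'.mem d = σ.mem d) ∧ (∀ y < x, σ'.mem (wb + N + y) = 0) ∧
      σ'.reg 16 = x) (2 ^ a) 1 (by omega) ?_ ?_ ?_ ?_)
    fun σ₁ ⟨f1, f2, f3⟩ =>
    Runs.forDo hM (fun r σ' => (∀ r < 15, σ'.reg r = σ.reg r) ∧
      (∀ d, d < wb + N → σ'.mem d = σ.mem d) ∧ (∀ x < 2 ^ a, σ'.mem (wb + N + x) = c r x) ∧
      σ'.reg 17 = r) (a + 1)
      ((2 + 2 ^ a * 3) + (1 + (transSteps a + (2 + 2 ^ a * (1 + 1 + 2))))) (by omega)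
      ?_ ?_ ?_ ?_) (by simp only [corrSteps]; ring_nf; omega) fun σ' h => h
  · refine ⟨fun r hr => ?_, by simp, by simp, by simp⟩
    simp [show r ≠ 16 by omega]
  · rintro x hx σ' ⟨h1, h2, h3, h4⟩
    exact ⟨h4, by simp [h1, h12]⟩
  · rintro x hx σ' ⟨h1, h2, h3, h4⟩
    refine Runs.put' hM (wb + N + x) 0 ?_ rfl (by simp) ?_
    · simp [h1, hr6, hr7, h4]
    · refine ⟨by simp [h4], fun r hr => ?_, fun d hd => ?_, fun y hy => ?_, by simp⟩
      · simp [show r ≠ 16 by omega, h1 r hr]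
      · simp only [Store.set_mem, Store.put_mem]
        rw [if_neg (by omega), h2 d hd]
      · simp only [Store.set_mem, Store.put_mem]
        by_cases h : y = x
        · simp [h]
        · rw [if_neg (by omega), h3 y (by omega)]
  · rintro σ' ⟨h1, h2, h3, h4⟩
    exact ⟨h1, h2, fun x hx => by rw [h3 x hx, hc, corr]⟩
  · refine ⟨fun r hr => ?_, by simpa using f2, by simpa using f3, by simp⟩
    simp [show r ≠ 17 by omega, f1 r hr]
  · rintro x hx σ' ⟨h1, h2, h3, h4⟩
    exact ⟨h4, by simp [h1, h11]⟩
  · rintro r hr σ' ⟨h1, h2, h3, h4⟩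
    refine Runs.seq (Q' := fun σ' => (∀ r < 15, σ'.reg r = σ.reg r) ∧
      (∀ d, d < wb + N → σ'.mem d = σ.mem d) ∧ (∀ x < 2 ^ a, σ'.mem (wb + N + x) = c r x) ∧
      (∀ x < 2 ^ a, σ'.mem (wb + 2 * N + x) = c r x) ∧ σ'.reg 17 = r)
      (Runs.forDo hM (fun x σ' => (∀ r < 15, σ'.reg r = σ.reg r) ∧
      (∀ d, d < wb + N → σ'.mem d = σ.mem d) ∧ (∀ x < 2 ^ a, σ'.mem (wb + N + x) = c r x) ∧
      (∀ y < x, σ'.mem (wb + 2 * N + y) = c r y) ∧ σ'.reg 17 = r ∧ σ'.reg 16 = x)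
      (2 ^ a) 1 (by omega) ?_ ?_ ?_ ?_)
      fun σ₂ ⟨g1, g2, g3, g4, g5⟩ => Runs.asg_seq hM ((wb + 2 * N : ℕ) : ℤ)
        (by simp [g1, hr6, hr7]) (by rw [Nat.abs_cast]; omega)
        (Runs.seq (runs_trans hM (a := a) (B := wb + 2 * N) (F := (2 ^ n + 2) ^ (n + 1))
          (by simp) (by simp [g1, h11]) (by simp [g1, h12]) (by omega) (fun x hx => ?_) ?_)
        fun σ₃ ⟨t1, t2, t3⟩ => ?_)
    · refine ⟨fun r hr => ?_, by simpa using h2, by simpa using h3, by simp, by simp [h4], by simp⟩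
      simp [show r ≠ 16 by omega, h1 r hr]
    · rintro x hx σ' ⟨e1, e2, e3, e4, e5, e6⟩
      exact ⟨e6, by simp [e1, h12]⟩
    · rintro x hx σ' ⟨e1, e2, e3, e4, e5, e6⟩
      refine Runs.put' hM (wb + 2 * N + x) (c r x) ?_ ?_ (hcM r (by omega) x hx) ?_
      · simp [e1, hr6, hr7, e6]
      · simp only [Ex.eval_ld, Ex.eval_add, Ex.eval_r, e1 6 (by decide), e1 7 (by decide), hr6, hr7,
          e6]
        rw [← e3 x hx]; congr 1
      · refine ⟨by simp [e6], fun r hr => ?_, fun d hd => ?_, fun y hy => ?_, fun y hy => ?_,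
          by simp [e5], by simp⟩
        · simp [show r ≠ 16 by omega, e1 r hr]
        · simp only [Store.set_mem, Store.put_mem]
          rw [if_neg (by omega), e2 d hd]
        · simp only [Store.set_mem, Store.put_mem]
          rw [if_neg (by omega), e3 y hy]
        · simp only [Store.set_mem, Store.put_mem]
          by_cases h : y = x
          · simp [h]
          · rw [if_neg (by omega), e4 y (by omega)]
    · rintro σ' ⟨e1, e2, e3, e4, e5, e6⟩
      exact ⟨e1, e2, e3, e4, e5⟩
    · simp only [Store.set_mem, g4 x hx]
      exact hcle r (by omega) x hx
    · exact (mul_le_mul_of_nonneg_right (pow_le_pow_right₀ (by norm_num) ha)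
        (by positivity)).trans hF.corr_le
    have t1' : ∀ q < 15, σ₃.reg q = σ.reg q := fun q hq => by
      rw [t1 q (by omega)]; simp [show q ≠ 20 by omega, g1 q hq]
    have t2' : ∀ d, d < wb + N → σ₃.mem d = σ.mem d := fun d hd => by
      rw [t2 d (by omega), Store.set_mem, g2 d hd]
    have t3' : ∀ x < 2 ^ a, σ₃.mem (wb + N + x) = c r x := fun x hx => by
      rw [t2 _ (by omega), Store.set_mem, g3 x hx]
    have t4' : ∀ x < 2 ^ a, σ₃.mem (wb + 2 * N + x) = mob a (c r) x := fun x hx => by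
      rw [t3 x hx]
      exact mob_congr _ _ fun y hy => g4 y (by omega)
    have t5' : σ₃.reg 17 = r := by rw [t1 17 (by decide)]; simp [g5]
    refine Runs.forDo hM (fun x σ' => (∀ r < 15, σ'.reg r = σ.reg r) ∧
      (∀ d, d < wb + N → σ'.mem d = σ.mem d) ∧
      (∀ y < 2 ^ a, σ'.mem (wb + N + y) = if y < x then c (r + 1) y else c r y) ∧
      (∀ x < 2 ^ a, σ'.mem (wb + 2 * N + x) = mob a (c r) x) ∧ σ'.reg 17 = r ∧ σ'.reg 16 = x)
      (2 ^ a) (1 + 1) (by omega) ?_ ?_ ?_ ?_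
    · refine ⟨fun r hr => ?_, by simpa using t2', by simpa using t3', by simpa using t4',
        by simp [t5'], by simp⟩
      simp [show r ≠ 16 by omega, t1' r hr]
    · rintro x hx σ' ⟨e1, e2, e3, e4, e5, e6⟩
      exact ⟨e6, by simp [e1, h12]⟩
    · rintro x hx σ' ⟨e1, e2, e3, e4, e5, e6⟩
      have hguard : Ex.eval σ' (.ld (.r 6 + (.r 12 - 1 - .r 16))) =
          pattern n m k row S a (2 ^ a - 1 - x) := by
        simp only [Ex.eval_ld, Ex.eval_add, Ex.eval_sub, Ex.eval_one, Ex.eval_r, e1 6 (by decide),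
          e1 12 (by decide), hr6, h12, e6]
        rw [← hmem _ (by omega), ← e2 _ (by omega)]; congr 1; omega
      have hex := e3 x hx
      rw [if_neg (lt_irrefl _)] at hex
      refine Runs.cond hM (fun h => ?_) (fun h => Runs.skip ?_)
      · rw [hguard] at h
        refine Runs.put' hM (wb + N + x) (c (r + 1) x) ?_ ?_ (hcM (r + 1) (by omega) x hx) ?_
        · simp [e1, hr6, hr7, e6]
        · have h1d : (1 : ℤ) / (x + 1) = if x = 0 then 1 else 0 := by
            split_ifs with h0
            · simp [h0]
            · exact Int.ediv_eq_zero_of_lt (by norm_num) (by omega)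
          rw [hc, corr, if_pos h, ← hc, ← hex, ← e4 x hx]
          simp only [Ex.eval_ld, Ex.eval_add, Ex.eval_sub, Ex.eval_mul, Ex.eval_div, Ex.eval_one,
            Ex.eval_two, Ex.eval_r, e1 6 (by decide), e1 7 (by decide), hr6, hr7, e6, h1d]
          congr 2
        · refine ⟨by simp [e6], fun r hr => ?_, fun d hd => ?_, fun y hy => ?_, fun y hy => ?_,
            by simp [e5], by simp⟩
          · simp [show r ≠ 16 by omega, e1 r hr]
          · simp only [Store.set_mem, Store.put_mem]
            rw [if_neg (by omega), e2 d hd]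
          · simp only [Store.set_mem, Store.put_mem, e3 y hy]
            rcases lt_trichotomy y x with h' | h' | h'
            · rw [if_neg (by omega), if_pos h', if_pos (by omega)]
            · rw [if_pos (by omega), if_pos (by omega), h']
            · rw [if_neg (by omega), if_neg (by omega), if_neg (by omega)]
          · simp only [Store.set_mem, Store.put_mem]
            rw [if_neg (by omega), e4 y hy]
      · rw [hguard] at h
        have hv : c (r + 1) x = c r x := by rw [hc, corr, if_neg (by omega)]
        refine ⟨e6, fun r hr => ?_, by simpa using e2, fun y hy => ?_, by simpa using e4,
          by simp [e5], by simp⟩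
        · simp [show r ≠ 16 by omega, e1 r hr]
        · simp only [Store.set_mem, e3 y hy]
          rcases lt_trichotomy y x with h' | h' | h'
          · rw [if_pos h', if_pos (by omega)]
          · rw [if_neg (by omega), if_pos (by omega), h', hv]
          · rw [if_neg (by omega), if_neg (by omega)]
    · rintro σ' ⟨e1, e2, e3, e4, e5, e6⟩
      refine ⟨e5, fun r hr => ?_, by simpa using e2, fun y hy => ?_, by simp⟩
      · simp [show r ≠ 17 by omega, e1 r hr]
      · rw [Store.set_mem, e3 y hy, if_pos hy]
  · rintro σ' ⟨h1, h2, h3, h4⟩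
    exact ⟨h1, fun d hd => h2 d (by omega), h3⟩

def sumSteps (n m k a q : ℕ) : ℕ := 3 + 6 * 2 ^ a + q * 2 ^ (n - a) * (evalSteps n m k + 4) + 2 * q

/-- The inner loop is entered only for nonzero coefficients. A zero coefficient costs a bounded
number of steps, so the number of evaluations is governed by the size of the support `p`. -/
theorem runs_sum (hF : Fits n m k M) (hE : Env n m k row S σ) (ha : a ≤ n)
    (h12 : σ.reg 12 = (2 ^ a : ℕ)) (h13 : σ.reg 13 = (2 ^ (n - a) : ℕ)) {c : ℕ → ℤ}
    (hc : ∀ x < 2 ^ a, |c x| ≤ (2 ^ n + 2) ^ (n + 1)) (p : ℕ → Prop) [DecidablePred p]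
    (hp : ∀ x, c x ≠ 0 → p x)
    (hmem : ∀ x < 2 ^ a, σ.mem (3 + m * n + m + 2 ^ n + x) = c x) :
    Runs M sumProg σ (sumSteps n m k a #((range (2 ^ a)).filter p)) fun σ' =>
      (∀ r < 10, σ'.reg r = σ.reg r) ∧ σ'.mem = σ.mem ∧
      σ'.reg 10 = ∑ x ∈ range (2 ^ a), ∑ w ∈ range (2 ^ (n - a)),
        c x * (tuples n m k row S (x + 2 ^ a * w) * sgn n (x + 2 ^ a * w)) := by
  obtain ⟨ha2, haddr⟩ := hF.two_pow_le ha
  have hM := hF.small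
  set wb := 3 + m * n + m with hwb
  set N := 2 ^ n with hN
  set b := n - a with hb
  have hb2 : 2 ^ b ≤ 2 ^ n := (hF.two_pow_le (show b ≤ n by omega)).1
  have hab : 2 ^ a * 2 ^ b = 2 ^ n := by rw [← pow_add]; congr 1; omega
  set T : ℕ → ℕ → ℤ := fun x w =>
    c x * (tuples n m k row S (x + 2 ^ a * w) * sgn n (x + 2 ^ a * w)) with hT
  set V : ℤ := (2 ^ n + 2) ^ (n + 1) * ((m : ℤ) + 1) ^ m with hV
  have hV0 : 0 ≤ V := by positivity
  have hTV : ∀ x < 2 ^ a, ∀ w, |T x w| ≤ V := fun x hx w => by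
    rw [hT, hV, abs_mul, abs_mul, abs_sgn, mul_one]
    exact mul_le_mul (hc x hx) (abs_tuples_le hF.card _) (abs_nonneg _) (by positivity)
  -- Every partial sum passes through register `10` and must respect the bound `M`; it has at most
  -- `2 ^ n` terms of size at most `V`.
  have hpart : ∀ x < 2 ^ a, ∀ w ≤ 2 ^ b,
      |∑ y ∈ range x, ∑ w ∈ range (2 ^ b), T y w + ∑ v ∈ range w, T x v| ≤ M := by
    intro x hx w hw
    have h1 : ∀ y < 2 ^ a, ∀ w, |∑ v ∈ range w, T y v| ≤ w * V := fun y hy w => by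
      refine (abs_sum_le_sum_abs _ _).trans ((sum_le_sum fun v _ => hTV y hy v).trans ?_)
      simp
    have h2 : |∑ y ∈ range x, ∑ w ∈ range (2 ^ b), T y w| ≤ x * (((2 ^ b : ℕ) : ℤ) * V) := by
      refine (abs_sum_le_sum_abs _ _).trans ((sum_le_sum fun y hy =>
        h1 y ((mem_range.1 hy).trans hx) (2 ^ b)).trans ?_)
      simp
    calc _ ≤ x * (((2 ^ b : ℕ) : ℤ) * V) + w * V := (abs_add_le _ _).trans (add_le_add h2 (h1 x hx w))
      _ = ((x * 2 ^ b + w : ℕ) : ℤ) * V := by push_cast; ring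
      _ ≤ ((2 ^ n : ℕ) : ℤ) * V := by
        refine mul_le_mul_of_nonneg_right ?_ hV0
        have : (x + 1) * 2 ^ b ≤ 2 ^ a * 2 ^ b := Nat.mul_le_mul_right _ hx
        rw [add_mul, hab] at this
        exact_mod_cast (show x * 2 ^ b + w ≤ 2 ^ n by omega)
      _ ≤ M := by push_cast; exact hF.total_le
  have hcM : ∀ x < 2 ^ a, |c x| ≤ M := fun x hx =>
    (hc x hx).trans (le_trans (le_mul_of_one_le_left (by positivity)
      (one_le_pow₀ (by norm_num))) hF.corr_le)
  have hr6 : σ.reg 6 = (wb : ℤ) := hE.reg6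
  have hr7 : σ.reg 7 = (N : ℤ) := hE.reg7
  have hlt : ∀ x < 2 ^ a, ∀ w < 2 ^ b, x + 2 ^ a * w < 2 ^ n := fun x hx w hw => by
    have : 2 ^ a * (w + 1) ≤ 2 ^ a * 2 ^ b := Nat.mul_le_mul_left _ hw
    rw [mul_add, hab] at this; omega
  refine Runs.mono (Runs.asg_seq hM 0 rfl (by simp)
    (Runs.forDo_sum hM (fun x σ' => (∀ r < 15, r ≠ 10 → σ'.reg r = σ.reg r) ∧ σ'.mem = σ.mem ∧
      σ'.reg 10 = ∑ y ∈ range x, ∑ w ∈ range (2 ^ b), T y w ∧ σ'.reg 16 = x) (2 ^ a)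
      (fun x => 1 + (1 + if p x then 2 + 2 ^ b * ((1 + (evalSteps n m k + 1)) + 2) else 1))
      (by omega) ?_ ?_ ?_ ?_)) ?_ fun σ' h => h
  · refine ⟨fun r hr hr' => ?_, by simp, by simp, by simp⟩
    simp [show r ≠ 16 by omega, hr']
  · rintro x hx σ' ⟨h1, h2, h3, h4⟩
    exact ⟨h4, by simp [h1, h12]⟩
  · rintro x hx σ' ⟨h1, h2, h3, h4⟩
    refine Runs.asg_seq hM (c x) ?_ (hcM x hx)
      (Runs.cond hM (fun h => ?_) fun h => Runs.mono (Runs.skip ?_) ?_ fun σ' h => h)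
    · simp only [Ex.eval_ld, Ex.eval_add, Ex.eval_r, h1 6 (by decide) (by decide),
        h1 7 (by decide) (by decide), hr6, hr7, h4, h2]
      rw [← hmem x hx]; congr 1
    · have hpx : p x := hp x fun h0 => by simp [h0] at h
      rw [if_pos hpx]
      refine Runs.forDo hM (fun w σ' => (∀ r < 15, r ≠ 10 → σ'.reg r = σ.reg r) ∧
        σ'.mem = σ.mem ∧ σ'.reg 19 = c x ∧ σ'.reg 16 = x ∧ σ'.reg 18 = w ∧
        σ'.reg 10 = ∑ y ∈ range x, ∑ w ∈ range (2 ^ b), T y w + ∑ v ∈ range w, T x v)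
        (2 ^ b) (1 + (evalSteps n m k + 1)) (by omega) ?_ ?_ ?_ ?_
      · refine ⟨fun r hr hr' => ?_, by simpa using h2, by simp, by simp [h4], by simp, by simp [h3]⟩
        simp [show r ≠ 18 by omega, show r ≠ 19 by omega, h1 r hr hr']
      · rintro w hw σ₁ ⟨g1, g2, g3, g4, g5, g6⟩
        exact ⟨g5, by simp [g1, h13]⟩
      · rintro w hw σ₁ ⟨g1, g2, g3, g4, g5, g6⟩
        have hxw := hlt x hx w hw
        have hE₁ : Env n m k row S (σ₁.set 40 ((x + 2 ^ a * w : ℕ) : ℤ)) :=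
          hE.congr (fun r hr => by simp [show r ≠ 40 by omega, g1 r (by omega) (by omega)])
            fun d _ => by simp [g2]
        refine Runs.asg_seq hM ((x + 2 ^ a * w : ℕ) : ℤ) ?_ (by rw [Nat.abs_cast]; omega)
          (Runs.seq (runs_eval hF hE₁ hxw (by simp)) fun σ₂ ⟨e1, e2, e3, e4⟩ => ?_)
        · simp [g1, g4, g5, h12]
        have e2' : ∀ r < 40, σ₂.reg r = σ₁.reg r := fun r hr => by
          rw [e2 r (by omega)]; simp [show r ≠ 40 by omega]
        refine Runs.asg' hM
          (∑ y ∈ range x, ∑ w ∈ range (2 ^ b), T y w + ∑ v ∈ range (w + 1), T x v) ?_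
          (hpart x hx _ hw) ?_
        · rw [sum_range_succ]
          simp only [Ex.eval_add, Ex.eval_mul, Ex.eval_r, e2' 10 (by decide), e2' 19 (by decide),
            g3, g6, e3, e4, hT]
          ring
        · refine ⟨by simp [e2', g5], fun r hr hr' => ?_, by simp [e1, g2], by simp [e2', g3],
            by simp [e2', g4], by simp, by simp⟩
          simp [show r ≠ 18 by omega, hr', e2' r (by omega), g1 r hr hr']
      · rintro σ₁ ⟨g1, g2, g3, g4, g5, g6⟩
        refine ⟨g4, fun r hr hr' => ?_, by simp [g2], ?_, by simp⟩
        · simp [show r ≠ 16 by omega, g1 r hr hr']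
        · rw [sum_range_succ, ← g6]; simp
    · have h0 : c x = 0 := by
        by_contra hne
        have : 0 < c x * c x := mul_self_pos.2 hne
        simp at h
        omega
      refine ⟨by simp [h4], fun r hr hr' => ?_, by simp [h2], ?_, by simp⟩
      · simp [show r ≠ 16 by omega, show r ≠ 19 by omega, h1 r hr hr']
      · rw [sum_range_succ, sum_eq_zero (s := range (2 ^ b)) fun w _ => by rw [hT]; simp [h0]]
        simp [h3]
    · split_ifs <;> omega
  · rintro σ' ⟨h1, h2, h3, h4⟩
    exact ⟨fun r hr => h1 r (by omega) (by omega), h2, h3⟩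
  · have : ∀ x ∈ range (2 ^ a),
        (1 + (1 + if p x then 2 + 2 ^ b * ((1 + (evalSteps n m k + 1)) + 2) else 1)) + 2 ≤
        6 + if p x then 2 + 2 ^ b * (evalSteps n m k + 4) else 0 := fun x _ => by
      split_ifs
      · ring_nf; omega
      · omega
    have hs := sum_le_sum this
    rw [sum_add_distrib (f := fun _ => 6), ← sum_filter, sum_const, sum_const, card_range,
      smul_eq_mul, smul_eq_mul] at hs
    refine le_trans (Nat.add_le_add_left (Nat.add_le_add_left hs _) _) ?_
    simp only [sumSteps, ← hb]
    ring_nf; omega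

def decideSteps (n m k a q : ℕ) : ℕ :=
  5 + ∑ x ∈ range (a + 1), searchSteps n m k x + (corrSteps a + sumSteps n m k a q)

theorem runs_decide (hF : Fits n m k M) (hS : S ⊆ range m) (hE : Env n m k row S σ) (ha : a ≤ n)
    (hfew : Few n m k row S a) (hmin : ∀ x < a, ¬ Few n m k row S x) :
    Runs M decideProg σ (decideSteps n m k a (patterns n m k row S a)) fun σ' =>
      (∀ r < 10, σ'.reg r = σ.reg r) ∧ (∀ c < 3 + m * n + m, σ'.mem c = σ.mem c) ∧
      (0 < σ'.reg 10 ↔ Feasible n k row S) := by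
  refine Runs.mono (Runs.seq (runs_search hF hE ha hfew hmin) fun σ₁ ⟨h1, h2, h3, h4, h5, h6⟩ =>
    Runs.seq (runs_corr hF (hE.congr h1 h2) ha h3 h4 h6) fun σ₂ ⟨g1, g2, g3⟩ =>
    Runs.mono (runs_sum hF (hE.congr (fun r hr => by rw [g1 r (by omega), h1 r hr])
      fun c hc => by rw [g2 c hc, h2 c hc]) ha (by rw [g1 12 (by decide), h4])
      (by rw [g1 13 (by decide), h5]) (fun x hx => abs_corr_le_pow _ ha le_rfl hx)
      (fun x => 0 < pattern n m k row S a (2 ^ a - 1 - x)) (fun x hx => ?_) g3)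
      (le_of_eq (congrArg _ ?_)) fun σ₃ ⟨e1, e2, e3⟩ => ?_) le_rfl fun σ' h => h
  · by_contra hcon
    exact hx (corr_eq_zero _ hcon _)
  -- Complementation is a bijection between the support of the coefficients and the occurring
  -- patterns.
  · rw [patterns, card_filter, card_filter,
      sum_range_reflect (fun x => if 0 < pattern n m k row S a x then 1 else 0)]
  · refine ⟨fun r hr => by rw [e1 r hr, g1 r (by omega), h1 r hr],
      fun c hc => by rw [e2, g2 c hc, h2 c hc], ?_⟩
    rw [e3, sum_corr_eq hS (show n = a + (n - a) by omega), feasible_iff]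

end

end SubsetTransform

/-! ### The complete algorithm: decision, self-reduction and output -/

namespace SubsetTransform

open Finset RAM RAM.Prog

/-- Reads the sizes and computes the addresses of the data structures. -/
def setupProg : Prog :=
  asg 1 (.ld 0) ;; asg 2 (.ld 1) ;; asg 3 (.ld 2) ;; asg 5 (3 + .r 2 * .r 1) ;;
  asg 6 (.r 5 + .r 2) ;; asg 7 1 ;; forDo 8 (.r 1) (asg 7 (2 * .r 7))

/-- Drops every member of the family that is not needed for a solution. -/
def greedyProg : Prog :=
  forDo 8 (.r 2) (put (.r 5 + .r 8) 0 ;; decideProg ;;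
    Prog.cond (.r 10) .skip (put (.r 5 + .r 8) 1))

/-- The first test is `k ≤ m`; without it the loop up to `k` in `evalProg` could be exponential in
the binary length of `k`. Register `0` starts as `0`, the answer for no solution, and is written
only after a solution has been copied to the output cells. -/
def coverProg : Prog :=
  setupProg ;;
  Prog.cond (.r 2 + 1 - .r 3)
    (forDo 8 (.r 2) (put (.r 5 + .r 8) 1) ;; decideProg ;;
      Prog.cond (.r 10)
        (greedyProg ;; forDo 8 (.r 2) (put (.r 8) (.ld (.r 5 + .r 8))) ;; asg 0 1)
        .skip)
    .skip

section

variable {n m k M a A U : ℕ} {row : ℕ → Finset ℕ} {S : Finset ℕ} {σ : Store}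

def decideBound (n m k : ℕ) : ℕ :=
  (n + 1) * (evalSteps n m k + 18 * n + 52) + 31 + 2 * evalSteps n m k

/-- Search and correction do polynomially many passes over at most `2 ^ a` entries, and the balance
condition `hq'` limits the final sum to `2 * 2 ^ a` evaluations. -/
theorem decideSteps_le (ha : a ≤ n) {q : ℕ} (hq : q ≤ 2 ^ a)
    (hq' : q * 2 ^ (n - a) ≤ 2 * 2 ^ a) :
    decideSteps n m k a q ≤ 2 ^ a * decideBound n m k := by
  have h1 : 1 ≤ 2 ^ a := Nat.one_le_two_pow
  have htr : transSteps a ≤ 2 ^ a * (9 * n + 3) := by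
    unfold transSteps
    calc 3 + a * (5 + 4 * 2 ^ a) ≤ 2 ^ a * 3 + n * (2 ^ a * 5 + 4 * 2 ^ a) := by gcongr <;> omega
      _ = _ := by ring
  have htr' : ∀ x ≤ a, transSteps x ≤ transSteps a := fun x hx => by
    unfold transSteps; gcongr; norm_num
  have hse : ∀ x ∈ range (a + 1), searchSteps n m k x ≤
      2 ^ a * (evalSteps n m k + 9 * n + 31) := fun x hx => by
    have hx' : x ≤ a := by have := mem_range.1 hx; omega
    unfold searchSteps
    calc _ ≤ 2 ^ a * (evalSteps n m k + 8) + 2 ^ a * (9 * n + 3) + 2 ^ a * 20 := by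
          gcongr
          · norm_num
          · exact (htr' x hx').trans htr
          · omega
      _ = _ := by ring
  have hs := sum_le_sum hse
  rw [sum_const, card_range, smul_eq_mul] at hs
  unfold decideSteps corrSteps sumSteps
  calc _ ≤ 2 ^ a * 5 + (n + 1) * (2 ^ a * (evalSteps n m k + 9 * n + 31)) +
        (2 ^ a * 4 + 2 ^ a * 3 + (n + 1) * (2 ^ a * 10 + 2 ^ a * 8 + 2 ^ a * (9 * n + 3)) +
        (2 ^ a * 3 + 6 * 2 ^ a + 2 * 2 ^ a * (evalSteps n m k + 4) + 2 * 2 ^ a)) := by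
        gcongr
        · omega
        · exact hs.trans (by gcongr)
        · omega
        · omega
        · omega
    _ = _ := by unfold decideBound; ring

/-- `A` belongs to the analysis only. Patterns number at most `U`, so the search stops at or before
`A`. Passing to a smaller `S` removes unions, so one `A` serves for all calls made by the
self-reduction. -/
theorem runs_decide_of_le (hF : Fits n m k M) (hS : S ⊆ range m) (hE : Env n m k row S σ)
    (hAn : A ≤ n) (hA : (U + 1) * 2 ^ (n - A) ≤ 2 * 2 ^ A)
    (hU : #(((range m).powersetCard k).image fun C => C.biUnion row) ≤ U) :
    Runs M decideProg σ (2 ^ A * decideBound n m k) fun σ' =>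
      (∀ r < 10, σ'.reg r = σ.reg r) ∧ (∀ c < 3 + m * n + m, σ'.mem c = σ.mem c) ∧
      (0 < σ'.reg 10 ↔ Feasible n k row S) := by
  classical
  have hfew : Few n m k row S A := by
    refine le_trans (Nat.mul_le_mul_right _ (Nat.succ_le_succ ?_)) hA
    exact (card_pattern_le hS hAn).trans
      ((card_le_card (image_subset_image (powersetCard_mono hS))).trans hU)
  have hex : ∃ a, Few n m k row S a := ⟨A, hfew⟩
  have hle : Nat.find hex ≤ A := Nat.find_min' hex hfew
  have hf := Nat.find_spec hex
  refine (runs_decide hF hS hE (hle.trans hAn) hf fun x hx => Nat.find_min hex hx).mono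
    ((decideSteps_le (hle.trans hAn) patterns_le ?_).trans ?_) fun σ' h => h
  · unfold Few at hf
    rw [add_mul] at hf
    exact (Nat.le_add_right _ _).trans hf
  · exact Nat.mul_le_mul_right _ (Nat.pow_le_pow_right (by norm_num) hle)

theorem Feasible.mono {S S' : Finset ℕ} (h : Feasible n k row S) (hS : S ⊆ S') :
    Feasible n k row S' := by
  obtain ⟨C, h1, h2⟩ := h
  exact ⟨C, h1.trans hS, h2⟩

theorem ind_erase (S : Finset ℕ) (i j : ℕ) : ind (S.erase i) j = if j = i then 0 else ind S j := by
  unfold ind; by_cases h : j = i <;> simp [h]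

theorem Env.set {i : ℕ} (hE : Env n m k row S σ) (hi : 8 ≤ i) (z : ℤ) :
    Env n m k row S (σ.set i z) where
  reg1 := by simp [show 1 ≠ i by omega, hE.reg1]
  reg2 := by simp [show 2 ≠ i by omega, hE.reg2]
  reg3 := by simp [show 3 ≠ i by omega, hE.reg3]
  reg5 := by simp [show 5 ≠ i by omega, hE.reg5]
  reg6 := by simp [show 6 ≠ i by omega, hE.reg6]
  reg7 := by simp [show 7 ≠ i by omega, hE.reg7]
  mem_row := hE.mem_row
  mem_act := hE.mem_act

theorem Env.put {S' : Finset ℕ} {i : ℕ} {z : ℤ} (hE : Env n m k row S σ)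
    (h : ∀ j < m, ind S' j = if j = i then z else ind S j) :
    Env n m k row S' (σ.put (3 + m * n + i) z) where
  reg1 := hE.reg1
  reg2 := hE.reg2
  reg3 := hE.reg3
  reg5 := hE.reg5
  reg6 := hE.reg6
  reg7 := hE.reg7
  mem_row j hj l hl := by
    have : (j + 1) * n ≤ m * n := Nat.mul_le_mul_right _ hj
    rw [add_mul] at this
    rw [Store.put_mem, if_neg (by omega), hE.mem_row j hj l hl]
  mem_act j hj := by
    rw [Store.put_mem, h j hj, hE.mem_act j hj]
    by_cases hji : j = i
    · simp [hji]
    · rw [if_neg (by omega), if_neg hji]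

/-- Each index is deleted and restored if feasibility is lost. In the end no member can be spared,
so the surviving family equals any `k`-subfamily of it that covers. -/
theorem runs_greedy (hF : Fits n m k M) (hS : S ⊆ range m) (hE : Env n m k row S σ)
    (hf : Feasible n k row S) (hAn : A ≤ n) (hA : (U + 1) * 2 ^ (n - A) ≤ 2 * 2 ^ A)
    (hU : #(((range m).powersetCard k).image fun C => C.biUnion row) ≤ U) :
    Runs M greedyProg σ (2 + m * (2 ^ A * decideBound n m k + 5)) fun σ' =>
      ∃ C ⊆ range m, #C = k ∧ (∀ j < n, j ∈ C.biUnion row) ∧ Env n m k row C σ' := by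
  have hM := hF.small
  have haddr := hF.addr
  refine Runs.mono (Runs.forDo hM (fun i σ' => ∃ S ⊆ range m, Env n m k row S σ' ∧
    Feasible n k row S ∧ (∀ j < i, j ∈ S → ¬ Feasible n k row (S.erase j)) ∧ σ'.reg 8 = i)
    m (1 + (2 ^ A * decideBound n m k + (1 + 1))) (by omega) ?_ ?_ ?_ ?_)
    (by ring_nf; omega) fun σ' h => h
  · exact ⟨S, hS, hE.set le_rfl _, hf, by simp, by simp⟩
  · rintro i hi σ' ⟨S, h1, h2, h3, h4, h5⟩
    exact ⟨h5, by simp [h2.reg2]⟩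
  · rintro i hi σ' ⟨S, h1, h2, h3, h4, h5⟩
    have hE₁ : Env n m k row (S.erase i) (σ'.put (3 + m * n + i) 0) :=
      h2.put fun j _ => ind_erase S i j
    have hS₁ : S.erase i ⊆ range m := (erase_subset _ _).trans h1
    refine Runs.put_seq hM (3 + m * n + i) 0 (by simp [h2.reg5, h5]) rfl (by simp)
      (Runs.seq (runs_decide_of_le hF hS₁ hE₁ hAn hA hU) fun σ₁ ⟨g1, g2, g3⟩ => ?_)
    have hE₂ : Env n m k row (S.erase i) σ₁ := hE₁.congr g1 g2
    have h8 : σ₁.reg 8 = i := by rw [g1 8 (by decide)]; simp [h5]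
    refine Runs.cond hM (fun hg => Runs.skip ?_) fun hg => ?_
    · refine ⟨h8, S.erase i, hS₁, hE₂.set le_rfl _, g3.1 hg, fun j hj hjS => ?_, by simp⟩
      rw [mem_erase] at hjS
      have hji : j < i := by omega
      -- A member found indispensable remains so when the family shrinks.
      exact fun hfe => h4 j hji hjS.2 (hfe.mono (erase_subset_erase j (erase_subset i S)))
    · have hnf : ¬ Feasible n k row (S.erase i) := fun h => absurd (g3.2 h) (by simpa using hg)
      have hiS : i ∈ S := by
        by_contra hcon
        exact hnf (by rwa [erase_eq_of_notMem hcon])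
      have hE₃ : Env n m k row S (σ₁.put (3 + m * n + i) 1) := hE₂.put fun j _ => by
        rw [ind_erase]
        by_cases hji : j = i
        · simp [hji, ind, hiS]
        · simp [hji]
      refine Runs.put' hM (3 + m * n + i) 1 (by simp [hE₂.reg5, h8]) rfl
        (by rw [abs_one]; omega) ?_
      refine ⟨by simp [h8], S, h1, hE₃.set le_rfl _, h3, fun j hj hjS => ?_, by simp⟩
      rcases Nat.lt_succ_iff_lt_or_eq.1 hj with hj | rfl
      · exact h4 j hj hjS
      · exact hnf
  · rintro σ' ⟨S, h1, h2, ⟨C, hCS, hCk, hC⟩, h4, h5⟩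
    have : C = S := by
      refine hCS.antisymm fun j hj => ?_
      by_contra hjC
      exact h4 j (mem_range.1 (h1 hj)) hj ⟨C, fun i hi => mem_erase.2
        ⟨fun h => hjC (h ▸ hi), hCS hi⟩, hCk, hC⟩
    subst this
    exact ⟨C, h1, hCk, hC, h2⟩

/-- The register and memory contents that present a correct answer. -/
def Answered (n m k : ℕ) (row : ℕ → Finset ℕ) (σ : Store) : Prop :=
  (σ.reg 0 = 1 ∧ ∃ C ⊆ range m, #C = k ∧ (∀ j < n, j ∈ C.biUnion row) ∧
    ∀ i < m, σ.mem i = ind C i) ∨ (σ.reg 0 = 0 ∧ ¬ Feasible n k row (range m))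

def coverSteps (n m k A : ℕ) : ℕ := 20 + 3 * n + 6 * m + (m + 1) * (2 ^ A * decideBound n m k + 5)

theorem runs_setup (hM : 128 ≤ M) (haddr : 3 + m * n + m + 4 * 2 ^ n ≤ M) (hk : k ≤ M)
    (hreg : ∀ r, σ.reg r = 0) (h0 : σ.mem 0 = n) (h1 : σ.mem 1 = m) (h2 : σ.mem 2 = k) :
    Runs M setupProg σ (8 + 3 * n) fun σ' => σ'.mem = σ.mem ∧ σ'.reg 0 = 0 ∧ σ'.reg 1 = n ∧
      σ'.reg 2 = m ∧ σ'.reg 3 = k ∧ σ'.reg 5 = (3 + m * n : ℕ) ∧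
      σ'.reg 6 = (3 + m * n + m : ℕ) ∧ σ'.reg 7 = (2 ^ n : ℕ) := by
  have hn2 : n < 2 ^ n := Nat.lt_two_pow_self
  have hz : ∀ z : ℕ, z ≤ M → |(z : ℤ)| ≤ M := fun z h => by rw [Nat.abs_cast]; omega
  refine Runs.mono (Runs.asg_seq hM (n : ℤ) (by simp [h0]) (hz _ (by omega))
    (Runs.asg_seq hM (m : ℤ) (by simp [h1]) (hz _ (by omega))
    (Runs.asg_seq hM (k : ℤ) (by simp [h2]) (hz _ (by omega))
    (Runs.asg_seq hM ((3 + m * n : ℕ) : ℤ) (by simp) (hz _ (by omega))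
    (Runs.asg_seq hM ((3 + m * n + m : ℕ) : ℤ) (by simp) (hz _ (by omega))
    (Runs.asg_seq hM 1 rfl (hz 1 (by omega))
    (Runs.forDo hM (fun x σ' => σ'.mem = σ.mem ∧ σ'.reg 0 = 0 ∧ σ'.reg 1 = n ∧
      σ'.reg 2 = m ∧ σ'.reg 3 = k ∧ σ'.reg 5 = (3 + m * n : ℕ) ∧
      σ'.reg 6 = (3 + m * n + m : ℕ) ∧ σ'.reg 7 = (2 ^ x : ℕ) ∧ σ'.reg 8 = x) n 1 (by omega)
      ?_ ?_ ?_ ?_))))))) (by omega) fun σ' h => h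
  · simp [hreg]
  · rintro x hx σ' ⟨g1, g2, g3, g4, g5, g6, g7, g8, g9⟩
    exact ⟨g9, by simp [g3]⟩
  · rintro x hx σ' ⟨g1, g2, g3, g4, g5, g6, g7, g8, g9⟩
    have hx2 : 2 ^ (x + 1) ≤ 2 ^ n := Nat.pow_le_pow_right (by norm_num) hx
    refine Runs.asg' hM ((2 ^ (x + 1) : ℕ) : ℤ) (by simp [g8, pow_succ, mul_comm])
      (hz _ (by omega)) ?_
    refine ⟨by simp [g9], by simp [g1], by simp [g2], by simp [g3], by simp [g4], by simp [g5],
      by simp [g6], by simp [g7], by simp, by simp⟩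
  · rintro σ' ⟨g1, g2, g3, g4, g5, g6, g7, g8, g9⟩
    exact ⟨g1, g2, g3, g4, g5, g6, g7, g8⟩

theorem runs_cover (hM : 128 ≤ M) (haddr : 3 + m * n + m + 4 * 2 ^ n ≤ M) (hk : k ≤ M)
    (hval : 2 ^ n * ((2 ^ n + 2) ^ (n + 1) * (m + 1) ^ m) ≤ M)
    (hreg : ∀ r, σ.reg r = 0) (h0 : σ.mem 0 = n) (h1 : σ.mem 1 = m) (h2 : σ.mem 2 = k)
    (hrow : ∀ i < m, ∀ j < n, σ.mem (3 + i * n + j) = ind (row i) j)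
    (hAn : A ≤ n) (hA : (U + 1) * 2 ^ (n - A) ≤ 2 * 2 ^ A)
    (hU : #(((range m).powersetCard k).image fun C => C.biUnion row) ≤ U) :
    Runs M coverProg σ (coverSteps n m (min k m) A) (Answered n m k row) := by
  refine Runs.mono (Runs.seq (runs_setup hM haddr hk hreg h0 h1 h2)
    fun σ₁ ⟨e1, e2, e3, e4, e5, e6, e7, e8⟩ => Runs.cond
    (K := (2 + m * (1 + 2)) + (2 ^ A * decideBound n m (min k m) + (1 +
      ((2 + m * (2 ^ A * decideBound n m (min k m) + 5)) + ((2 + m * (1 + 2)) + 1)))))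
    hM (fun hg => ?_) fun hg => ?_) (by simp only [coverSteps]; ring_nf; omega) fun σ' h => h
  · have hkm : k ≤ m := by simp [e4, e5] at hg; omega
    rw [min_eq_left hkm]
    have hF : Fits n m k M := ⟨hM, hkm, haddr, hval⟩
    refine Runs.seq (Q' := fun σ' => Env n m k row (range m) σ' ∧ σ'.reg 0 = 0)
      (Runs.forDo hM (fun x σ' => (∀ r < 8, σ'.reg r = σ₁.reg r) ∧
        (∀ d < 3 + m * n, σ'.mem d = σ.mem d) ∧ (∀ i < x, σ'.mem (3 + m * n + i) = 1) ∧
        σ'.reg 8 = x) m 1 (by omega) ?_ ?_ ?_ ?_)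
      fun σ₂ ⟨g1, g2⟩ => Runs.seq (runs_decide_of_le hF subset_rfl g1 hAn hA hU)
        fun σ₃ ⟨d1, d2, d3⟩ => Runs.cond hM (fun hd => ?_) fun hd =>
          Runs.mono (Runs.skip (Or.inr ⟨?_, ?_⟩)) (by omega) fun σ' h => h
    · refine ⟨fun r hr => ?_, by simp [e1], by simp, by simp⟩
      simp [show r ≠ 8 by omega]
    · rintro x hx σ' ⟨f1, f2, f3, f4⟩
      exact ⟨f4, by simp [f1, e4]⟩
    · rintro x hx σ' ⟨f1, f2, f3, f4⟩
      refine Runs.put' hM (3 + m * n + x) 1 (by simp [f1, e6, f4]) rfl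
        (by rw [abs_one]; omega) ?_
      refine ⟨by simp [f4], fun r hr => ?_, fun d hd => ?_, fun i hi => ?_, by simp⟩
      · simp [show r ≠ 8 by omega, f1 r hr]
      · simp only [Store.set_mem, Store.put_mem]
        rw [if_neg (by omega), f2 d hd]
      · simp only [Store.set_mem, Store.put_mem]
        by_cases h : i = x
        · simp [h]
        · rw [if_neg (by omega), f3 i (by omega)]
    · rintro σ' ⟨f1, f2, f3, f4⟩
      refine ⟨⟨by rw [f1 1 (by decide), e3], by rw [f1 2 (by decide), e4],
        by rw [f1 3 (by decide), e5], by rw [f1 5 (by decide), e6], by rw [f1 6 (by decide), e7],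
        by rw [f1 7 (by decide), e8], fun i hi j hj => ?_, fun i hi => ?_⟩,
        by rw [f1 0 (by decide), e2]⟩
      · have : (i + 1) * n ≤ m * n := Nat.mul_le_mul_right _ hi
        rw [add_mul] at this
        rw [f2 _ (by omega), hrow i hi j hj]
      · rw [f3 i hi, ind, if_pos (mem_range.2 hi)]
    · have hE₃ : Env n m k row (range m) σ₃ := g1.congr d1 d2
      refine Runs.seq (runs_greedy hF subset_rfl hE₃ (d3.1 hd) hAn hA hU)
        -- Copying the answer to address `0` may overwrite the input, but the target `x` always lies
        -- below the source cells still to be read.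
        fun σ₄ ⟨C, c1, c2, c3, c4⟩ => Runs.seq (Q' := fun σ' => ∀ i < m, σ'.mem i = ind C i)
        (Runs.forDo hM (fun x σ' => (∀ r < 8, σ'.reg r = σ₄.reg r) ∧
          (∀ i < m, x ≤ i → σ'.mem (3 + m * n + i) = ind C i) ∧ (∀ i < x, σ'.mem i = ind C i) ∧
          σ'.reg 8 = x) m 1 (by omega) ?_ ?_ ?_ ?_)
        fun σ₅ h₅ => Runs.asg' hM 1 rfl (by rw [abs_one]; omega)
          (Or.inl ⟨by simp, C, c1, c2, c3, by simpa using h₅⟩)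
      · refine ⟨fun r hr => ?_, fun i hi _ => by simp [c4.mem_act i hi], by simp, by simp⟩
        simp [show r ≠ 8 by omega]
      · rintro x hx σ' ⟨f1, f2, f3, f4⟩
        exact ⟨f4, by simp [f1, c4.reg2]⟩
      · rintro x hx σ' ⟨f1, f2, f3, f4⟩
        refine Runs.put' hM x (ind C x) (by simp [f4]) ?_ ?_ ?_
        · simp only [Ex.eval_ld, Ex.eval_add, Ex.eval_r, f1 5 (by decide), c4.reg5, f4]
          rw [← f2 x hx le_rfl]; congr 1
        · obtain ⟨b1, b2⟩ := ind_nonneg_le C x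
          rw [abs_of_nonneg b1]; omega
        · refine ⟨by simp [f4], fun r hr => ?_, fun i hi hxi => ?_, fun i hi => ?_, by simp⟩
          · simp [show r ≠ 8 by omega, f1 r hr]
          · simp only [Store.set_mem, Store.put_mem]
            rw [if_neg (by omega), f2 i hi (by omega)]
          · simp only [Store.set_mem, Store.put_mem]
            by_cases h : i = x
            · simp [h]
            · rw [if_neg h, f3 i (by omega)]
      · rintro σ' ⟨f1, f2, f3, f4⟩
        exact f3
    · rw [d1 0 (by decide), g2]
    · exact fun h => absurd (d3.2 h) (by simpa using hd)
  · have hkm : m < k := by simp [e4, e5] at hg; omega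
    refine Runs.mono (Runs.skip (Or.inr ⟨e2, ?_⟩)) (by omega) fun σ' h => h
    rintro ⟨C, h1, h2, -⟩
    have := card_le_card h1
    rw [card_range] at this; omega

end

end SubsetTransform

/-! ### Index sets versus subfamilies, and the input encoding -/

namespace SetCover

open Finset SubsetTransform RAM

variable (I : SetCover)

/-- The sets of the family as sets of natural numbers. -/
def row (i : ℕ) : Finset ℕ :=
  if h : i < I.m then (I.sets ⟨i, h⟩).map Fin.valEmbedding else ∅

/-- The subfamily with the given indices. -/
def subfamily (C : Finset ℕ) : Finset (Finset (Fin I.n)) :=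
  (univ.filter fun i : Fin I.m => (i : ℕ) ∈ C).image I.sets

theorem sets_mem_subfamily (C : Finset ℕ) (i : Fin I.m) :
    I.sets i ∈ I.subfamily C ↔ (i : ℕ) ∈ C := by
  simp [subfamily, I.sets_injective.eq_iff]

theorem subfamily_subset (C : Finset ℕ) : I.subfamily C ⊆ I.family :=
  image_subset_image (filter_subset _ _)

theorem card_subfamily {C : Finset ℕ} (hC : C ⊆ range I.m) : #(I.subfamily C) = #C := by
  rw [subfamily, card_image_of_injective _ I.sets_injective]
  refine card_bij (fun i _ => (i : ℕ)) (by simp) (fun i _ j _ h => Fin.ext h) fun j hj => ?_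
  exact ⟨⟨j, mem_range.1 (hC hj)⟩, by simpa using hj, rfl⟩

theorem exists_subfamily {D : Finset (Finset (Fin I.n))} (hD : D ⊆ I.family) :
    ∃ C ⊆ range I.m, I.subfamily C = D := by
  refine ⟨(univ.filter fun i : Fin I.m => I.sets i ∈ D).map Fin.valEmbedding, ?_, ?_⟩
  · intro j hj
    simp only [mem_map, mem_filter, mem_univ, true_and] at hj
    obtain ⟨i, -, rfl⟩ := hj
    simp
  · ext s
    simp only [subfamily, mem_image, mem_filter, mem_univ, true_and, mem_map,
      Fin.valEmbedding_apply]
    constructor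
    · rintro ⟨i, ⟨j, hj, hji⟩, rfl⟩
      rwa [← Fin.ext hji]
    · intro hs
      obtain ⟨i, -, rfl⟩ := mem_image.1 (hD hs)
      exact ⟨i, ⟨i, hs, rfl⟩, rfl⟩

theorem biUnion_row {C : Finset ℕ} (hC : C ⊆ range I.m) :
    C.biUnion I.row = ((I.subfamily C).biUnion id).map Fin.valEmbedding := by
  ext j
  simp only [mem_biUnion, mem_map, subfamily, mem_image, mem_filter, mem_univ, true_and, id]
  constructor
  · rintro ⟨i, hi, hj⟩
    have him := mem_range.1 (hC hi)
    rw [row, dif_pos him, mem_map] at hj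
    obtain ⟨l, hl, rfl⟩ := hj
    exact ⟨l, ⟨_, ⟨⟨i, him⟩, hi, rfl⟩, hl⟩, rfl⟩
  · rintro ⟨l, ⟨_, ⟨i, hi, rfl⟩, hl⟩, rfl⟩
    exact ⟨i, hi, by rw [row, dif_pos i.2]; exact mem_map_of_mem _ hl⟩

theorem isSolution_subfamily {C : Finset ℕ} (hC : C ⊆ range I.m) :
    I.IsSolution (I.subfamily C) ↔ #C = I.k ∧ ∀ j < I.n, j ∈ C.biUnion I.row := by
  rw [IsSolution, card_subfamily I hC, biUnion_row I hC]
  simp only [subfamily_subset, true_and, eq_univ_iff_forall]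
  refine and_congr_right fun _ => ⟨fun h j hj => ?_, fun h j => ?_⟩
  · exact mem_map.2 ⟨⟨j, hj⟩, h _, rfl⟩
  · obtain ⟨l, hl, hlj⟩ := mem_map.1 (h j j.2)
    rwa [← Fin.ext hlj]

theorem feasible_iff_exists_isSolution :
    Feasible I.n I.k I.row (range I.m) ↔ ∃ C, I.IsSolution C := by
  constructor
  · rintro ⟨C, h1, h2⟩
    exact ⟨_, (I.isSolution_subfamily h1).2 h2⟩
  · rintro ⟨D, hD⟩
    obtain ⟨C, hC, rfl⟩ := I.exists_subfamily hD.1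
    exact ⟨C, hC, (I.isSolution_subfamily hC).1 hD⟩

theorem card_image_biUnion_row_le :
    #(((range I.m).powersetCard I.k).image fun C => C.biUnion I.row) ≤ #I.unions := by
  refine (card_le_card (t := I.unions.image fun s => s.map Fin.valEmbedding) ?_).trans
    card_image_le
  intro s hs
  obtain ⟨C, hC, rfl⟩ := mem_image.1 hs
  rw [mem_powersetCard] at hC
  refine mem_image.2 ⟨_, mem_image.2 ⟨I.subfamily C, mem_powersetCard.2
    ⟨I.subfamily_subset C, by rw [I.card_subfamily hC.1, hC.2]⟩, rfl⟩, ?_⟩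
  rw [I.biUnion_row hC.1]

theorem answers_of_answered {s : State} {σ : Store} (h : Agree s σ)
    (hσ : Answered I.n I.m I.k I.row σ) : I.Answers s := by
  rcases hσ with ⟨h0, C, hC, hk, hcov, hm⟩ | ⟨h0, hf⟩
  · refine Or.inl ⟨by rw [h.1 0 (by decide), h0], I.subfamily C,
      (I.isSolution_subfamily hC).2 ⟨hk, hcov⟩, fun i => ?_⟩
    rw [h.2, hm i i.2, ind]
    simp only [sets_mem_subfamily]
  · exact Or.inr ⟨by rw [h.1 0 (by decide), h0], by rwa [← I.feasible_iff_exists_isSolution]⟩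

theorem init_mem_zero : (State.init I.input).mem 0 = I.n := rfl
theorem init_mem_one : (State.init I.input).mem 1 = I.m := rfl
theorem init_mem_two : (State.init I.input).mem 2 = I.k := rfl

theorem init_mem_row {i j : ℕ} (hi : i < I.m) (hj : j < I.n) :
    (State.init I.input).mem (3 + i * I.n + j) = ind (I.row i) j := by
  have hlt : i * I.n + j < I.m * I.n := by
    have : (i + 1) * I.n ≤ I.m * I.n := Nat.mul_le_mul_right _ hi
    rw [add_mul] at this; omega
  have hd : (⟨i * I.n + j, hlt⟩ : Fin (I.m * I.n)).divNat = ⟨i, hi⟩ := by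
    ext
    simp only [Fin.coe_divNat]
    rw [mul_comm, Nat.mul_add_div (by omega), Nat.div_eq_of_lt hj, add_zero]
  have hm : (⟨i * I.n + j, hlt⟩ : Fin (I.m * I.n)).modNat = ⟨j, hj⟩ := by
    ext
    simp only [Fin.coe_modNat]
    rw [mul_comm, Nat.mul_add_mod, Nat.mod_eq_of_lt hj]
  have h1 : (State.init I.input).mem (3 + i * I.n + j) =
      if (⟨j, hj⟩ : Fin I.n) ∈ I.sets ⟨i, hi⟩ then 1 else 0 := by
    rw [← hd, ← hm]
    rw [show 3 + i * I.n + j = (i * I.n + j) + 3 by ring]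
    change (I.input).getD (i * I.n + j + 3) 0 = _
    simp only [input, List.getD_cons_succ]
    rw [List.getD_eq_getElem _ _ (by simpa using hlt), List.getElem_ofFn]
  have h2 : j ∈ I.row i ↔ (⟨j, hj⟩ : Fin I.n) ∈ I.sets ⟨i, hi⟩ := by
    rw [row, dif_pos hi, mem_map]
    constructor
    · rintro ⟨l, hl, rfl⟩
      exact hl
    · exact fun h => ⟨_, h, rfl⟩
  rw [h1, ind]
  simp only [h2]

theorem init_mem_cases (a : ℕ) :
    (State.init I.input).mem a = I.n ∨ (State.init I.input).mem a = I.m ∨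
      (State.init I.input).mem a = I.k ∨ (State.init I.input).mem a = 0 ∨
      (State.init I.input).mem a = 1 := by
  rcases lt_or_ge a I.input.length with h | h
  · have : (State.init I.input).mem a ∈ I.input := by
      simp only [State.init, List.toFinsupp_apply]
      rw [List.getD_eq_getElem _ _ h]
      exact List.getElem_mem h
    generalize (State.init I.input).mem a = z at this ⊢
    simp only [input, List.mem_cons, List.mem_ofFn] at this
    rcases this with h | h | h | ⟨p, h⟩
    · exact Or.inl h
    · exact Or.inr (Or.inl h)
    · exact Or.inr (Or.inr (Or.inl h))
    · rw [← h]; split_ifs <;> simp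
  · refine Or.inr (Or.inr (Or.inr (Or.inl ?_)))
    simp only [State.init, List.toFinsupp_apply]
    exact List.getD_eq_default _ _ h

/-! ### Polynomial bounds in terms of the input size -/

theorem space_init_le : (State.init I.input).space ≤ 18 * (I.size + 1) ^ 2 := by
  have hlen : I.input.length = 3 + I.m * I.n := by simp [input]; ring
  have hb : ∀ z : ℕ, bits (z : ℤ) ≤ z + 1 := fun z => by
    have := Nat.size_le.2 (Nat.lt_two_pow_self (n := z))
    simpa [bits] using this
  have hsup : (State.init I.input).mem.support ⊆ range (3 + I.m * I.n) := by
    intro a ha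
    rw [Finsupp.mem_support_iff] at ha
    rw [mem_range, ← hlen]
    by_contra! hcon
    exact ha (by
      simp only [State.init, List.toFinsupp_apply]
      exact List.getD_eq_default _ _ hcon)
  have hsize : I.size = I.n + I.m + I.m * I.n + Nat.size I.k := rfl
  have hterm : ∀ a ∈ (State.init I.input).mem.support,
      bits a + bits ((State.init I.input).mem a) ≤ 6 * (I.size + 1) := by
    intro a ha
    have h1 := mem_range.1 (hsup ha)
    have h2 := hb a
    have h3 : bits ((State.init I.input).mem a) ≤ I.size + 2 := by
      rcases I.init_mem_cases a with h | h | h | h | h <;> rw [h]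
      · exact (hb _).trans (by omega)
      · exact (hb _).trans (by omega)
      · simp only [bits, Int.natAbs_natCast]; omega
      · exact (hb 0).trans (by omega)
      · exact (hb 1).trans (by omega)
    omega
  have hreg : cellBits (State.init I.input).reg = 0 := by simp [State.init, cellBits]
  rw [State.space, hreg, zero_add, cellBits, Finsupp.sum]
  refine (sum_le_card_nsmul _ _ _ hterm).trans ?_
  have hc := card_le_card hsup
  rw [card_range] at hc
  rw [smul_eq_mul]
  calc _ ≤ (3 * (I.size + 1)) * (6 * (I.size + 1)) := Nat.mul_le_mul_right _ (by omega)
    _ = _ := by ring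

theorem coverSteps_le (A : ℕ) :
    coverSteps I.n I.m (min I.k I.m) A ≤ 2 ^ A * (180 * (I.size + 1) ^ 3) := by
  have hsize : I.size = I.n + I.m + I.m * I.n + Nat.size I.k := rfl
  set q := I.size + 1 with hq
  have h1 : 1 ≤ 2 ^ A := Nat.one_le_two_pow
  have hE : evalSteps I.n I.m (min I.k I.m) ≤ 18 * q := by
    unfold evalSteps
    have : I.m * (7 + 4 * I.n) = 7 * I.m + 4 * (I.m * I.n) := by ring
    omega
  have hD : decideBound I.n I.m (min I.k I.m) ≤ 155 * q ^ 2 := by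
    unfold decideBound
    calc _ ≤ q * (18 * q + 18 * q + 52 * q) + 31 * (q * q) + 2 * (18 * (q * q)) := by
          have : q ≤ q * q := Nat.le_mul_of_pos_left _ (by omega)
          gcongr <;> omega
      _ = 155 * q ^ 2 := by ring
  unfold coverSteps
  have h3 : q ≤ q ^ 3 := Nat.le_self_pow (by norm_num) _
  calc _ ≤ 2 ^ A * (20 * q ^ 3) + q * (2 ^ A * (155 * q ^ 2)) + 2 ^ A * (5 * q ^ 3) := by
        have e1 : 20 * q ^ 3 ≤ 2 ^ A * (20 * q ^ 3) := Nat.le_mul_of_pos_left _ h1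
        have e2 : 5 * q ^ 3 ≤ 2 ^ A * (5 * q ^ 3) := Nat.le_mul_of_pos_left _ h1
        have e3 : (I.m + 1) * (2 ^ A * decideBound I.n I.m (min I.k I.m)) ≤
            q * (2 ^ A * (155 * q ^ 2)) := by gcongr; omega
        rw [mul_add]
        omega
    _ = _ := by ring

/-- A bound on the logarithms of the numbers that occur. -/
def logBound : ℕ := 10 * (I.size + 1) ^ 2

theorem unit_two_pow (L : ℕ) : unit (2 ^ L) = 24 * L + 2 := by
  have h : ((2 ^ L : ℕ) : ℤ) ^ 24 = ((2 ^ (24 * L) : ℕ) : ℤ) := by push_cast; ring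
  rw [unit, h, bits, Int.natAbs_natCast, Nat.size_pow]

theorem le_two_pow_logBound {x : ℕ} (hx : x ≤ 4 * (I.size + 1) ^ 2 + 6) :
    2 ^ x ≤ 2 ^ I.logBound := by
  refine Nat.pow_le_pow_right (by norm_num) (hx.trans ?_)
  have := Nat.le_self_pow (two_ne_zero) (I.size + 1)
  unfold logBound; omega

/-- All factors are bounded by powers of two whose exponents are quadratic in the size. Hence
numbers have polynomially many bits, and logarithmic cost exceeds the step count only by a
polynomial factor. -/
theorem val_le_two_pow_logBound :
    2 ^ I.n * ((2 ^ I.n + 2) ^ (I.n + 1) * (I.m + 1) ^ I.m) ≤ 2 ^ I.logBound := by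
  have hsize : I.size = I.n + I.m + I.m * I.n + Nat.size I.k := rfl
  have h1 : 2 ^ I.n + 2 ≤ 2 ^ (I.n + 2) := by
    have : 1 ≤ 2 ^ I.n := Nat.one_le_two_pow
    rw [pow_add]; omega
  have h2 : I.m + 1 ≤ 2 ^ I.m := Nat.lt_two_pow_self
  calc _ ≤ 2 ^ I.n * ((2 ^ (I.n + 2)) ^ (I.n + 1) * (2 ^ I.m) ^ I.m) := by gcongr
    _ = 2 ^ (I.n + ((I.n + 2) * (I.n + 1) + I.m * I.m)) := by
        rw [← pow_mul, ← pow_mul, ← pow_add, ← pow_add]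
    _ ≤ _ := by
        refine I.le_two_pow_logBound ?_
        have hq := Nat.le_self_pow (two_ne_zero) (I.size + 1)
        calc _ ≤ (I.size + 1) + ((I.size + 1 + 1) * (I.size + 1) + (I.size + 1) * (I.size + 1)) :=
              add_le_add (by omega) (add_le_add (Nat.mul_le_mul (by omega) (by omega))
                (Nat.mul_le_mul (by omega) (by omega)))
          _ = 2 * (I.size + 1) ^ 2 + 2 * (I.size + 1) := by ring
          _ ≤ _ := by omega

theorem small_le_two_pow_logBound : 128 ≤ 2 ^ I.logBound ∧
    3 + I.m * I.n + I.m + 4 * 2 ^ I.n ≤ 2 ^ I.logBound ∧ I.n + I.k ≤ 2 ^ I.logBound := by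
  have hsize : I.size = I.n + I.m + I.m * I.n + Nat.size I.k := rfl
  have hq := Nat.le_self_pow (two_ne_zero) (I.size + 1)
  have h1 : 2 ^ (I.size + 7) ≤ 2 ^ I.logBound := I.le_two_pow_logBound (by omega)
  rw [pow_add] at h1
  have h2 : I.size < 2 ^ I.size := Nat.lt_two_pow_self
  have h3 : 2 ^ I.n ≤ 2 ^ I.size := Nat.pow_le_pow_right (by norm_num) (by omega)
  have h4 : I.k < 2 ^ I.size :=
    (Nat.lt_size_self I.k).trans_le (Nat.pow_le_pow_right (by norm_num) (by omega))
  omega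

theorem bdd_init {M : ℕ} (hM : 128 ≤ M) (hn : I.n ≤ M) (hm : I.m ≤ M) (hk : I.k ≤ M) :
    Store.Bdd M ⟨fun _ => 0, (State.init I.input).mem⟩ := by
  refine ⟨fun i => by simp, fun a => ?_⟩
  change |(State.init I.input).mem a| ≤ M
  rcases I.init_mem_cases a with h | h | h | h | h <;> rw [h]
  · rw [Nat.abs_cast]; omega
  · rw [Nat.abs_cast]; omega
  · rw [Nat.abs_cast]; omega
  · simp
  · rw [abs_one]; omega

theorem W_two_pow_logBound_le : W (2 ^ I.logBound) ≤ 242000 * (I.size + 1) ^ 2 := by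
  have := Nat.one_le_pow 2 (I.size + 1) (by omega)
  rw [W, unit_two_pow, logBound]; omega

/-- The constant is `180 * 242000`, the step bound times the cost per step. -/
theorem exists_exec (A : ℕ) (hAn : A ≤ I.n) (hA : (#I.unions + 1) * 2 ^ (I.n - A) ≤ 2 * 2 ^ A) :
    ∃ t p s, Exec coverProg (State.init I.input) t p s ∧ I.Answers s ∧
      t ≤ 2 ^ A * (43560000 * (I.size + 1) ^ 5) := by
  obtain ⟨h128, haddr, hk⟩ := I.small_le_two_pow_logBound
  have hval := I.val_le_two_pow_logBound
  have hW := I.W_two_pow_logBound_le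
  generalize 2 ^ I.logBound = M at h128 haddr hk hval hW
  obtain ⟨t, p, s, σ', hx, ht, hag, -, hans⟩ := runs_cover h128 haddr (by omega) hval
    (fun _ => rfl) I.init_mem_zero I.init_mem_one I.init_mem_two
    (fun i hi j hj => I.init_mem_row hi hj) hAn hA I.card_image_biUnion_row_le
    (I.bdd_init h128 (by omega) (by omega) (by omega)) (State.init I.input)
    ⟨fun i _ => rfl, fun a => rfl⟩
  refine ⟨t, p, s, hx, I.answers_of_answered hag hans, ht.trans ?_⟩
  refine (Nat.mul_le_mul (I.coverSteps_le A) hW).trans (le_of_eq ?_)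
  ring

end SetCover

/-! ### Balancing the prefix length against the number of unions -/

theorem mainTheorem8 :
    ∃ (P : RAM.Prog) (c : ℕ), ∀ I : SetCover,
      ∃ (t p : ℕ) (s : RAM.State),
        RAM.Exec P (RAM.State.init I.input) t p s ∧
        I.Answers s ∧
        ∀ α : ℝ,
          IsGreatest {a : ℝ | 0 < a ∧ a ≤ 1 / 2 ∧
            (I.unions.card : ℝ) ≤ (2 : ℝ) ^ ((1 - a) * (I.n : ℝ))} α →
          (t : ℝ) ≤ c * ((I.size : ℝ) + 1) ^ c * (2 : ℝ) ^ ((1 - α / 2) * (I.n : ℝ)) ∧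
          (p : ℝ) ≤ c * ((I.size : ℝ) + 1) ^ c * (2 : ℝ) ^ (I.n : ℝ) := by
  classical
  -- `c` serves as factor and as exponent: it has to exceed `87120000` for the time, `43560018` for
  -- the space and `5` for the degree.
  obtain ⟨c, hc⟩ : ∃ c : ℕ, 100000000 ≤ c := ⟨_, le_rfl⟩
  have hcR : (100000000 : ℝ) ≤ c := by exact_mod_cast hc
  refine ⟨SubsetTransform.coverProg, c, fun I => ?_⟩
  -- `A = n` is always admissible because there are at most `2 ^ n` unions; with `A ≤ n` this also
  -- yields the space bound.
  have hex : ∃ A, A ≤ I.n ∧ (I.unions.card + 1) * 2 ^ (I.n - A) ≤ 2 * 2 ^ A := by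
    refine ⟨I.n, le_rfl, ?_⟩
    have h := Finset.card_le_univ I.unions
    rw [Fintype.card_finset, Fintype.card_fin] at h
    have : 1 ≤ 2 ^ I.n := Nat.one_le_two_pow
    simp only [Nat.sub_self, pow_zero, mul_one]
    omega
  obtain ⟨hAn, hA⟩ := Nat.find_spec hex
  obtain ⟨t, p, s, hx, hans, ht⟩ := I.exists_exec _ hAn hA
  refine ⟨t, p, s, hx, hans, fun α hα => ?_⟩
  obtain ⟨⟨hα0, hα1, hU⟩, -⟩ := hα
  set A := Nat.find hex with hAdef
  have hq1 : (1 : ℝ) ≤ (I.size : ℝ) + 1 := le_add_of_nonneg_left (by positivity)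
  have hpoly : ((I.size : ℝ) + 1) ^ 5 ≤ ((I.size : ℝ) + 1) ^ c :=
    pow_le_pow_right₀ hq1 (by omega)
  have htR : (t : ℝ) ≤ 2 ^ A * (43560000 * ((I.size : ℝ) + 1) ^ 5) := by exact_mod_cast ht
  have hn0 : (0 : ℝ) ≤ I.n := by positivity
  constructor
  · set y : ℝ := (1 - α / 2) * I.n with hy
    have hy0 : 0 ≤ y := mul_nonneg (by linarith) hn0
    have hyn : y ≤ I.n := by rw [hy]; nlinarith
    have hcn : ⌈y⌉₊ ≤ I.n := Nat.ceil_le.2 hyn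
    -- With `y = (1 - α/2) n`, the product `2^((1-α)n) * 2^(αn/2)` is exactly `2^y`. The `+ 1`
    -- contributes `2^(αn/2) ≤ 2^y`, which the factor `2` in the balance condition absorbs.
    have hbest : A ≤ ⌈y⌉₊ := by
      refine Nat.find_min' hex ⟨hcn, ?_⟩
      have h1 : (2 : ℝ) ^ y ≤ 2 ^ (⌈y⌉₊ : ℝ) :=
        Real.rpow_le_rpow_of_exponent_le (by norm_num) (Nat.le_ceil y)
      have h2 : (2 : ℝ) ^ ((I.n - ⌈y⌉₊ : ℕ) : ℝ) ≤ 2 ^ (α / 2 * I.n) := by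
        refine Real.rpow_le_rpow_of_exponent_le (by norm_num) ?_
        rw [Nat.cast_sub hcn]
        have := Nat.le_ceil y
        have : y = I.n - α / 2 * I.n := by rw [hy]; ring
        linarith
      have h3 : (2 : ℝ) ^ (α / 2 * I.n) ≤ 2 ^ y :=
        Real.rpow_le_rpow_of_exponent_le (by norm_num) (by rw [hy]; nlinarith)
      have h4 : (2 : ℝ) ^ ((1 - α) * I.n) * 2 ^ (α / 2 * I.n) = 2 ^ y := by
        rw [← Real.rpow_add (by norm_num)]; congr 1; rw [hy]; ring
      have h5 : ((I.unions.card : ℝ) + 1) * 2 ^ ((I.n - ⌈y⌉₊ : ℕ) : ℝ) ≤ 2 * 2 ^ (⌈y⌉₊ : ℝ) := by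
        calc _ ≤ ((2 : ℝ) ^ ((1 - α) * I.n) + 1) * 2 ^ (α / 2 * I.n) := by gcongr
          _ = 2 ^ y + 2 ^ (α / 2 * I.n) := by rw [add_mul, h4, one_mul]
          _ ≤ _ := by linarith
      rw [Real.rpow_natCast, Real.rpow_natCast] at h5
      exact_mod_cast h5
    -- Rounding `y` up costs at most another factor `2`.
    have hAy : (2 : ℝ) ^ A ≤ 2 * 2 ^ y := by
      rw [← Real.rpow_natCast, ← Real.rpow_one_add' (by norm_num) (by linarith)]
      refine Real.rpow_le_rpow_of_exponent_le (by norm_num) ?_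
      have := Nat.ceil_lt_add_one hy0
      have : (A : ℝ) ≤ ⌈y⌉₊ := by exact_mod_cast hbest
      linarith
    calc (t : ℝ) ≤ 2 ^ A * (43560000 * ((I.size : ℝ) + 1) ^ 5) := htR
      _ ≤ (2 * 2 ^ y) * (43560000 * ((I.size : ℝ) + 1) ^ c) := by gcongr
      _ = 87120000 * ((I.size : ℝ) + 1) ^ c * 2 ^ y := by ring
      _ ≤ _ := by gcongr; linarith
  · have hsp := hx.space_le.1
    have hin := I.space_init_le
    have hpR : (p : ℝ) ≤ 18 * ((I.size : ℝ) + 1) ^ 2 + t := by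
      exact_mod_cast (show p ≤ 18 * (I.size + 1) ^ 2 + t by omega)
    have h2n : (1 : ℝ) ≤ 2 ^ I.n := one_le_pow₀ (by norm_num)
    have hAn' : (2 : ℝ) ^ A ≤ 2 ^ I.n := pow_le_pow_right₀ (by norm_num) hAn
    have hsq : ((I.size : ℝ) + 1) ^ 2 ≤ ((I.size : ℝ) + 1) ^ c :=
      pow_le_pow_right₀ hq1 (by omega)
    rw [Real.rpow_natCast]
    set Z : ℝ := ((I.size : ℝ) + 1) ^ c with hZ
    have hZ0 : 0 ≤ Z := by positivity
    calc (p : ℝ) ≤ 18 * Z * 2 ^ I.n + 2 ^ I.n * (43560000 * Z) := by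
          refine hpR.trans (add_le_add ?_ (htR.trans (by gcongr)))
          nlinarith
      _ = 43560018 * Z * 2 ^ I.n := by ring
      _ ≤ _ := by gcongr; linarith
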